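/- **Setting.** Let $C$ be a finite set of colours. All graphs below are weakly connected directed graphs without self-loops and without multiple arcs, with arcs coloured by $C$. A *deterministic iterated graph system* consists of a finite graph $\Xi^0$ with at least one arc and, for each $i\in C$, a finite rule graph $R_i$ with two marked nodes $A,B$ at (undirected) distance $\mathrm d_{R_i}(A,B)\ge 2$. The graph $\Xi^{n+1}$ arises from $\Xi^n$ by replacing every arc $a$, of colour $i$ say, by a copy of $R_i$, where the node $A$ of $R_i$ is identified with the beginning node of $a$ and the node $B$ with its ending node. Thus $V(\Xi^0)\subset V(\Xi^1)\subset\cdots$. *Matrices.* Let $\mathbf M=(m_{ij})_{i,j\in C}$, where $m_{ij}$ is the number of $j$-coloured arcs of $R_i$. Let $\mathcal D$ be the finite set of all matrices obtained by choosing, for every $i$ independently, a simple path $P_i$ between $A$ and $B$ in the undirected graph underlying $R_i$ and taking as $(i,j)$ entry the number of $j$-coloured arcs of $P_i$. Let $\rho$ denote the spectral radius and $\rho_{\min}(\mathcal D)=\min_{\mathbf D\in\mathcal D}\rho(\mathbf D)$. The system is *primitive* if $\mathbf M$ and all $\mathbf D\in\mathcal D$ are primitive matrices. *Graph limit.* Distances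 and diameters $\Delta$ ignore directions. Let $\mathrm d_{\hat\Xi^n}=\mathrm d_{\Xi^n}/\Delta(\Xi^n)$. The graph limit $\Xi$ has node set $V(\Xi)=\bigcup_n V(\Xi^n)$ with $\mathrm d_{\hat\Xi}(x,y)=\lim_n \mathrm d_{\hat\Xi^n}(x,y)$. Its arcs are the sequences $e=(e_n)_{n\ge 0}$ such that $e_n$ is an arc of $\Xi^n$ and $e_{n+1}$ lies in the copy of the rule graph that replaces $e_n$. Writing $e_n^-,e_n^+$ for the beginning and ending node of $e_n$, the arc $e$ has length $\lim_n\mathrm d_{\hat\Xi}(e_n^-,e_n^+)=0$, and the distance of two arcs is $\mathrm d_{\hat\Xi}(e,f)=\lim_n\mathrm d_{\hat\Xi}(e_n^-,f_n^-)$. *Dimensions.* Let $N_\ell$ be the minimum number of sets of $\mathrm d_{\hat\Xi}$-diameter strictly less than $\ell$ needed to cover $V(\Xi)$, and let $\dim_B(\Xi)=\lim_{\ell\to0}\frac{\log N_\ell}{-\log\ell}$ if this limit exists. For $X=V(\Xi)$ or $X=E(\Xi)$ (the set of arcs of $\Xi$) and $s\ge0$ let $$\mathcal H^s(X)=\lim_{\delta\to0}\inf\Big\{\sum_{i\ge1}\Delta(U_i)^s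 : X=\bigcup_{i\ge1}U_i,\ \Delta(U_i)\le\delta\Big\},$$ where $\Delta(U)$ is the $\mathrm d_{\hat\Xi}$-diameter of $U$; put $\dim_{HV}(\Xi)=\inf\{s\ge 0:\mathcal H^s(V(\Xi))=0\}$, $\dim_{HE}(\Xi)=\inf\{s\ge 0:\mathcal H^s(E(\Xi))=0\}$ and $\dim_H(\Xi)=\max\{\dim_{HV}(\Xi),\dim_{HE}(\Xi)\}$. **Theorem.** For every deterministic primitive iterated graph system, the limits defining $\Xi$ (its node distances, the zero length of its arcs, and its arc distances) exist as stated above, $N_\ell<\infty$ for all $\ell>0$, the Minkowski dimension of $\Xi$ exists, and $$\dim_B(\Xi)=\dim_H(\Xi)=\frac{\log\rho(\mathbf M)}{\log\rho_{\min}(\mathcal D)}.$$ -/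

import Mathlib

open Filter Topology
open scoped ENNReal NNReal

universe u v

/-- A finite nonempty weakly connected directed graph without self-loops and without multiple arcs,
whose arcs carry colours in `C`. (A pair of opposite arcs between two nodes is permitted.) -/
structure ColouredDigraph (C : Type u) where
  V : Type v
  E : Type v
  finite_V : Finite V
  finite_E : Finite E
  src : E → V
  tgt : E → V
  col : E → C
  loopless : ∀ e, src e ≠ tgt e
  simple : ∀ e f, src e = src f → tgt e = tgt f → e = f
  connected : (SimpleGraph.fromRel fun x y => ∃ e, src e = x ∧ tgt e = y).Connected

namespace ColouredDigraph

variable {C : Type u} (G : ColouredDigraph.{u, v} C)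

/-- The underlying undirected graph. -/
def underlying : SimpleGraph G.V :=
  SimpleGraph.fromRel fun x y => ∃ e, G.src e = x ∧ G.tgt e = y

/-- The colour vector `χ(F)` of a set `F` of arcs: the number of arcs of each colour in `F`. -/
noncomputable def chi (F : Set G.E) (j : C) : ℕ := {e | e ∈ F ∧ G.col e = j}.ncard

/-- The simple paths between `a` and `b` in the undirected graph underlying `G`, each recorded by
its set of arcs: every edge of the path is contributed by exactly one arc of the set. -/
def pathArcSets (a b : G.V) : Set (Set G.E) :=
  {F | ∃ P : G.underlying.Walk a b, P.IsPath ∧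
    Set.BijOn (fun e => s(G.src e, G.tgt e)) F {d | d ∈ P.edges}}

end ColouredDigraph

/-- A deterministic iterated graph system with colour set `C`: an initial graph with at least one
arc, and for each colour a rule graph with two marked nodes `A`, `B` at distance at least `2`. -/
structure IteratedGraphSystem (C : Type u) where
  init : ColouredDigraph.{u, v} C
  rule : C → ColouredDigraph.{u, v} C
  A : ∀ i, (rule i).V
  B : ∀ i, (rule i).V
  init_nonempty : Nonempty init.E
  two_le_dist : ∀ i, 2 ≤ (rule i).underlying.dist (A i) (B i)

namespace IteratedGraphSystem

variable {C : Type u} (S : IteratedGraphSystem.{u, v} C)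

/-! ### Matrices -/

/-- The substitution matrix: `M i j` is the number of `j`-coloured arcs of the rule graph `R i`. -/
noncomputable def M : Matrix C C ℝ := fun i j => (S.rule i).chi Set.univ j

/-- The set `𝒟` of path matrices: the `i`-th row is the colour vector of a simple path between
`A` and `B` in `R i`, the paths for different `i` being chosen independently. -/
def pathMatrices : Set (Matrix C C ℝ) :=
  {D | ∃ F : ∀ i, Set (S.rule i).E,
    (∀ i, F i ∈ (S.rule i).pathArcSets (S.A i) (S.B i)) ∧ ∀ i j, D i j = (S.rule i).chi (F i) j}

/-- The system is primitive: `M` and all path matrices are primitive. -/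
def IsPrimitive [Fintype C] [DecidableEq C] : Prop :=
  S.M.IsPrimitive ∧ ∀ D ∈ S.pathMatrices, D.IsPrimitive

/-- The spectral radius of a real square matrix: the maximal modulus of its complex eigenvalues. -/
noncomputable def specRadius [Fintype C] [DecidableEq C] (X : Matrix C C ℝ) : ℝ :=
  (spectralRadius ℂ (X.map (fun x : ℝ => (x : ℂ)))).toReal

/-- `ρ_min(𝒟)`, the smallest spectral radius of a path matrix (`𝒟` is finite and nonempty). -/
noncomputable def rhoMin [Fintype C] [DecidableEq C] : ℝ := sInf (specRadius '' S.pathMatrices)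

/-! ### The graphs `Ξ^n` -/

/-- The arcs of `Ξ^n` with their colours: an arc of `Ξ^(n+1)` is an arc `a` of `Ξ^n` together with
an arc of the rule graph that replaces `a`. -/
def level : ℕ → (T : Type v) × (T → C)
  | 0 => ⟨S.init.E, S.init.col⟩
  | n + 1 => ⟨(a : (level n).1) × (S.rule ((level n).2 a)).E,
      fun p => (S.rule ((level n).2 p.1)).col p.2⟩

/-- The arcs of `Ξ^n`. -/
abbrev Arc (n : ℕ) : Type v := (S.level n).1

/-- The colour of an arc of `Ξ^n`. -/
abbrev colour (n : ℕ) (a : S.Arc n) : C := (S.level n).2 a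

/-- The arc of `Ξ^n` out of whose substitution an arc of `Ξ^(n+1)` arises. -/
def parent (n : ℕ) (e : S.Arc (n + 1)) : S.Arc n := e.1

/-- The nodes of the graph limit, i.e. the union of the increasing node sets of the `Ξ^n`: the
nodes of `Ξ^0`, and for each `n` and each arc `a` of `Ξ^n` the nodes other than `A` and `B` of the
copy of the rule graph that replaces `a`. -/
abbrev Node : Type v :=
  S.init.V ⊕ ((n : ℕ) × (a : S.Arc n) ×
    {x : (S.rule (S.colour n a)).V // x ≠ S.A (S.colour n a) ∧ x ≠ S.B (S.colour n a)})

/-- The first `n` such that the node belongs to `Ξ^n`. -/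
def birth : S.Node → ℕ
  | Sum.inl _ => 0
  | Sum.inr p => p.1 + 1

/-- The node set of `Ξ^n`. -/
def nodes (n : ℕ) : Set S.Node := {x | S.birth x ≤ n}

open scoped Classical in
/-- The node of `Ξ^(n+1)` that a node `x` of the rule graph becomes when the rule graph replaces the
arc `a` of `Ξ^n` with beginning node `p` and ending node `q`. -/
noncomputable def place {n : ℕ} (a : S.Arc n) (p q : S.Node)
    (x : (S.rule (S.colour n a)).V) : S.Node :=
  if hA : x = S.A (S.colour n a) then p
  else if hB : x = S.B (S.colour n a) then q
  else Sum.inr ⟨n, a, x, hA, hB⟩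

/-- The beginning node and the ending node of an arc of `Ξ^n`. -/
noncomputable def ends : (n : ℕ) → S.Arc n → S.Node × S.Node
  | 0, e => (Sum.inl (S.init.src e), Sum.inl (S.init.tgt e))
  | n + 1, ⟨a, e⟩ =>
      (S.place a (ends n a).1 (ends n a).2 ((S.rule (S.colour n a)).src e),
       S.place a (ends n a).1 (ends n a).2 ((S.rule (S.colour n a)).tgt e))

/-- The undirected graph underlying `Ξ^n`; its nodes are those in `S.nodes n`, while the nodes of
the graph limit that do not belong to `Ξ^n` are isolated. -/
def graph (n : ℕ) : SimpleGraph S.Node :=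
  SimpleGraph.fromRel fun x y => ∃ e : S.Arc n, (S.ends n e).1 = x ∧ (S.ends n e).2 = y

/-- The diameter `Δ(Ξ^n)`. -/
noncomputable def graphDiam (n : ℕ) : ℕ :=
  sSup {d | ∃ x ∈ S.nodes n, ∃ y ∈ S.nodes n, d = (S.graph n).dist x y}

/-- The distance in the scaled graph of `Ξ^n`, where each arc has weight `1 / Δ(Ξ^n)`. It is
meaningful for `x` and `y` in `S.nodes n`. -/
noncomputable def scaledDist (n : ℕ) (x y : S.Node) : ℝ :=
  ((S.graph n).dist x y : ℝ) / (S.graphDiam n : ℝ)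

/-! ### The graph limit `Ξ` -/

/-- The distance between nodes of the graph limit: the limit of their scaled distances. -/
noncomputable def limitDist (x y : S.Node) : ℝ :=
  limUnder atTop fun n => S.scaledDist n x y

/-- The arcs of the graph limit: the infinite sequences of arcs, one in each `Ξ^n`, each of which
arises from the substitution of the preceding one. -/
def LimitArc : Type v := {e : ∀ n, S.Arc n // ∀ n, S.parent n (e (n + 1)) = e n}

/-- The distance between arcs of the graph limit. An arc of the graph limit has weight `0`, so it
is located at the common limit of the beginning nodes and of the ending nodes of its members. -/
noncomputable def limitArcDist (e f : S.LimitArc) : ℝ :=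
  limUnder atTop fun n => S.limitDist (S.ends n (e.1 n)).1 (S.ends n (f.1 n)).1

/-- The limits that define the graph limit exist: the scaled distance of any two nodes converges,
the arcs of the graph limit have weight `0`, and the distance of any two of them is defined. -/
def LimitExists : Prop :=
  (∀ x y : S.Node, Tendsto (fun n => S.scaledDist n x y) atTop (𝓝 (S.limitDist x y))) ∧
  (∀ e : S.LimitArc,
    Tendsto (fun n => S.limitDist (S.ends n (e.1 n)).1 (S.ends n (e.1 n)).2) atTop (𝓝 0)) ∧
  (∀ e f : S.LimitArc,
    Tendsto (fun n => S.limitDist (S.ends n (e.1 n)).1 (S.ends n (f.1 n)).1) atTop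
      (𝓝 (S.limitArcDist e f)))

end IteratedGraphSystem

/-! ### Dimensions of a set `α` with respect to a distance function `δ` on it -/

namespace GraphDim

variable {α : Type v} (δ : α → α → ℝ)

/-- The diameter of a set. -/
noncomputable def diam (U : Set α) : ℝ≥0∞ := ⨆ x ∈ U, ⨆ y ∈ U, ENNReal.ofReal (δ x y)

/-- `N_ℓ`: the minimum number of boxes of diameter strictly less than `ℓ` that cover `α`. -/
noncomputable def coveringNumber (ℓ : ℝ) : ℕ∞ :=
  ⨅ (𝒰 : Set (Set α)) (_ : ⋃₀ 𝒰 = Set.univ) (_ : ∀ U ∈ 𝒰, diam δ U < ENNReal.ofReal ℓ), 𝒰.encard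

/-- The Minkowski dimension exists and equals `d`: all covering numbers are finite and
`log N_ℓ / (- log ℓ)` tends to `d` as `ℓ` tends to `0` from above. -/
def HasMinkowskiDim (d : ℝ) : Prop :=
  (∀ ℓ : ℝ, 0 < ℓ → coveringNumber δ ℓ ≠ ⊤) ∧
  Tendsto (fun ℓ : ℝ => Real.log ((coveringNumber δ ℓ).toNat : ℝ) / (-Real.log ℓ))
    (𝓝[>] 0) (𝓝 d)

/-- The `s`-dimensional Hausdorff measure of `α`: the limit as `r → 0` (a supremum, by monotonicity)
of the infimum of `∑ Δ(U i) ^ s` over all countable covers by sets of diameter at most `r`. -/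
noncomputable def hausdorffMeasure (s : ℝ≥0) : ℝ≥0∞ :=
  ⨆ (r : ℝ) (_ : 0 < r), ⨅ (U : ℕ → Set α) (_ : ⋃ i, U i = Set.univ)
    (_ : ∀ i, diam δ (U i) ≤ ENNReal.ofReal r), ∑' i, diam δ (U i) ^ (s : ℝ)

/-- The Hausdorff dimension of `α`: the infimum of all `s ≥ 0` for which the `s`-dimensional
Hausdorff measure is zero. -/
noncomputable def hausdorffDim : ℝ≥0∞ := ⨅ (s : ℝ≥0) (_ : hausdorffMeasure δ s = 0), (s : ℝ≥0∞)

end GraphDim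

namespace IteratedGraphSystem

variable {C : Type u} (S : IteratedGraphSystem.{u, v} C)

/-- The Minkowski dimension of the graph limit exists and equals `d`; boxes cover the nodes. -/
def HasMinkowskiDim (d : ℝ) : Prop := GraphDim.HasMinkowskiDim S.limitDist d

/-- The graph Hausdorff dimension of the graph limit: the maximum of its vertex Hausdorff dimension
(from covers of the nodes) and its edge Hausdorff dimension (from covers of the arcs). -/
noncomputable def hausdorffDim : ℝ≥0∞ :=
  max (GraphDim.hausdorffDim S.limitDist) (GraphDim.hausdorffDim S.limitArcDist)

end IteratedGraphSystem

/-! Put λ = ρ_min(𝒟) and ρ = ρ(M). The theorem rests on two facts: distances in Ξ^n grow like λ^n,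
and the number of arcs grows like ρ^n.

Distances. Give every arc a weight depending on its colour. Between old nodes, the distance in
Ξ^(n+1) for the weights ω is the distance in Ξ^n for the weights `substWeight ω`, whose entry at i
is the weighted distance of A and B in R_i (`levelDist_succ`). Weighted distances are defined
dually, as suprema of potentials, so lower bounds follow by extending potentials into the new
copies. For finite weights the map `substWeight` is the minimum of the linear maps D in 𝒟, attained
row by row. Since rows are chosen independently, the Perron vector x of a matrix of minimal radius
satisfies λx ≤ Dx for all D in 𝒟: otherwise exchanging one row would lower the radius. Hence x is an
eigenvector of the minimum, and the iterates from the constant weight 1, divided by λ^k, converge to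
a multiple of x (`exists_tendsto_iterate_min`). So distances divided by λ^n converge to a positive
metric `ldist`. Every node lies within O(λ^(-m)) of Ξ^m, so diameters divided by λ^n converge as
well, and so do the scaled distances.

Upper bounds. Ξ^n has O(ρ^n) arcs, and the limit arcs passing through one of them form a set of
diameter O(λ^(-n)), a cylinder. Balls of radius O(λ^(-n)) about the ends of these arcs cover the
nodes. Both dimensions are therefore at most log ρ / log λ.

Lower bounds. A mass distribution argument on cylinders meets one obstacle: different cylinders may
share end nodes and then need not be separated. Only descendants detached from the ends of their
ancestor are therefore retained. A limit arc detached between levels m and n is at distance at least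
cλ^(-n) from every limit arc in another cylinder of level m (`le_limitArcDist_of_detached`). Little
mass is lost: no rule arc joins A and B, so the weight of the descendants touching a fixed node
grows by a factor of at most θρ per generation, with θ < 1 (`sum_touching_le`). For λ^s < ρ and K
large, the detached descendants K generations later carry at least λ^(sK) times the weight of the
ancestor. A cover of too small s-cost is then missed by some branch of the retained tree
(`exists_le_tsum_of_cover`). This bounds the edge Hausdorff dimension and, because a finite cover of
the nodes induces one of the limit arcs, also the covering numbers. The node set is countable, so
its Hausdorff dimension is 0 and does not affect the maximum. -/

/-! ### Nonnegative and primitive matrices -/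

namespace Matrix

variable {n : Type*} [Fintype n]

theorem mulVec_mono {A : Matrix n n ℝ} (hA : ∀ i j, 0 ≤ A i j) {x y : n → ℝ}
    (h : ∀ i, x i ≤ y i) (i : n) : (A *ᵥ x) i ≤ (A *ᵥ y) i :=
  Finset.sum_le_sum fun j _ => mul_le_mul_of_nonneg_left (h j) (hA i j)

theorem mulVec_pos_of_pos {A : Matrix n n ℝ} (hA : ∀ i j, 0 < A i j) {x : n → ℝ}
    (hx : ∀ i, 0 ≤ x i) {j : n} (hj : 0 < x j) (i : n) : 0 < (A *ᵥ x) i :=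
  Finset.sum_pos' (fun k _ => mul_nonneg (hA i k).le (hx k)) ⟨j, Finset.mem_univ j,
    mul_pos (hA i j) hj⟩

theorem mulVec_nonneg_of_nonneg {A : Matrix n n ℝ} (hA : ∀ i j, 0 ≤ A i j) {x : n → ℝ}
    (hx : ∀ i, 0 ≤ x i) (i : n) : 0 ≤ (A *ᵥ x) i :=
  Finset.sum_nonneg fun k _ => mul_nonneg (hA i k) (hx k)

variable [DecidableEq n]

theorem pow_mulVec_comm (A : Matrix n n ℝ) (k : ℕ) (x : n → ℝ) :
    A *ᵥ (A ^ k *ᵥ x) = A ^ k *ᵥ (A *ᵥ x) := by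
  rw [mulVec_mulVec, mulVec_mulVec, ← pow_succ', ← pow_succ]

theorem pow_mulVec_of_eigen {A : Matrix n n ℝ} {r : ℝ} {x : n → ℝ} (h : A *ᵥ x = r • x) (k : ℕ) :
    A ^ k *ᵥ x = r ^ k • x := by
  induction k with
  | zero => simp
  | succ k ih => rw [pow_succ, ← mulVec_mulVec, h, mulVec_smul, ih, smul_smul, pow_succ']

/-- A primitive matrix that maps `x ≥ 0` above `r x`, but not to `r x`, maps some positive vector
strictly above its `r`-multiple. -/
theorem IsPrimitive.exists_pos_lt_mulVec {A : Matrix n n ℝ} (hA : A.IsPrimitive) {r : ℝ}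
    {x : n → ℝ} (hx : ∀ i, 0 ≤ x i) (hx0 : ∃ i, 0 < x i) (h : ∀ i, r * x i ≤ (A *ᵥ x) i)
    (hne : ∃ i, r * x i ≠ (A *ᵥ x) i) :
    ∃ y : n → ℝ, (∀ i, 0 < y i) ∧ ∀ i, r * y i < (A *ᵥ y) i := by
  obtain ⟨k, -, hk⟩ := hA.exists_pos_pow
  obtain ⟨j, hj⟩ := hx0
  obtain ⟨l, hl⟩ := hne
  refine ⟨A ^ k *ᵥ x, mulVec_pos_of_pos hk hx hj, fun i => ?_⟩
  -- A positive power sends the nonzero nonnegative vector Ax - rx to a strictly positive one, and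
  -- it commutes with A.
  have := mulVec_pos_of_pos hk (x := A *ᵥ x - r • x) (j := l)
    (fun i => by simpa using h i) (by simpa using lt_of_le_of_ne (h l) hl) i
  rw [mulVec_sub, mulVec_smul, ← pow_mulVec_comm] at this
  simpa using this

theorem IsPrimitive.exists_pos_mulVec_lt {A : Matrix n n ℝ} (hA : A.IsPrimitive) {r : ℝ}
    {x : n → ℝ} (hx : ∀ i, 0 < x i) (h : ∀ i, (A *ᵥ x) i ≤ r * x i)
    (hne : ∃ i, (A *ᵥ x) i ≠ r * x i) :
    ∃ y : n → ℝ, (∀ i, 0 < y i) ∧ ∀ i, (A *ᵥ y) i < r * y i := by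
  obtain ⟨k, -, hk⟩ := hA.exists_pos_pow
  obtain ⟨l, hl⟩ := hne
  refine ⟨A ^ k *ᵥ x, mulVec_pos_of_pos hk (fun i => (hx i).le) (hx l), fun i => ?_⟩
  have := mulVec_pos_of_pos hk (x := r • x - A *ᵥ x) (j := l)
    (fun i => by simpa using h i) (by simpa using lt_of_le_of_ne (h l) hl) i
  rw [mulVec_sub, mulVec_smul, ← pow_mulVec_comm] at this
  simpa using this

/-- **Perron's theorem**: a primitive matrix has a positive eigenvector. -/
theorem IsPrimitive.exists_pos_eigenvector [Nonempty n] {A : Matrix n n ℝ} (hA : A.IsPrimitive) :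
    ∃ r : ℝ, ∃ x : n → ℝ, (∀ i, 0 < x i) ∧ A *ᵥ x = r • x := by
  -- Collatz–Wielandt: maximise r subject to r x ≤ A x with x in the simplex. The upper bound on r
  -- holds automatically and is imposed only for compactness.
  set T : Set ((n → ℝ) × ℝ) :=
    {p | p.1 ∈ stdSimplex ℝ n ∧ p.2 ∈ Set.Icc 0 (∑ i, ∑ j, A i j) ∧ ∀ i, p.2 * p.1 i ≤ (A *ᵥ p.1) i}
    with hT
  have hTc : IsCompact T := by
    have h1 : IsCompact (stdSimplex ℝ n ×ˢ Set.Icc (0 : ℝ) (∑ i, ∑ j, A i j)) :=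
      (isCompact_stdSimplex ℝ n).prod isCompact_Icc
    have h2 : IsClosed {p : (n → ℝ) × ℝ | ∀ i, p.2 * p.1 i ≤ (A *ᵥ p.1) i} := by
      simp only [Set.ofPred_forall]
      refine isClosed_iInter fun i => isClosed_le (by fun_prop) ?_
      simp only [mulVec, dotProduct]
      fun_prop
    convert h1.inter_right h2 using 1
    ext p
    simp [hT, and_assoc]
  have hTn : T.Nonempty := by
    obtain ⟨i⟩ := ‹Nonempty n›
    refine ⟨(Pi.single i 1, 0), single_mem_stdSimplex ℝ i, ⟨le_rfl, ?_⟩, fun k => ?_⟩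
    · exact Finset.sum_nonneg fun i _ => Finset.sum_nonneg fun j _ => hA.nonneg i j
    · rw [zero_mul]
      exact mulVec_nonneg_of_nonneg hA.nonneg (fun j => (single_mem_stdSimplex ℝ i).1 j) k
  obtain ⟨⟨x, r⟩, ⟨hx, hr, hxr⟩, hmax⟩ := hTc.exists_isMaxOn hTn continuous_snd.continuousOn
  simp only at hx hr hxr
  have hx0 : ∃ i, 0 < x i := by
    by_contra! hcon
    have := hx.2
    have h0 : ∑ i, x i ≤ 0 := Finset.sum_nonpos fun i _ => hcon i
    linarith
  -- If equality failed in one coordinate, smoothing by a power of A would make all inequalities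
  -- strict, and a larger r would be admissible.
  have heig : ∀ i, r * x i = (A *ᵥ x) i := by
    by_contra! hne
    obtain ⟨y, hy, hyr⟩ := hA.exists_pos_lt_mulVec hx.1 hx0 hxr hne
    obtain ⟨i0, hi0⟩ := Finite.exists_min fun i => (A *ᵥ y) i / y i
    set t := (A *ᵥ y) i0 / y i0
    have hrt : r < t := by rw [lt_div_iff₀ (hy i0)]; exact hyr i0
    have hsum : 0 < ∑ i, y i := Finset.sum_pos (fun i _ => hy i) Finset.univ_nonempty
    have hz : ((∑ i, y i)⁻¹ • y) ∈ stdSimplex ℝ n :=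
      ⟨fun i => by simpa using mul_nonneg (inv_nonneg.2 hsum.le) (hy i).le, by
        simp only [Pi.smul_apply, smul_eq_mul, ← Finset.mul_sum]
        exact inv_mul_cancel₀ hsum.ne'⟩
    have hzt : ∀ i, t * ((∑ i, y i)⁻¹ • y) i ≤ (A *ᵥ ((∑ i, y i)⁻¹ • y)) i := fun i => by
      have := (le_div_iff₀ (hy i)).1 (hi0 i)
      rw [mulVec_smul]
      simp only [Pi.smul_apply, smul_eq_mul]
      rw [mul_left_comm]
      exact mul_le_mul_of_nonneg_left this (inv_nonneg.2 hsum.le)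
    have htb : t ≤ ∑ i, ∑ j, A i j := by
      set z := (∑ i, y i)⁻¹ • y
      calc t = ∑ i, t * z i := by rw [← Finset.mul_sum, hz.2, mul_one]
        _ ≤ ∑ i, ∑ j, A i j := Finset.sum_le_sum fun i _ => (hzt i).trans <|
            Finset.sum_le_sum fun j _ => by
              have : z j ≤ 1 := by
                rw [← hz.2]; exact Finset.single_le_sum (fun k _ => hz.1 k) (Finset.mem_univ j)
              exact mul_le_of_le_one_right (hA.nonneg i j) this
    have := hmax (show (((∑ i, y i)⁻¹ • y), t) ∈ T from
      ⟨hz, ⟨hr.1.trans hrt.le, htb⟩, hzt⟩)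
    simp only [Set.mem_ofPred_eq] at this
    linarith
  have heig' : A *ᵥ x = r • x := funext fun i => by simp [← heig i]
  obtain ⟨k, -, hk⟩ := hA.exists_pos_pow
  obtain ⟨j, hj⟩ := hx0
  refine ⟨r, x, fun i => ?_, heig'⟩
  have h1 := mulVec_pos_of_pos hk hx.1 hj i
  rw [pow_mulVec_of_eigen heig'] at h1
  exact pos_of_mul_pos_right h1 (pow_nonneg hr.1 k)

theorem exists_mulVec_eq_of_mem_spectrum {B : Matrix n n ℂ} {k : ℂ} (hk : k ∈ spectrum ℂ B) :
    ∃ z : n → ℂ, z ≠ 0 ∧ B *ᵥ z = k • z := by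
  rw [spectrum.mem_iff, Matrix.isUnit_iff_isUnit_det, isUnit_iff_ne_zero, not_not] at hk
  obtain ⟨z, hz, h⟩ := Matrix.exists_mulVec_eq_zero_iff.2 hk
  refine ⟨z, hz, ?_⟩
  rw [sub_mulVec, sub_eq_zero, Matrix.algebraMap_eq_diagonal] at h
  rw [← h]
  ext i
  simp [mulVec_diagonal]

/-- For a complex eigenvector `z`, the eigenvalue equation is compared with `x` at the index where
`‖z i‖ / x i` is largest. -/
theorem spectralRadius_le_of_mulVec_le {A : Matrix n n ℝ} (hA : ∀ i j, 0 ≤ A i j) {r : ℝ}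
    {x : n → ℝ} (hx : ∀ i, 0 < x i) (h : ∀ i, (A *ᵥ x) i ≤ r * x i) :
    spectralRadius ℂ (A.map (fun x : ℝ => (x : ℂ))) ≤ ENNReal.ofReal r := by
  refine iSup₂_le fun k hk => ?_
  obtain ⟨z, hz, hzk⟩ := exists_mulVec_eq_of_mem_spectrum hk
  obtain ⟨j0, hj0⟩ := Function.ne_iff.1 hz
  have : Nonempty n := ⟨j0⟩
  obtain ⟨i0, hi0⟩ := Finite.exists_max fun i => ‖z i‖ / x i
  set t := ‖z i0‖ / x i0 with ht
  have htpos : 0 < t := lt_of_lt_of_le (div_pos (norm_pos_iff.2 hj0) (hx j0)) (hi0 j0)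
  have hzt : ‖z i0‖ = t * x i0 := by rw [ht, div_mul_cancel₀ _ (hx i0).ne']
  have h1 : ‖k‖ * ‖z i0‖ ≤ r * ‖z i0‖ := by
    calc ‖k‖ * ‖z i0‖ = ‖∑ j, (A i0 j : ℂ) * z j‖ := by
          rw [← norm_mul]
          have := congrFun hzk i0
          simp only [mulVec, dotProduct, map_apply, Pi.smul_apply, smul_eq_mul] at this
          rw [this]
      _ ≤ ∑ j, A i0 j * ‖z j‖ := by
          refine (norm_sum_le _ _).trans_eq (Finset.sum_congr rfl fun j _ => ?_)
          rw [norm_mul, Complex.norm_real, Real.norm_of_nonneg (hA i0 j)]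
      _ ≤ ∑ j, A i0 j * (t * x j) := Finset.sum_le_sum fun j _ =>
          mul_le_mul_of_nonneg_left ((div_le_iff₀ (hx j)).1 (hi0 j)) (hA i0 j)
      _ = t * (A *ᵥ x) i0 := by
          simp only [mulVec, dotProduct, Finset.mul_sum]
          exact Finset.sum_congr rfl fun j _ => by ring
      _ ≤ t * (r * x i0) := mul_le_mul_of_nonneg_left (h i0) htpos.le
      _ = r * ‖z i0‖ := by rw [hzt]; ring
  have h2 : ‖k‖ ≤ r := le_of_mul_le_mul_right h1 (hzt ▸ mul_pos htpos (hx i0))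
  rw [← ENNReal.ofReal_coe_nnreal]
  exact ENNReal.ofReal_le_ofReal h2

end Matrix

/-! ### Spectral radii and their minimisation over independently chosen rows. -/

namespace IteratedGraphSystem

variable {n : Type u} [Fintype n] [DecidableEq n]

open Matrix

theorem specRadius_le {A : Matrix n n ℝ} (hA : ∀ i j, 0 ≤ A i j) {r : ℝ} (hr : 0 ≤ r)
    {x : n → ℝ} (hx : ∀ i, 0 < x i) (h : ∀ i, (A *ᵥ x) i ≤ r * x i) : specRadius A ≤ r :=
  ENNReal.toReal_le_of_le_ofReal hr (spectralRadius_le_of_mulVec_le hA hx h)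

/-- `r` is itself a complex eigenvalue, and comparison with its positive eigenvector bounds all the
others. -/
theorem specRadius_eq [Nonempty n] {A : Matrix n n ℝ} (hA : ∀ i j, 0 ≤ A i j) {r : ℝ}
    {x : n → ℝ} (hx : ∀ i, 0 < x i) (h : A *ᵥ x = r • x) : specRadius A = r := by
  obtain ⟨i⟩ := ‹Nonempty n›
  have hr : 0 ≤ r := by
    have h1 := mulVec_nonneg_of_nonneg hA (fun i => (hx i).le) i
    rw [h] at h1
    exact nonneg_of_mul_nonneg_left h1 (hx i)
  have hle := spectralRadius_le_of_mulVec_le hA hx (r := r) fun i => by rw [h]; simp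
  refine le_antisymm (ENNReal.toReal_le_of_le_ofReal hr hle) ?_
  refine (ENNReal.ofReal_le_iff_le_toReal (ne_top_of_le_ne_top ENNReal.ofReal_ne_top hle)).1 ?_
  have hmem : (r : ℂ) ∈ spectrum ℂ (A.map (fun x : ℝ => (x : ℂ))) := by
    rw [spectrum.mem_iff, Matrix.isUnit_iff_isUnit_det, isUnit_iff_ne_zero, not_not]
    refine Matrix.exists_mulVec_eq_zero_iff.1 ⟨fun i => (x i : ℂ), fun h0 => ?_, ?_⟩
    · have := congrFun h0 i
      simp only [Pi.zero_apply, Complex.ofReal_eq_zero] at this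
      exact (hx i).ne' this
    · rw [sub_mulVec, sub_eq_zero, Matrix.algebraMap_eq_diagonal]
      ext j
      have := congrArg (fun t : ℝ => (t : ℂ)) (congrFun h j)
      simp only [mulVec, dotProduct, Pi.smul_apply, smul_eq_mul, Complex.ofReal_sum,
        Complex.ofReal_mul] at this
      rw [mulVec_diagonal]
      simp [mulVec, dotProduct, this]
  refine le_trans ?_ (le_iSup₂ (α := ℝ≥0∞) (r : ℂ) hmem)
  rw [← ENNReal.ofReal_coe_nnreal]
  refine ENNReal.ofReal_le_ofReal ?_
  simp [abs_of_nonneg hr]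

/-- A primitive matrix has a positive eigenvector for its spectral radius. -/
theorem exists_perron_vector [Nonempty n] {A : Matrix n n ℝ} (hA : A.IsPrimitive) :
    ∃ x : n → ℝ, (∀ i, 0 < x i) ∧ A *ᵥ x = specRadius A • x := by
  obtain ⟨r, x, hx, h⟩ := hA.exists_pos_eigenvector
  exact ⟨x, hx, by rw [specRadius_eq hA.nonneg hx h, h]⟩

/-- Smoothing by a positive power makes the inequality strict in every coordinate; the largest of
the finitely many ratios is then a bound below `r`. -/
theorem specRadius_lt [Nonempty n] {A : Matrix n n ℝ} (hA : A.IsPrimitive) {r : ℝ}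
    {x : n → ℝ} (hx : ∀ i, 0 < x i) (h : ∀ i, (A *ᵥ x) i ≤ r * x i)
    (hne : ∃ i, (A *ᵥ x) i ≠ r * x i) : specRadius A < r := by
  obtain ⟨y, hy, hyr⟩ := hA.exists_pos_mulVec_lt hx h hne
  obtain ⟨i0, hi0⟩ := Finite.exists_max fun i => (A *ᵥ y) i / y i
  refine lt_of_le_of_lt (specRadius_le hA.nonneg (r := (A *ᵥ y) i0 / y i0) ?_ hy fun i => ?_) ?_
  · exact div_nonneg (mulVec_nonneg_of_nonneg hA.nonneg (fun i => (hy i).le) i0) (hy i0).le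
  · exact (div_le_iff₀ (hy i)).1 (hi0 i)
  · exact (div_lt_iff₀ (hy i0)).2 (hyr i0)

/-- The eigenvector equation is read off at the smallest entry of the Perron vector. -/
theorem le_specRadius [Nonempty n] {A : Matrix n n ℝ} (hA : A.IsPrimitive) {r : ℝ}
    (h : ∀ i, r ≤ ∑ j, A i j) : r ≤ specRadius A := by
  obtain ⟨x, hx, hxr⟩ := exists_perron_vector hA
  obtain ⟨i0, hi0⟩ := Finite.exists_min x
  have h1 := congrFun hxr i0
  simp only [mulVec, dotProduct, Pi.smul_apply, smul_eq_mul] at h1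
  refine le_of_mul_le_mul_right ?_ (hx i0)
  rw [← h1]
  calc r * x i0 ≤ (∑ j, A i0 j) * x i0 := mul_le_mul_of_nonneg_right (h i0) (hx i0).le
    _ = ∑ j, A i0 j * x i0 := Finset.sum_mul _ _ _
    _ ≤ _ := Finset.sum_le_sum fun j _ => mul_le_mul_of_nonneg_left (hi0 j) (hA.nonneg i0 j)

/-- A finite set of primitive matrices whose rows can be chosen independently has a common positive
subinvariant vector for its minimal spectral radius, which is an eigenvector of one of them. -/
theorem exists_common_perron_vector [Nonempty n] {𝒟 : Set (Matrix n n ℝ)} (hfin : 𝒟.Finite)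
    (hne : 𝒟.Nonempty) (hprim : ∀ D ∈ 𝒟, D.IsPrimitive)
    (hmix : ∀ D ∈ 𝒟, ∀ D' ∈ 𝒟, ∀ i, D.updateRow i (D' i) ∈ 𝒟) :
    ∃ D₀ ∈ 𝒟, ∃ x : n → ℝ, (∀ i, 0 < x i) ∧ D₀ *ᵥ x = sInf (specRadius '' 𝒟) • x ∧
      ∀ D ∈ 𝒟, ∀ i, sInf (specRadius '' 𝒟) * x i ≤ (D *ᵥ x) i := by
  obtain ⟨D₀, hD₀, heq⟩ := (hne.image specRadius).csInf_mem (hfin.image _)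
  have hmin : ∀ D ∈ 𝒟, specRadius D₀ ≤ specRadius D := fun D hD => by
    rw [heq]
    exact csInf_le (hfin.image _).bddBelow ⟨D, hD, rfl⟩
  rw [← heq]
  obtain ⟨x, hx, hxr⟩ := exists_perron_vector (hprim D₀ hD₀)
  refine ⟨D₀, hD₀, x, hx, hxr, fun D hD i => ?_⟩
  -- Exchange argument: putting row `i` of `D` into `D₀` would give a matrix of the set with a
  -- smaller spectral radius.
  by_contra! hlt
  have hrow : ∀ k, (D₀.updateRow i (D i) *ᵥ x) k =
      if k = i then (D *ᵥ x) i else specRadius D₀ * x k := fun k => by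
    by_cases hk : k = i
    · subst hk; simp [mulVec]
    · have := congrFun hxr k
      simp only [mulVec, Pi.smul_apply, smul_eq_mul] at this ⊢
      rw [if_neg hk, updateRow_ne hk, this]
  refine absurd (hmin _ (hmix D₀ hD₀ D hD i)) (not_le.2 ?_)
  refine specRadius_lt (hprim _ (hmix D₀ hD₀ D hD i)) hx (fun k => ?_) ⟨i, ?_⟩
  · rw [hrow]
    split_ifs with hk
    · subst hk; exact hlt.le
    · exact le_rfl
  · rw [hrow, if_pos rfl]; exact hlt.ne

/-- Convergence of the normalised iterates of the minimum of a finite set of primitive matrices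
whose rows can be chosen independently. -/
theorem exists_tendsto_iterate_min [Nonempty n] {𝒟 : Set (Matrix n n ℝ)} (hfin : 𝒟.Finite)
    (hne : 𝒟.Nonempty) (hprim : ∀ D ∈ 𝒟, D.IsPrimitive)
    (hmix : ∀ D ∈ 𝒟, ∀ D' ∈ 𝒟, ∀ i, D.updateRow i (D' i) ∈ 𝒟)
    (hpos : 0 < sInf (specRadius '' 𝒟)) {g : ℕ → n → ℝ} (hg0 : ∀ i, 0 < g 0 i)
    (hle : ∀ m, ∀ D ∈ 𝒟, ∀ i, g (m + 1) i ≤ (D *ᵥ g m) i)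
    (hex : ∀ m i, ∃ D ∈ 𝒟, g (m + 1) i = (D *ᵥ g m) i) :
    ∃ x : n → ℝ, (∀ i, 0 < x i) ∧
      (∀ i, Tendsto (fun m => g m i / sInf (specRadius '' 𝒟) ^ m) atTop (𝓝 (x i))) ∧
      (∃ D ∈ 𝒟, D *ᵥ x = sInf (specRadius '' 𝒟) • x) ∧
      ∀ D ∈ 𝒟, ∀ i, sInf (specRadius '' 𝒟) * x i ≤ (D *ᵥ x) i := by
  obtain ⟨D₀, hD₀, y, hy, hD₀y, hsub⟩ := exists_common_perron_vector hfin hne hprim hmix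
  set r := sInf (specRadius '' 𝒟)
  obtain ⟨K, -, hK⟩ := (hprim D₀ hD₀).exists_pos_pow
  -- Ratios to the eigenvector. Their maximum `a m` decreases because y is an eigenvector of D₀;
  -- their minimum `b m` increases because y is subinvariant under every D in 𝒟.
  set h : ℕ → n → ℝ := fun m i => g m i / (r ^ m * y i) with hh
  have hden : ∀ m i, 0 < r ^ m * y i := fun m i => mul_pos (pow_pos hpos m) (hy i)
  have hgh : ∀ m i, g m i = h m i * (r ^ m * y i) := fun m i =>
    (div_mul_cancel₀ _ (hden m i).ne').symm
  set a : ℕ → ℝ := fun m => ⨆ i, h m i with ha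
  set b : ℕ → ℝ := fun m => ⨅ i, h m i with hb
  have hha : ∀ m i, h m i ≤ a m := fun m i => le_ciSup (Finite.bddAbove_range (h m)) i
  have hbh : ∀ m i, b m ≤ h m i := fun m i => ciInf_le (Finite.bddBelow_range (h m)) i
  have hba : ∀ m, b m ≤ a m := fun m =>
    (hbh m (Classical.arbitrary n)).trans (hha m (Classical.arbitrary n))
  have hb0 : 0 < b 0 := by
    obtain ⟨i, hi⟩ := exists_eq_ciInf_of_finite (f := h 0)
    rw [hb]; simp only; rw [← hi]
    exact div_pos (hg0 i) (hden 0 i)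
  have hgpos : ∀ k i, 0 < g k i := by
    intro k
    induction k with
    | zero => exact hg0
    | succ k ih =>
      intro i
      obtain ⟨D, hD, hDi⟩ := hex k i
      rw [hDi]
      obtain ⟨j0, hj0⟩ := Finite.exists_min fun j => g k j / y j
      have h1 : (g k j0 / y j0) * (D *ᵥ y) i ≤ (D *ᵥ g k) i := by
        calc _ = (D *ᵥ ((g k j0 / y j0) • y)) i := by rw [mulVec_smul]; simp
          _ ≤ _ := mulVec_mono (hprim D hD).nonneg (fun j => by
            rw [Pi.smul_apply, smul_eq_mul]
            exact (le_div_iff₀ (hy j)).1 (hj0 j)) i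
      exact lt_of_lt_of_le (mul_pos (div_pos (ih j0) (hy j0))
        (lt_of_lt_of_le (mul_pos hpos (hy i)) (hsub D hD i))) h1
  have hpow : ∀ k, D₀ ^ k *ᵥ y = r ^ k • y := pow_mulVec_of_eigen hD₀y
  have hpownn : ∀ k i j, 0 ≤ (D₀ ^ k) i j := by
    intro k
    induction k with
    | zero => intro i j; rw [pow_zero, one_apply]; split_ifs <;> norm_num
    | succ k ih =>
      intro i j
      rw [pow_succ, mul_apply]
      exact Finset.sum_nonneg fun l _ => mul_nonneg (ih i l) ((hprim D₀ hD₀).nonneg l j)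
  have hiter : ∀ m k i, g (m + k) i ≤ (D₀ ^ k *ᵥ g m) i := fun m k => by
    induction k with
    | zero => intro i; simp
    | succ k ih =>
      intro i
      rw [pow_succ', ← mulVec_mulVec]
      exact (hle (m + k) D₀ hD₀ i).trans (mulVec_mono (hprim D₀ hD₀).nonneg ih i)
  have hupper : ∀ m k i, h (m + k) i ≤ a m := fun m k i => by
    rw [div_le_iff₀ (hden _ i)]
    refine (hiter m k i).trans ?_
    calc (D₀ ^ k *ᵥ g m) i ≤ (D₀ ^ k *ᵥ ((a m * r ^ m) • y)) i :=
          mulVec_mono (hpownn k) (fun j => by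
            rw [hgh m j, Pi.smul_apply, smul_eq_mul, mul_assoc]
            exact mul_le_mul_of_nonneg_right (hha m j) (hden m j).le) i
      _ = _ := by
          rw [mulVec_smul, hpow]; simp only [Pi.smul_apply, smul_eq_mul, pow_add]; ring
  have hanti : Antitone a := antitone_nat_of_succ_le fun m => ciSup_le fun i => hupper m 1 i
  have hmono : Monotone b := monotone_nat_of_le_succ fun m => le_ciInf fun i => by
    obtain ⟨D, hD, hDi⟩ := hex m i
    rw [le_div_iff₀ (hden _ i), hDi]
    have key : (b m * r ^ m) * (D *ᵥ y) i ≤ (D *ᵥ g m) i := by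
      calc _ = (D *ᵥ ((b m * r ^ m) • y)) i := by rw [mulVec_smul]; simp
        _ ≤ _ := mulVec_mono (hprim D hD).nonneg (fun j => by
            rw [hgh m j, Pi.smul_apply, smul_eq_mul, mul_assoc]
            exact mul_le_mul_of_nonneg_right (hbh m j) (hden m j).le) i
    refine le_trans ?_ key
    have hbpos : 0 ≤ b m := le_ciInf fun i => (div_pos (hgpos m i) (hden m i)).le
    calc b m * (r ^ (m + 1) * y i) = (b m * r ^ m) * (r * y i) := by ring
      _ ≤ _ := mul_le_mul_of_nonneg_left (hsub D hD i)
        (mul_nonneg hbpos (pow_nonneg hpos.le m))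
  obtain ⟨⟨i1, j1⟩, hij⟩ := Finite.exists_min fun p : n × n =>
    (D₀ ^ K) p.1 p.2 * y p.2 / (r ^ K * y p.1)
  set ε := (D₀ ^ K) i1 j1 * y j1 / (r ^ K * y i1)
  have hε : 0 < ε := div_pos (mul_pos (hK i1 j1) (hy j1)) (hden K i1)
  -- The coordinate with the smallest ratio enters every row of `D₀ ^ K`, with a relative weight of
  -- at least ε, and pulls all ratios down. So the gap `a m - b m` shrinks by the factor 1 - ε over
  -- K steps.
  have hcontr : ∀ m, a (m + K) ≤ a m - ε * (a m - b m) := fun m => ciSup_le fun i => by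
    obtain ⟨j0, hj0⟩ := exists_eq_ciInf_of_finite (f := h m)
    change h m j0 = b m at hj0
    rw [div_le_iff₀ (hden _ i)]
    refine (hiter m K i).trans ?_
    have h1 : (D₀ ^ K *ᵥ g m) i + (D₀ ^ K) i j0 * (r ^ m * y j0) * (a m - b m) ≤
        (D₀ ^ K *ᵥ ((a m * r ^ m) • y)) i := by
      simp only [mulVec, dotProduct]
      rw [← Finset.add_sum_erase _ _ (Finset.mem_univ j0),
        ← Finset.add_sum_erase _ (fun j => (D₀ ^ K) i j * ((a m * r ^ m) • y) j)
          (Finset.mem_univ j0)]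
      have h2 : (D₀ ^ K) i j0 * g m j0 + (D₀ ^ K) i j0 * (r ^ m * y j0) * (a m - b m) =
          (D₀ ^ K) i j0 * ((a m * r ^ m) • y) j0 := by
        rw [hgh m j0, hj0, Pi.smul_apply, smul_eq_mul]; ring
      have h3 : ∑ j ∈ Finset.univ.erase j0, (D₀ ^ K) i j * g m j ≤
          ∑ j ∈ Finset.univ.erase j0, (D₀ ^ K) i j * ((a m * r ^ m) • y) j :=
        Finset.sum_le_sum fun j _ => mul_le_mul_of_nonneg_left (by
          rw [hgh m j, Pi.smul_apply, smul_eq_mul, mul_assoc]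
          exact mul_le_mul_of_nonneg_right (hha m j) (hden m j).le) (hpownn K i j)
      linarith
    rw [mulVec_smul, hpow] at h1
    have h4 : ε * (r ^ K * y i) ≤ (D₀ ^ K) i j0 * y j0 := (le_div_iff₀ (hden K i)).1 (hij (i, j0))
    have h5 : ε * (r ^ K * y i) * (r ^ m * (a m - b m)) ≤
        (D₀ ^ K) i j0 * y j0 * (r ^ m * (a m - b m)) :=
      mul_le_mul_of_nonneg_right h4 (mul_nonneg (pow_nonneg hpos.le m) (sub_nonneg.2 (hba m)))
    simp only [Pi.smul_apply, smul_eq_mul] at h1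
    rw [pow_add]
    linarith
  have hbdd : BddBelow (Set.range fun m => a m - b m) :=
    ⟨0, by rintro _ ⟨m, rfl⟩; exact sub_nonneg.2 (hba m)⟩
  have hda : Antitone fun m => a m - b m := fun m k hmk => sub_le_sub (hanti hmk) (hmono hmk)
  have hlim := tendsto_atTop_ciInf hda hbdd
  set L := ⨅ m, (a m - b m)
  have hL0 : 0 ≤ L := le_ciInf fun m => sub_nonneg.2 (hba m)
  have hL : L ≤ (1 - ε) * L := by
    refine le_of_tendsto_of_tendsto' (hlim.comp (tendsto_add_atTop_nat K))
      (hlim.const_mul (1 - ε)) fun m => ?_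
    have := hcontr m
    have := hmono (Nat.le_add_right m K)
    simp only [Function.comp]
    linarith
  have hLz : L = 0 := by nlinarith
  rw [hLz] at hlim
  have hbb : BddAbove (Set.range b) :=
    ⟨a 0, by rintro _ ⟨m, rfl⟩; exact (hba m).trans (hanti (Nat.zero_le m))⟩
  have hbl := tendsto_atTop_ciSup hmono hbb
  set c := ⨆ m, b m
  have hc : 0 < c := lt_of_lt_of_le hb0 (le_ciSup hbb 0)
  have hal : Tendsto a atTop (𝓝 c) := by simpa using hlim.add hbl
  refine ⟨c • y, fun i => mul_pos hc (hy i), fun i => ?_, ⟨D₀, hD₀, ?_⟩, fun D hD i => ?_⟩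
  rotate_left
  · rw [mulVec_smul, hD₀y, smul_comm]
  · rw [mulVec_smul]
    simp only [Pi.smul_apply, smul_eq_mul]
    rw [mul_left_comm]
    exact mul_le_mul_of_nonneg_left (hsub D hD i) hc.le
  have hhl : Tendsto (fun m => h m i) atTop (𝓝 c) :=
    tendsto_of_tendsto_of_tendsto_of_le_of_le hbl hal (fun m => hbh m i) fun m => hha m i
  refine (hhl.mul_const (y i)).congr fun m => ?_
  rw [hh]
  have := (hy i).ne'
  have := (pow_pos hpos m).ne'
  field_simp

end IteratedGraphSystem

/-! ### Weighted distances via potentials -/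

section WeightedDist

variable {V : Type*} {E : Type*} (src tgt : E → V) (ω : E → ℝ≥0∞)

/-- A function on the nodes that varies by at most the weight along each arc. -/
def IsPotential (φ : V → ℝ≥0∞) : Prop :=
  ∀ e, φ (src e) ≤ φ (tgt e) + ω e ∧ φ (tgt e) ≤ φ (src e) + ω e

/-- The weighted distance of two nodes, ignoring directions: the largest potential that vanishes
at the first node. -/
noncomputable def wdist (x y : V) : ℝ≥0∞ :=
  ⨆ (φ : V → ℝ≥0∞) (_ : IsPotential src tgt ω φ) (_ : φ x = 0), φ y

variable {src tgt ω}

theorem IsPotential.le_wdist {φ : V → ℝ≥0∞} (h : IsPotential src tgt ω φ) {x : V} (hx : φ x = 0)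
    (y : V) : φ y ≤ wdist src tgt ω x y :=
  le_iSup₂_of_le φ h (le_iSup_of_le hx le_rfl)

theorem wdist_le {x y : V} {c : ℝ≥0∞}
    (h : ∀ φ : V → ℝ≥0∞, IsPotential src tgt ω φ → φ x = 0 → φ y ≤ c) :
    wdist src tgt ω x y ≤ c :=
  iSup₂_le fun φ hφ => iSup_le fun hx => h φ hφ hx

/-- Truncated subtraction of the constant `φ x` leaves a potential, which now vanishes at `x`. -/
theorem IsPotential.le_add_wdist {φ : V → ℝ≥0∞} (h : IsPotential src tgt ω φ) (x y : V) :
    φ y ≤ φ x + wdist src tgt ω x y := by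
  have hψ : IsPotential src tgt ω fun z => φ z - φ x := fun e => by
    constructor
    · rw [tsub_le_iff_right, add_right_comm]
      exact (h e).1.trans (add_le_add_left le_tsub_add _)
    · rw [tsub_le_iff_right, add_right_comm]
      exact (h e).2.trans (add_le_add_left le_tsub_add _)
  calc φ y ≤ φ x + (φ y - φ x) := le_add_tsub
    _ ≤ _ := by gcongr; exact hψ.le_wdist (tsub_self _) y

theorem isPotential_wdist (x : V) : IsPotential src tgt ω (wdist src tgt ω x) := fun e =>
  ⟨wdist_le fun _ hφ hx => (hφ e).1.trans (add_le_add_left (hφ.le_wdist hx _) _),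
    wdist_le fun _ hφ hx => (hφ e).2.trans (add_le_add_left (hφ.le_wdist hx _) _)⟩

@[simp] theorem wdist_self (x : V) : wdist src tgt ω x x = 0 :=
  le_antisymm (wdist_le fun _ _ hx => hx.le) zero_le

theorem wdist_triangle (x y z : V) :
    wdist src tgt ω x z ≤ wdist src tgt ω x y + wdist src tgt ω y z :=
  (isPotential_wdist x).le_add_wdist y z

theorem wdist_arc_le (e : E) : wdist src tgt ω (src e) (tgt e) ≤ ω e := by
  simpa only [wdist_self, zero_add] using
    (isPotential_wdist (src := src) (tgt := tgt) (ω := ω) (src e) e).2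

/-- The reflection z ↦ `φ y - φ z` turns a potential vanishing at `x` into one vanishing at `y`. -/
theorem wdist_symm_le (x y : V) : wdist src tgt ω x y ≤ wdist src tgt ω y x := by
  refine wdist_le fun φ hφ hx => ?_
  have hψ : IsPotential src tgt ω fun z => φ y - φ z := fun e => by
    constructor
    · rw [tsub_le_iff_right, add_assoc]
      calc φ y ≤ φ y - φ (tgt e) + φ (tgt e) := le_tsub_add
        _ ≤ _ := by rw [add_comm (ω e)]; gcongr; exact (hφ e).2
    · rw [tsub_le_iff_right, add_assoc]
      calc φ y ≤ φ y - φ (src e) + φ (src e) := le_tsub_add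
        _ ≤ _ := by rw [add_comm (ω e)]; gcongr; exact (hφ e).1
  simpa [hx] using hψ.le_wdist (tsub_self _) x

theorem wdist_comm (x y : V) : wdist src tgt ω x y = wdist src tgt ω y x :=
  le_antisymm (wdist_symm_le x y) (wdist_symm_le y x)

theorem IsPotential.mono {ω' : E → ℝ≥0∞} (h : ∀ e, ω e ≤ ω' e) {φ : V → ℝ≥0∞}
    (hφ : IsPotential src tgt ω φ) : IsPotential src tgt ω' φ := fun e =>
  ⟨(hφ e).1.trans (by gcongr; exact h e), (hφ e).2.trans (by gcongr; exact h e)⟩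

theorem wdist_mono {ω' : E → ℝ≥0∞} (h : ∀ e, ω e ≤ ω' e) (x y : V) :
    wdist src tgt ω x y ≤ wdist src tgt ω' x y :=
  wdist_le fun _ hφ hx => (hφ.mono h).le_wdist hx y

theorem IsPotential.const_mul {φ : V → ℝ≥0∞} (h : IsPotential src tgt ω φ) (c : ℝ≥0∞) :
    IsPotential src tgt (fun e => c * ω e) fun x => c * φ x := fun e => by
  simp only [← mul_add]
  exact ⟨by gcongr; exact (h e).1, by gcongr; exact (h e).2⟩

theorem IsPotential.const_add {φ : V → ℝ≥0∞} (h : IsPotential src tgt ω φ) (c : ℝ≥0∞) :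
    IsPotential src tgt ω fun x => c + φ x := fun e => by
  simp only [add_assoc]
  exact ⟨by gcongr; exact (h e).1, by gcongr; exact (h e).2⟩

theorem isPotential_const (c : ℝ≥0∞) : IsPotential src tgt ω fun _ => c :=
  fun _ => ⟨le_self_add, le_self_add⟩

theorem IsPotential.min {φ ψ : V → ℝ≥0∞} (hφ : IsPotential src tgt ω φ)
    (hψ : IsPotential src tgt ω ψ) : IsPotential src tgt ω fun x => min (φ x) (ψ x) := fun e => by
  simp only [min_add]
  exact ⟨min_le_min (hφ e).1 (hψ e).1, min_le_min (hφ e).2 (hψ e).2⟩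

theorem le_wdist_const_mul (c : ℝ≥0∞) (x y : V) :
    c * wdist src tgt ω x y ≤ wdist src tgt (fun e => c * ω e) x y := by
  simpa using (((isPotential_wdist (ω := ω) x).const_mul c)).le_wdist (by simp) y

/-- Only the inequality ≤ needs `c` invertible: a potential for the scaled weights is divided by
`c`. -/
theorem wdist_const_mul {c : ℝ≥0∞} (hc0 : c ≠ 0) (hc : c ≠ ⊤) (x y : V) :
    wdist src tgt (fun e => c * ω e) x y = c * wdist src tgt ω x y := by
  refine le_antisymm (wdist_le fun φ hφ hx => ?_) (le_wdist_const_mul c x y)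
  have h1 := (hφ.const_mul c⁻¹).le_wdist (x := x) (by simp [hx]) y
  simp only [← mul_assoc, ENNReal.inv_mul_cancel hc0 hc, one_mul] at h1
  rwa [mul_comm, ← div_eq_mul_inv, ENNReal.div_le_iff hc0 hc, mul_comm] at h1

/-- Weighted distances are bounded along walks. -/
theorem wdist_le_sum_edges {G : SimpleGraph V} {W : Sym2 V → ℝ≥0∞} {x y : V} (P : G.Walk x y)
    (hW : ∀ d ∈ P.edges, ∃ e, s(src e, tgt e) = d ∧ ω e ≤ W d) :
    wdist src tgt ω x y ≤ (P.edges.map W).sum := by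
  induction P with
  | nil => simp
  | @cons x y z h P ih =>
    rw [SimpleGraph.Walk.edges_cons, List.map_cons, List.sum_cons]
    refine (wdist_triangle x y z).trans (add_le_add ?_ (ih fun d hd => hW d (by simp [hd])))
    obtain ⟨e, he, hle⟩ := hW s(x, y) (by simp)
    refine le_trans ?_ hle
    rcases Sym2.eq_iff.1 he with ⟨rfl, rfl⟩ | ⟨rfl, rfl⟩
    · exact wdist_arc_le e
    · rw [wdist_comm]; exact wdist_arc_le e

/-- A walk distance with weights on the edges is at most the weighted distance. -/
theorem iInf_walk_le_wdist {G : SimpleGraph V}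
    (hG : ∀ e, src e ≠ tgt e → G.Adj (src e) (tgt e)) {W : Sym2 V → ℝ≥0∞}
    (hW : ∀ e, W s(src e, tgt e) ≤ ω e) (x y : V) :
    ⨅ P : G.Walk x y, (P.edges.map W).sum ≤ wdist src tgt ω x y := by
  refine IsPotential.le_wdist (φ := fun z => ⨅ P : G.Walk x z, (P.edges.map W).sum) ?_ ?_ y
  · have key : ∀ z w (h : G.Adj z w) (c : ℝ≥0∞), W s(z, w) ≤ c →
        ⨅ P : G.Walk x w, (P.edges.map W).sum ≤ (⨅ P : G.Walk x z, (P.edges.map W).sum) + c :=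
      fun z w h c hc => by
        rw [ENNReal.iInf_add]
        refine le_iInf fun P => iInf_le_of_le (P.concat h) ?_
        rw [SimpleGraph.Walk.edges_concat]
        simpa using by gcongr
    intro e
    by_cases he : src e = tgt e
    · rw [he]; exact ⟨le_self_add, le_self_add⟩
    · exact ⟨key _ _ (hG e he).symm _ (by rw [Sym2.eq_swap]; exact hW e), key _ _ (hG e he) _ (hW e)⟩
  · exact le_antisymm (iInf_le_of_le SimpleGraph.Walk.nil (by simp)) zero_le

/-- For unit weights the weighted distance is the distance in the underlying graph. -/
theorem wdist_one_eq_edist (x y : V) : wdist src tgt (fun _ => 1) x y =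
    ((SimpleGraph.fromRel fun x y => ∃ e, src e = x ∧ tgt e = y).edist x y : ℝ≥0∞) := by
  set G := SimpleGraph.fromRel fun x y => ∃ e, src e = x ∧ tgt e = y with hG
  have hlen : ∀ {x y : V} (P : G.Walk x y), (P.edges.map fun _ => (1 : ℝ≥0∞)).sum = P.length :=
    fun P => by simp
  refine le_antisymm ?_ ?_
  · by_cases h : G.Reachable x y
    · obtain ⟨P, hP⟩ := h.exists_walk_length_eq_edist
      rw [← hP]
      refine (wdist_le_sum_edges (W := fun _ => 1) P fun d hd => ?_).trans_eq (by rw [hlen]; simp)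
      induction d with
      | h a b =>
        have := P.adj_of_mem_edges hd
        rw [hG, SimpleGraph.fromRel_adj] at this
        rcases this.2 with ⟨e, rfl, rfl⟩ | ⟨e, rfl, rfl⟩
        · exact ⟨e, rfl, le_rfl⟩
        · exact ⟨e, Sym2.eq_swap, le_rfl⟩
    · rw [SimpleGraph.edist_eq_top_of_not_reachable h]; simp
  · refine le_trans ?_ (iInf_walk_le_wdist (G := G) (W := fun _ => 1) (fun e he => ?_)
      (fun e => le_rfl) x y)
    · refine le_iInf fun P => ?_
      rw [hlen]
      exact_mod_cast P.edist_le
    · rw [hG, SimpleGraph.fromRel_adj]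
      exact ⟨he, Or.inl ⟨e, rfl, rfl⟩⟩

end WeightedDist

/-! ### Simple paths and weighted distances in a coloured digraph. -/

namespace ColouredDigraph

variable {C : Type u} (G : ColouredDigraph.{u, v} C)

instance : Finite G.V := G.finite_V

instance : Finite G.E := G.finite_E

theorem sum_chi_mul {R : Type*} [Semiring R] [Fintype C] (F : Set G.E) (w : C → R) :
    ∑ j, (G.chi F j : R) * w j = ∑ e ∈ F.toFinite.toFinset, w (G.col e) := by
  classical
  rw [← Finset.sum_fiberwise _ G.col]
  refine Finset.sum_congr rfl fun j _ => ?_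
  rw [Finset.sum_congr rfl (g := fun _ => w j) fun e he => by rw [(Finset.mem_filter.1 he).2],
    Finset.sum_const, nsmul_eq_mul]
  congr 2
  rw [chi, ← Set.ncard_coe_finset]
  congr 1
  ext e
  simp

theorem adj_underlying (e : G.E) : G.underlying.Adj (G.src e) (G.tgt e) := by
  rw [underlying, SimpleGraph.fromRel_adj]
  exact ⟨G.loopless e, Or.inl ⟨e, rfl, rfl⟩⟩

theorem exists_arc_of_adj {x y : G.V} (h : G.underlying.Adj x y) :
    ∃ e, s(G.src e, G.tgt e) = s(x, y) := by
  rw [underlying, SimpleGraph.fromRel_adj] at h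
  rcases h.2 with ⟨e, rfl, rfl⟩ | ⟨e, rfl, rfl⟩
  exacts [⟨e, rfl⟩, ⟨e, Sym2.eq_swap⟩]

/-- A node other than some node is an end of an arc. -/
theorem exists_arc_of_ne {x y : G.V} (hxy : x ≠ y) : ∃ e, G.src e = x ∨ G.tgt e = x := by
  have hc : G.underlying.Connected := G.connected
  obtain ⟨P⟩ := hc.preconnected x y
  cases P with
  | nil => exact absurd rfl hxy
  | cons h _ =>
    obtain ⟨e, he⟩ := G.exists_arc_of_adj h
    rcases Sym2.eq_iff.1 he with ⟨h1, -⟩ | ⟨-, h1⟩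
    exacts [⟨e, Or.inl h1⟩, ⟨e, Or.inr h1⟩]

/-- Every walk yields a simple path with minimal arcs that is no longer than the walk. -/
theorem exists_pathArcSet_le (ω : G.E → ℝ≥0∞) {a b : G.V} (P : G.underlying.Walk a b) :
    ∃ F ∈ G.pathArcSets a b, ∑ e ∈ F.toFinite.toFinset, ω e ≤
      (P.edges.map fun d => ⨅ (e) (_ : s(G.src e, G.tgt e) = d), ω e).sum := by
  classical
  set W : Sym2 G.V → ℝ≥0∞ := fun d => ⨅ (e) (_ : s(G.src e, G.tgt e) = d), ω e with hW
  -- Two opposite arcs may lie over one edge; for each edge of the loop-erased walk a cheapest arc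
  -- is picked.
  have hmin : ∀ d ∈ P.bypass.edges, ∃ e, s(G.src e, G.tgt e) = d ∧ ω e ≤ W d := by
    intro d hd
    have hne : ∃ e, s(G.src e, G.tgt e) = d := by
      induction d with
      | h x y => exact G.exists_arc_of_adj (P.bypass.adj_of_mem_edges hd)
    obtain ⟨e, he, hmin⟩ := Set.exists_min_image {e | s(G.src e, G.tgt e) = d} ω (Set.toFinite _) hne
    exact ⟨e, he, le_iInf₂ fun f hf => hmin f hf⟩
  choose c hc using fun d : {d // d ∈ P.bypass.edges} => hmin d.1 d.2
  have hinj : Function.Injective c := fun d d' h => by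
    apply Subtype.ext
    rw [← (hc d).1, ← (hc d').1, h]
  refine ⟨Set.range c, ⟨P.bypass, P.bypass_isPath, ?_, ?_, ?_⟩, ?_⟩
  · rintro _ ⟨d, rfl⟩
    simp only [(hc d).1]
    exact d.2
  · rintro _ ⟨d, rfl⟩ _ ⟨d', rfl⟩ h
    simp only [(hc _).1] at h
    rw [Subtype.ext h]
  · intro d hd
    exact ⟨c ⟨d, hd⟩, ⟨_, rfl⟩, (hc ⟨d, hd⟩).1⟩
  · have h1 : (Set.range c).toFinite.toFinset =
        (Finset.univ : Finset {d // d ∈ P.bypass.edges.toFinset}).map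
          ⟨fun d => c ⟨d.1, List.mem_toFinset.1 d.2⟩, fun d d' h =>
            Subtype.ext (Subtype.mk.inj (hinj h))⟩ := by
      ext e
      simp only [Set.Finite.mem_toFinset, Set.mem_range, Finset.mem_map, Finset.mem_univ, true_and]
      constructor
      · rintro ⟨d, rfl⟩
        exact ⟨⟨d.1, List.mem_toFinset.2 d.2⟩, rfl⟩
      · rintro ⟨d, rfl⟩
        exact ⟨_, rfl⟩
    rw [h1, Finset.sum_map]
    calc _ ≤ ∑ d : {d // d ∈ P.bypass.edges.toFinset}, W d.1 :=
          Finset.sum_le_sum fun d _ => (hc ⟨d.1, List.mem_toFinset.1 d.2⟩).2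
      _ = ∑ d ∈ P.bypass.edges.toFinset, W d := Finset.sum_coe_sort _ W
      _ = (P.bypass.edges.map W).sum :=
          (List.sum_toFinset W P.bypass_isPath.isTrail.edges_nodup)
      _ ≤ (P.edges.map W).sum :=
          (P.edges_bypass_sublist_edges.map W).sum_le_sum fun _ _ => zero_le

theorem pathArcSets_nonempty (a b : G.V) : (G.pathArcSets a b).Nonempty := by
  have : G.underlying.Connected := G.connected
  obtain ⟨P⟩ := this.preconnected a b
  obtain ⟨F, hF, -⟩ := G.exists_pathArcSet_le (fun _ => 0) P
  exact ⟨F, hF⟩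

theorem wdist_le_of_pathArcSet (ω : G.E → ℝ≥0∞) {a b : G.V} {F : Set G.E}
    (hF : F ∈ G.pathArcSets a b) :
    wdist G.src G.tgt ω a b ≤ ∑ e ∈ F.toFinite.toFinset, ω e := by
  classical
  obtain ⟨P, hP, hbij⟩ := hF
  refine (wdist_le_sum_edges (W := fun d => ⨅ e ∈ {e | e ∈ F ∧ s(G.src e, G.tgt e) = d}, ω e)
    P fun d hd => ?_).trans ?_
  · obtain ⟨e, he, hed⟩ := hbij.surjOn hd
    refine ⟨e, hed, le_iInf₂ fun f hf => ?_⟩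
    rw [hbij.injOn hf.1 he (hf.2.trans hed.symm)]
  · rw [← List.sum_toFinset _ hP.isTrail.edges_nodup]
    have h1 : P.edges.toFinset = F.toFinite.toFinset.image fun e => s(G.src e, G.tgt e) := by
      ext d
      have := Set.ext_iff.1 hbij.image_eq d
      simpa [Set.mem_image] using this.symm
    rw [h1, Finset.sum_image fun e he f hf h => hbij.injOn (by simpa using he) (by simpa using hf) h]
    refine Finset.sum_le_sum fun e he => iInf₂_le e ⟨by simpa using he, rfl⟩

/-- The weighted distance is attained by a simple path. -/
theorem exists_pathArcSet_le_wdist (ω : G.E → ℝ≥0∞) (a b : G.V) :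
    ∃ F ∈ G.pathArcSets a b, ∑ e ∈ F.toFinite.toFinset, ω e ≤ wdist G.src G.tgt ω a b := by
  obtain ⟨F, hF, hmin⟩ := Set.exists_min_image (G.pathArcSets a b)
    (fun F => ∑ e ∈ F.toFinite.toFinset, ω e) (Set.toFinite _) (G.pathArcSets_nonempty a b)
  refine ⟨F, hF, le_trans ?_ (iInf_walk_le_wdist (G := G.underlying)
    (W := fun d => ⨅ (e) (_ : s(G.src e, G.tgt e) = d), ω e) (fun e _ => G.adj_underlying e)
    (fun e => iInf₂_le (κ := fun f => s(G.src f, G.tgt f) = s(G.src e, G.tgt e))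
      (f := fun f _ => ω f) e rfl) a b)⟩
  refine le_iInf fun P => ?_
  obtain ⟨F', hF', hle⟩ := G.exists_pathArcSet_le ω P
  exact (hmin F' hF').trans hle

theorem wdist_one_ne_top (a b : G.V) : wdist G.src G.tgt (fun _ => 1) a b ≠ ⊤ := by
  rw [wdist_one_eq_edist]
  have h : G.underlying.Connected := G.connected
  have h1 : G.underlying.edist a b ≠ ⊤ := SimpleGraph.edist_ne_top_iff_reachable.2 (h.preconnected a b)
  simpa [underlying] using h1

end ColouredDigraph

namespace IteratedGraphSystem

variable {C : Type u} (S : IteratedGraphSystem.{u, v} C)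

/-! ### Nodes and arcs -/

theorem A_ne_B (i : C) : S.A i ≠ S.B i := fun h => by
  have := S.two_le_dist i
  rw [h, SimpleGraph.dist_self] at this
  omega

instance finite_arc (n : ℕ) : Finite (S.Arc n) := by
  induction n with
  | zero => exact S.init.finite_E
  | succ n ih =>
    have : Finite ((a : S.Arc n) × (S.rule (S.colour n a)).E) := inferInstance
    exact this

noncomputable instance fintypeArc (n : ℕ) : Fintype (S.Arc n) := Fintype.ofFinite _

instance countable_node : Countable S.Node := by
  unfold Node
  infer_instance

theorem nodes_mono {m n : ℕ} (h : m ≤ n) : S.nodes m ⊆ S.nodes n := fun _ hx => le_trans hx h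

theorem mem_nodes_birth (x : S.Node) : x ∈ S.nodes (S.birth x) := le_refl (S.birth x)

theorem inr_mem_nodes {n k : ℕ} {a : S.Arc k}
    {x : {x : (S.rule (S.colour k a)).V // x ≠ S.A (S.colour k a) ∧ x ≠ S.B (S.colour k a)}} :
    (Sum.inr ⟨k, a, x⟩ : S.Node) ∈ S.nodes n ↔ k + 1 ≤ n := Iff.rfl

variable {S}

@[simp] theorem place_A {n : ℕ} (a : S.Arc n) (p q : S.Node) :
    S.place a p q (S.A (S.colour n a)) = p := by simp [place]

@[simp] theorem place_B {n : ℕ} (a : S.Arc n) (p q : S.Node) :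
    S.place a p q (S.B (S.colour n a)) = q := by simp [place, (S.A_ne_B _).symm]

theorem place_of_ne {n : ℕ} (a : S.Arc n) (p q : S.Node) {x : (S.rule (S.colour n a)).V}
    (hA : x ≠ S.A (S.colour n a)) (hB : x ≠ S.B (S.colour n a)) :
    S.place a p q x = Sum.inr ⟨n, a, x, hA, hB⟩ := by simp [place, hA, hB]

theorem ends_succ (n : ℕ) (e : S.Arc (n + 1)) : S.ends (n + 1) e =
    (S.place e.1 (S.ends n e.1).1 (S.ends n e.1).2 ((S.rule (S.colour n e.1)).src e.2),
      S.place e.1 (S.ends n e.1).1 (S.ends n e.1).2 ((S.rule (S.colour n e.1)).tgt e.2)) := rfl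

theorem place_mem_nodes {n : ℕ} (a : S.Arc n) {p q : S.Node} (hp : p ∈ S.nodes n)
    (hq : q ∈ S.nodes n) (x : (S.rule (S.colour n a)).V) : S.place a p q x ∈ S.nodes (n + 1) := by
  unfold place
  split_ifs
  · exact S.nodes_mono n.le_succ hp
  · exact S.nodes_mono n.le_succ hq
  · exact le_refl (n + 1)

theorem ends_mem_nodes (n : ℕ) (e : S.Arc n) :
    (S.ends n e).1 ∈ S.nodes n ∧ (S.ends n e).2 ∈ S.nodes n := by
  induction n with
  | zero => exact ⟨le_refl 0, le_refl 0⟩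
  | succ n ih =>
    rw [ends_succ]
    exact ⟨place_mem_nodes _ (ih _).1 (ih _).2 _, place_mem_nodes _ (ih _).1 (ih _).2 _⟩

theorem place_injective {n : ℕ} (a : S.Arc n) {p q : S.Node} (hp : p ∈ S.nodes n)
    (hq : q ∈ S.nodes n) (hpq : p ≠ q) : Function.Injective (S.place a p q) := by
  have hnew : ∀ x hA hB, ∀ r ∈ S.nodes n, (Sum.inr ⟨n, a, x, hA, hB⟩ : S.Node) ≠ r :=
    fun x hA hB r hr h => by
      subst h
      exact absurd hr (by simp [inr_mem_nodes])
  intro x y h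
  by_cases hxA : x = S.A _ <;> by_cases hyA : y = S.A _
  · rw [hxA, hyA]
  · subst hxA
    by_cases hyB : y = S.B _
    · subst hyB; simp [hpq] at h
    · rw [place_A, place_of_ne a p q hyA hyB] at h
      exact absurd h.symm (hnew _ hyA hyB _ hp)
  · subst hyA
    by_cases hxB : x = S.B _
    · subst hxB; simp [hpq.symm] at h
    · rw [place_A, place_of_ne a p q hxA hxB] at h
      exact absurd h (hnew _ hxA hxB _ hp)
  · by_cases hxB : x = S.B _ <;> by_cases hyB : y = S.B _
    · rw [hxB, hyB]
    · subst hxB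
      rw [place_B, place_of_ne a p q hyA hyB] at h
      exact absurd h.symm (hnew _ hyA hyB _ hq)
    · subst hyB
      rw [place_B, place_of_ne a p q hxA hxB] at h
      exact absurd h (hnew _ hxA hxB _ hq)
    · rw [place_of_ne a p q hxA hxB, place_of_ne a p q hyA hyB] at h
      simpa using h

theorem ends_ne (n : ℕ) (e : S.Arc n) : (S.ends n e).1 ≠ (S.ends n e).2 := by
  induction n with
  | zero =>
    intro h
    exact S.init.loopless e (Sum.inl_injective h)
  | succ n ih =>
    rw [ends_succ]
    intro h
    exact (S.rule _).loopless e.2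
      (place_injective _ (ends_mem_nodes n _).1 (ends_mem_nodes n _).2 (ih _) h)

variable (S)

/-! ### Weighted distances in the graphs `Ξ^n` -/

/-- The distance in the rule graph of colour `i` with weights given by the colours. -/
noncomputable def ruleDist (i : C) (ω : C → ℝ≥0∞) (x y : (S.rule i).V) : ℝ≥0∞ :=
  wdist (S.rule i).src (S.rule i).tgt (fun e => ω ((S.rule i).col e)) x y

/-- The weights of the colours that result from substituting once. -/
noncomputable def substWeight (ω : C → ℝ≥0∞) (i : C) : ℝ≥0∞ := S.ruleDist i ω (S.A i) (S.B i)

/-- The distance in `Ξ^n` with weights given by the colours. -/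
noncomputable def levelDist (n : ℕ) (ω : C → ℝ≥0∞) (x y : S.Node) : ℝ≥0∞ :=
  wdist (fun e : S.Arc n => (S.ends n e).1) (fun e => (S.ends n e).2)
    (fun e => ω (S.colour n e)) x y

/-- Potentials on `Ξ^n` with weights given by the colours. -/
def IsLevelPotential (n : ℕ) (ω : C → ℝ≥0∞) (φ : S.Node → ℝ≥0∞) : Prop :=
  IsPotential (fun e : S.Arc n => (S.ends n e).1) (fun e => (S.ends n e).2)
    (fun e => ω (S.colour n e)) φ

variable {S}

/-- A potential on `Ξ^n` for the substituted weights extends to `Ξ^(n+1)`. -/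
theorem IsLevelPotential.exists_extension {n : ℕ} {ω : C → ℝ≥0∞} {φ : S.Node → ℝ≥0∞}
    (hφ : S.IsLevelPotential n (S.substWeight ω) φ) :
    ∃ ψ : S.Node → ℝ≥0∞, S.IsLevelPotential (n + 1) ω ψ ∧ (∀ x ∈ S.nodes n, ψ x = φ x) ∧
      ∀ (a : S.Arc n) (x : (S.rule (S.colour n a)).V),
        ψ (S.place a (S.ends n a).1 (S.ends n a).2 x) ∈
          Set.Icc (min (φ (S.ends n a).1) (φ (S.ends n a).2))
            (max (φ (S.ends n a).1) (φ (S.ends n a).2)) := by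
  -- In each copy, take the smaller of the two distance cones issuing from the end values, cut off
  -- at the larger end value. The cut-off keeps the extension between the end values; in particular
  -- it is constant on a copy whose ends have equal values.
  set F : ∀ (k : ℕ) (a : S.Arc k), (S.rule (S.colour k a)).V → ℝ≥0∞ := fun k a x =>
    min (min (φ (S.ends k a).1 + S.ruleDist _ ω (S.A _) x)
      (φ (S.ends k a).2 + S.ruleDist _ ω (S.B _) x))
      (max (φ (S.ends k a).1) (φ (S.ends k a).2)) with hF
  set ψ : S.Node → ℝ≥0∞ := fun z => match z with
    | Sum.inl x => φ (Sum.inl x)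
    | Sum.inr ⟨k, a, x⟩ => if k = n then F k a x.1 else φ (Sum.inr ⟨k, a, x⟩) with hψ
  have hold : ∀ x ∈ S.nodes n, ψ x = φ x := by
    rintro (x | ⟨k, a, x⟩) hx
    · rfl
    · have : k ≠ n := by rw [inr_mem_nodes] at hx; omega
      simp [hψ, this]
  have hplace : ∀ (a : S.Arc n) (x : (S.rule (S.colour n a)).V),
      ψ (S.place a (S.ends n a).1 (S.ends n a).2 x) = F n a x := by
    intro a x
    have hp := (ends_mem_nodes n a).1
    have hq := (ends_mem_nodes n a).2
    by_cases hA : x = S.A _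
    · subst hA
      rw [place_A, hold _ hp, hF]
      -- The potential inequality for the substituted weight says exactly that the cone from the
      -- other end does not undercut the value here.
      have h1 : φ (S.ends n a).1 ≤ φ (S.ends n a).2 +
          S.ruleDist (S.colour n a) ω (S.B _) (S.A _) := by
        rw [ruleDist, wdist_comm]; exact (hφ a).1
      simp only [ruleDist, wdist_self, add_zero] at h1 ⊢
      rw [min_eq_left h1, min_eq_left (le_max_left _ _)]
    · by_cases hB : x = S.B _
      · subst hB
        rw [place_B, hold _ hq, hF]
        have h1 : φ (S.ends n a).2 ≤ φ (S.ends n a).1 +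
          S.ruleDist (S.colour n a) ω (S.A _) (S.B _) := (hφ a).2
        simp only [ruleDist, wdist_self, add_zero] at h1 ⊢
        rw [min_eq_right h1, min_eq_left (le_max_right _ _)]
      · rw [place_of_ne a _ _ hA hB]
        simp [hψ]
  refine ⟨ψ, fun e => ?_, hold, fun a x => ?_⟩
  · simp only [ends_succ, hplace]
    exact ((((isPotential_wdist _).const_add _).min ((isPotential_wdist _).const_add _)).min
      (isPotential_const _)) e.2
  · rw [hplace, hF]
    refine ⟨le_min (min_le_min le_self_add le_self_add) min_le_max, min_le_right _ _⟩

/-- Pulled back along `place`, the distance in Ξ^(n+1) from the beginning node is a potential on the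
rule graph. -/
theorem levelDist_place_le (n : ℕ) (ω : C → ℝ≥0∞) (a : S.Arc n)
    (x : (S.rule (S.colour n a)).V) :
    S.levelDist (n + 1) ω (S.ends n a).1 (S.place a (S.ends n a).1 (S.ends n a).2 x) ≤
      S.ruleDist (S.colour n a) ω (S.A _) x := by
  refine IsPotential.le_wdist
    (φ := fun x => S.levelDist (n + 1) ω (S.ends n a).1 (S.place a (S.ends n a).1 (S.ends n a).2 x))
    (fun e => isPotential_wdist (src := fun e : S.Arc (n + 1) => (S.ends (n + 1) e).1)
      (tgt := fun e => (S.ends (n + 1) e).2) (S.ends n a).1 ⟨a, e⟩) ?_ x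
  simp [levelDist]

/-- The renormalisation identity behind all asymptotics. For ≤, crossing a copy costs at most the
distance of its marked nodes; for ≥, potentials of Ξ^n extend, so no route through the copies is
shorter. -/
theorem levelDist_succ (n : ℕ) (ω : C → ℝ≥0∞) {x y : S.Node} (hx : x ∈ S.nodes n)
    (hy : y ∈ S.nodes n) :
    S.levelDist (n + 1) ω x y = S.levelDist n (S.substWeight ω) x y := by
  refine le_antisymm ?_ ?_
  · refine IsPotential.le_wdist (φ := S.levelDist (n + 1) ω x) (fun a => ?_) (wdist_self x) y
    have h : S.levelDist (n + 1) ω (S.ends n a).1 (S.ends n a).2 ≤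
        S.substWeight ω (S.colour n a) := by
      have := levelDist_place_le n ω a (S.B _)
      rwa [place_B] at this
    refine ⟨(wdist_triangle x (S.ends n a).2 _).trans (add_le_add_right ?_ _),
      (wdist_triangle x (S.ends n a).1 _).trans (add_le_add_right h _)⟩
    rw [wdist_comm]
    exact h
  · obtain ⟨ψ, hψ, hold, -⟩ :=
      IsLevelPotential.exists_extension (φ := S.levelDist n (S.substWeight ω) x)
        (isPotential_wdist x)
    rw [← hold y hy]
    refine hψ.le_wdist ?_ y
    rw [hold x hx]
    exact wdist_self x

theorem levelDist_add (m k : ℕ) (ω : C → ℝ≥0∞) {x y : S.Node} (hx : x ∈ S.nodes m)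
    (hy : y ∈ S.nodes m) :
    S.levelDist (m + k) ω x y = S.levelDist m (S.substWeight^[k] ω) x y := by
  induction k generalizing ω with
  | zero => rfl
  | succ k ih =>
    rw [← add_assoc, levelDist_succ _ _ (S.nodes_mono (Nat.le_add_right m k) hx)
      (S.nodes_mono (Nat.le_add_right m k) hy), ih]
    rfl

theorem levelDist_one_eq_edist (n : ℕ) (x y : S.Node) :
    S.levelDist n (fun _ => 1) x y = ((S.graph n).edist x y : ℝ≥0∞) :=
  wdist_one_eq_edist x y

/-- Every node of `Ξ^(n+1)` lies in the copy of a rule graph that replaces an arc of `Ξ^n`, or is a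
node of `Ξ^n`. -/
theorem mem_nodes_succ {n : ℕ} {x : S.Node} (hx : x ∈ S.nodes (n + 1)) :
    x ∈ S.nodes n ∨ ∃ (a : S.Arc n) (z : (S.rule (S.colour n a)).V),
      x = S.place a (S.ends n a).1 (S.ends n a).2 z := by
  rcases x with x | ⟨k, a, x, hA, hB⟩
  · exact Or.inl (Nat.zero_le n)
  · rw [inr_mem_nodes] at hx
    rcases Nat.lt_or_ge k n with h | h
    · exact Or.inl h
    · obtain rfl : k = n := by omega
      exact Or.inr ⟨a, x, (place_of_ne a _ _ hA hB).symm⟩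

instance finite_nodes (n : ℕ) : Finite (S.nodes n) := by
  rw [Set.finite_coe_iff]
  induction n with
  | zero =>
    refine (Set.finite_range (Sum.inl : S.init.V → S.Node)).subset ?_
    rintro (x | ⟨k, a, x⟩) hx
    · exact ⟨x, rfl⟩
    · rw [inr_mem_nodes] at hx; omega
  | succ n ih =>
    refine (ih.union (Set.finite_range fun p : (a : S.Arc n) × (S.rule (S.colour n a)).V =>
      S.place p.1 (S.ends n p.1).1 (S.ends n p.1).2 p.2)).subset fun x hx => ?_
    rcases mem_nodes_succ hx with h | ⟨a, z, rfl⟩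
    · exact Or.inl h
    · exact Or.inr ⟨⟨a, z⟩, rfl⟩

/-! ### Bounds for rule distances -/

section Bounds

variable (S) [Fintype C]

/-- A common bound for the distances in the rule graphs. -/
noncomputable def ruleBound : ℝ≥0∞ :=
  -- The summand 1 makes the bound nonzero, as the scaling arguments require.
  1 + ∑ i, ⨆ p : (S.rule i).V × (S.rule i).V, S.ruleDist i (fun _ => 1) p.1 p.2

theorem ruleBound_ne_top : S.ruleBound ≠ ⊤ := by
  refine ENNReal.add_ne_top.2 ⟨ENNReal.one_ne_top, ENNReal.sum_ne_top.2 fun i _ => ?_⟩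
  cases isEmpty_or_nonempty ((S.rule i).V × (S.rule i).V)
  · simp
  · obtain ⟨p, hp⟩ := exists_eq_ciSup_of_finite
      (f := fun p : (S.rule i).V × (S.rule i).V => S.ruleDist i (fun _ => 1) p.1 p.2)
    rw [← hp]
    exact (S.rule i).wdist_one_ne_top _ _

theorem ruleDist_le {ω : C → ℝ≥0∞} {c : ℝ≥0∞} (hc0 : c ≠ 0) (hc : c ≠ ⊤) (hω : ∀ j, ω j ≤ c)
    (i : C) (x y : (S.rule i).V) : S.ruleDist i ω x y ≤ c * S.ruleBound := by
  calc S.ruleDist i ω x y ≤ S.ruleDist i (fun _ => c * 1) x y :=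
        wdist_mono (fun e => by simpa using hω _) x y
    _ = c * S.ruleDist i (fun _ => 1) x y := wdist_const_mul hc0 hc x y
    _ ≤ c * S.ruleBound := by
        gcongr
        refine le_trans ?_ le_add_self
        refine le_trans ?_ (Finset.single_le_sum (fun _ _ => zero_le) (Finset.mem_univ i))
        exact le_iSup (fun p : (S.rule i).V × (S.rule i).V => S.ruleDist i (fun _ => 1) p.1 p.2)
          (x, y)

end Bounds

end IteratedGraphSystem

namespace IteratedGraphSystem

variable {C : Type u} (S : IteratedGraphSystem.{u, v} C)

/-! ### Path matrices and substituted weights -/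

theorem pathMatrices_finite [Finite C] : S.pathMatrices.Finite := by
  refine (Set.finite_range fun (F : ∀ i, Set (S.rule i).E) (i j : C) =>
    ((S.rule i).chi (F i) j : ℝ)).subset ?_
  rintro D ⟨F, -, h⟩
  exact ⟨F, by ext i j; exact (h i j).symm⟩

theorem pathMatrices_nonempty : S.pathMatrices.Nonempty := by
  choose F hF using fun i => (S.rule i).pathArcSets_nonempty (S.A i) (S.B i)
  exact ⟨fun i j => (S.rule i).chi (F i) j, F, hF, fun _ _ => rfl⟩

/-- Paths in different rule graphs are chosen independently; this is the exchange property needed in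
`exists_common_perron_vector`. -/
theorem updateRow_mem_pathMatrices [DecidableEq C] {D D' : Matrix C C ℝ}
    (hD : D ∈ S.pathMatrices) (hD' : D' ∈ S.pathMatrices) (i : C) :
    D.updateRow i (D' i) ∈ S.pathMatrices := by
  obtain ⟨F, hF, h⟩ := hD
  obtain ⟨F', hF', h'⟩ := hD'
  refine ⟨Function.update F i (F' i), fun k => ?_, fun k j => ?_⟩
  · by_cases hk : k = i
    · subst hk; simpa using hF' k
    · simpa [hk] using hF k
  · by_cases hk : k = i
    · subst hk; simpa using h' k j
    · simpa [hk, Matrix.updateRow_ne hk] using h k j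

theorem nonempty_colours (S : IteratedGraphSystem.{u, v} C) : Nonempty C :=
  ⟨S.init.col S.init_nonempty.some⟩

theorem two_le_substWeight_one (i : C) : 2 ≤ S.substWeight (fun _ => 1) i := by
  have h := S.two_le_dist i
  have hc : (S.rule i).underlying.Connected := (S.rule i).connected
  rw [substWeight, ruleDist, wdist_one_eq_edist]
  have h1 : (2 : ℕ∞) ≤ (S.rule i).underlying.edist (S.A i) (S.B i) := by
    rw [← (hc.preconnected _ _).coe_dist_eq_edist]
    exact_mod_cast h
  have h2 : ((2 : ℕ∞) : ℝ≥0∞) ≤ _ := ENat.toENNReal_le.2 h1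
  simpa [ColouredDigraph.underlying] using h2

/-- The asymptotics of the distances of the marked nodes in the iterated rule graphs: they grow like
`lam ^ n * w i`, and `w` is an eigenvector of the substitution of weights. -/
structure Growth where
  lam : ℝ
  w : C → ℝ
  one_lt_lam : 1 < lam
  w_pos : ∀ i, 0 < w i
  substWeight_w : S.substWeight (fun i => ENNReal.ofReal (w i)) = fun i =>
    ENNReal.ofReal (lam * w i)
  iterate_ne_top : ∀ k i, S.substWeight^[k] (fun _ => 1) i ≠ ⊤
  tendsto_iterate : ∀ i,
    Tendsto (fun k => (S.substWeight^[k] (fun _ => 1) i).toReal / lam ^ k) atTop (𝓝 (w i))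

variable [Fintype C]

open Matrix

theorem ofReal_mulVec {D : Matrix C C ℝ} {F : ∀ i, Set (S.rule i).E}
    (h : ∀ i j, D i j = (S.rule i).chi (F i) j) {w : C → ℝ} (hw : ∀ j, 0 ≤ w j) (i : C) :
    ENNReal.ofReal ((D *ᵥ w) i) =
      ∑ e ∈ (F i).toFinite.toFinset, ENNReal.ofReal (w ((S.rule i).col e)) := by
  rw [← ENNReal.ofReal_sum_of_nonneg fun _ _ => hw _, ← ColouredDigraph.sum_chi_mul]
  simp [mulVec, dotProduct, h]

theorem substWeight_le_mulVec {D : Matrix C C ℝ} (hD : D ∈ S.pathMatrices) {w : C → ℝ}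
    (hw : ∀ j, 0 ≤ w j) (i : C) :
    S.substWeight (fun j => ENNReal.ofReal (w j)) i ≤ ENNReal.ofReal ((D *ᵥ w) i) := by
  obtain ⟨F, hF, h⟩ := hD
  rw [S.ofReal_mulVec h hw]
  exact (S.rule i).wdist_le_of_pathArcSet _ (hF i)

theorem exists_substWeight_eq_mulVec {w : C → ℝ} (hw : ∀ j, 0 ≤ w j) (i : C) :
    ∃ D ∈ S.pathMatrices,
      S.substWeight (fun j => ENNReal.ofReal (w j)) i = ENNReal.ofReal ((D *ᵥ w) i) := by
  choose F hF hle using fun i => (S.rule i).exists_pathArcSet_le_wdist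
    (fun e => ENNReal.ofReal (w ((S.rule i).col e))) (S.A i) (S.B i)
  have hD : (fun i j => ((S.rule i).chi (F i) j : ℝ)) ∈ S.pathMatrices :=
    ⟨F, hF, fun _ _ => rfl⟩
  refine ⟨_, hD, le_antisymm (S.substWeight_le_mulVec hD hw i) ?_⟩
  rw [S.ofReal_mulVec (fun _ _ => rfl) hw]
  exact hle i

/-- A path between the marked nodes has at least two arcs. This makes the spectral radii at least 2,
hence both logarithms in the dimension positive. -/
theorem two_le_sum_of_mem_pathMatrices {D : Matrix C C ℝ} (hD : D ∈ S.pathMatrices) (i : C) :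
    2 ≤ ∑ j, D i j := by
  have h1 := S.substWeight_le_mulVec hD (w := fun _ => 1) (fun _ => zero_le_one) i
  have h2 := (S.two_le_substWeight_one i).trans (by simpa using h1)
  have h3 : (2 : ℝ≥0∞) = ENNReal.ofReal 2 := by simp
  rw [h3, ENNReal.ofReal_le_ofReal_iff'] at h2
  rcases h2 with h2 | h2
  · simpa [mulVec, dotProduct] using h2
  · norm_num at h2

theorem two_le_sum_M (i : C) : 2 ≤ ∑ j, S.M i j := by
  obtain ⟨D, hD⟩ := S.pathMatrices_nonempty
  refine (S.two_le_sum_of_mem_pathMatrices hD i).trans (Finset.sum_le_sum fun j _ => ?_)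
  obtain ⟨F, -, h⟩ := hD
  rw [h, M]
  exact_mod_cast Set.ncard_le_ncard (s := {e | e ∈ F i ∧ (S.rule i).col e = j})
    (t := {e | e ∈ Set.univ ∧ (S.rule i).col e = j})
    (fun e he => ⟨Set.mem_univ e, he.2⟩) (Set.toFinite _)

variable [DecidableEq C]

variable {S}

theorem IsPrimitive.two_le_rho (hS : S.IsPrimitive) : 2 ≤ specRadius S.M :=
  have := S.nonempty_colours
  le_specRadius hS.1 S.two_le_sum_M

theorem IsPrimitive.two_le_rhoMin (hS : S.IsPrimitive) : 2 ≤ S.rhoMin := by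
  have := S.nonempty_colours
  refine le_csInf (S.pathMatrices_nonempty.image _) ?_
  rintro _ ⟨D, hD, rfl⟩
  exact le_specRadius (hS.2 D hD) (S.two_le_sum_of_mem_pathMatrices hD)

/-- On finite weights the substitution is the minimum of the path matrices, attained in each row, so
`exists_tendsto_iterate_min` applies to its iterates. Its limit vector is an eigenvector of one path
matrix and subinvariant under the others, hence an eigenvector of the minimum. -/
theorem IsPrimitive.exists_growth (hS : S.IsPrimitive) : ∃ H : S.Growth, H.lam = S.rhoMin := by
  have := S.nonempty_colours
  have hlam : 1 < S.rhoMin := by have := hS.two_le_rhoMin; linarith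
  have hfin : ∀ k i, S.substWeight^[k] (fun _ => 1) i ≠ ⊤ := by
    intro k
    induction k with
    | zero => simp
    | succ k ih =>
      intro i
      rw [Function.iterate_succ_apply',
        show S.substWeight^[k] (fun _ => 1) = fun j => ENNReal.ofReal
          (S.substWeight^[k] (fun _ => 1) j).toReal from
          funext fun j => (ENNReal.ofReal_toReal (ih j)).symm]
      obtain ⟨D, -, h⟩ := S.exists_substWeight_eq_mulVec
        (w := fun j => (S.substWeight^[k] (fun _ => 1) j).toReal)
        (fun j => ENNReal.toReal_nonneg) i
      rw [h]
      exact ENNReal.ofReal_ne_top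
  set g : ℕ → C → ℝ := fun k i => (S.substWeight^[k] (fun _ => 1) i).toReal with hg
  have hsucc : ∀ k, S.substWeight (fun j => ENNReal.ofReal (g k j)) =
      fun i => ENNReal.ofReal (g (k + 1) i) := by
    intro k
    ext i
    rw [show (fun j => ENNReal.ofReal (g k j)) = S.substWeight^[k] (fun _ => 1) from
      funext fun j => ENNReal.ofReal_toReal (hfin k j), hg]
    simp only
    rw [ENNReal.ofReal_toReal (hfin _ i), Function.iterate_succ_apply']
  have hmv : ∀ k D, D ∈ S.pathMatrices → ∀ i, 0 ≤ (D *ᵥ g k) i := fun k D hD =>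
    mulVec_nonneg_of_nonneg (hS.2 D hD).nonneg fun i => ENNReal.toReal_nonneg
  obtain ⟨x, hx, hlim, ⟨D₀, hD₀, heq⟩, hsub⟩ := exists_tendsto_iterate_min S.pathMatrices_finite
    S.pathMatrices_nonempty hS.2 (fun D hD D' hD' i => S.updateRow_mem_pathMatrices hD hD' i)
    (zero_lt_one.trans hlam) (g := g) (fun i => by simp [hg])
    (fun m D hD i => by
      have := S.substWeight_le_mulVec hD (w := g m) (fun _ => ENNReal.toReal_nonneg) i
      rw [hsucc] at this
      exact (ENNReal.ofReal_le_ofReal_iff (hmv m D hD i)).1 this)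
    (fun m i => by
      obtain ⟨D, hD, h⟩ := S.exists_substWeight_eq_mulVec (w := g m)
        (fun _ => ENNReal.toReal_nonneg) i
      rw [hsucc] at h
      exact ⟨D, hD, (ENNReal.ofReal_eq_ofReal_iff ENNReal.toReal_nonneg (hmv m D hD i)).1 h⟩)
  refine ⟨⟨S.rhoMin, x, hlam, hx, ?_, hfin, hlim⟩, rfl⟩
  ext i
  refine le_antisymm ?_ ?_
  · have := S.substWeight_le_mulVec hD₀ (fun j => (hx j).le) i
    rw [heq] at this
    exact this
  · obtain ⟨D, hD, h⟩ := S.exists_substWeight_eq_mulVec (fun j => (hx j).le) i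
    rw [h]
    exact ENNReal.ofReal_le_ofReal (hsub D hD i)

end IteratedGraphSystem

namespace IteratedGraphSystem

variable {C : Type u} {S : IteratedGraphSystem.{u, v} C}

/-! ### Unscaled limit distances -/

theorem substWeight_mono {ω ω' : C → ℝ≥0∞} (h : ∀ j, ω j ≤ ω' j) (i : C) :
    S.substWeight ω i ≤ S.substWeight ω' i := wdist_mono (fun _ => h _) _ _

theorem substWeight_iterate_mono {ω ω' : C → ℝ≥0∞} (h : ∀ j, ω j ≤ ω' j) (k : ℕ) (i : C) :
    S.substWeight^[k] ω i ≤ S.substWeight^[k] ω' i := by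
  induction k generalizing ω ω' with
  | zero => exact h i
  | succ k ih => exact ih (substWeight_mono h)

theorem substWeight_iterate_const_mul {c : ℝ≥0∞} (hc0 : c ≠ 0) (hc : c ≠ ⊤) (ω : C → ℝ≥0∞)
    (k : ℕ) : S.substWeight^[k] (fun i => c * ω i) = fun i => c * S.substWeight^[k] ω i := by
  induction k generalizing ω with
  | zero => rfl
  | succ k ih =>
    have h : S.substWeight (fun i => c * ω i) = fun i => c * S.substWeight ω i :=
      funext fun i => wdist_const_mul hc0 hc _ _
    rw [Function.iterate_succ_apply, h, ih]
    rfl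

theorem levelDist_mono {ω ω' : C → ℝ≥0∞} (h : ∀ j, ω j ≤ ω' j) (n : ℕ) (x y : S.Node) :
    S.levelDist n ω x y ≤ S.levelDist n ω' x y := wdist_mono (fun _ => h _) _ _

theorem levelDist_const_mul {c : ℝ≥0∞} (hc0 : c ≠ 0) (hc : c ≠ ⊤) (ω : C → ℝ≥0∞) (n : ℕ)
    (x y : S.Node) : S.levelDist n (fun i => c * ω i) x y = c * S.levelDist n ω x y :=
  wdist_const_mul hc0 hc _ _

section Fintype

variable [Fintype C]

/-- The node `p` is chosen before the weights, so that it serves all later levels at once. -/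
theorem exists_near_succ {n : ℕ} {x : S.Node} (hx : x ∈ S.nodes (n + 1)) :
    ∃ p ∈ S.nodes n, ∀ (ω : C → ℝ≥0∞) (c : ℝ≥0∞), c ≠ 0 → c ≠ ⊤ → (∀ j, ω j ≤ c) →
      S.levelDist (n + 1) ω x p ≤ c * S.ruleBound := by
  rcases mem_nodes_succ hx with h | ⟨a, z, rfl⟩
  · exact ⟨x, h, fun ω c _ _ _ => by simp [levelDist]⟩
  · refine ⟨(S.ends n a).1, (ends_mem_nodes n a).1, fun ω c hc0 hc hω => ?_⟩
    rw [levelDist, wdist_comm]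
    exact (levelDist_place_le n ω a z).trans (S.ruleDist_le hc0 hc hω _ _ _)

/-- The induction runs over all bounded weights, because each step down replaces the weights by the
substituted ones. -/
theorem levelDist_ne_top {n : ℕ} {x y : S.Node} (hx : x ∈ S.nodes n) (hy : y ∈ S.nodes n)
    {ω : C → ℝ≥0∞} {c : ℝ≥0∞} (hc0 : c ≠ 0) (hc : c ≠ ⊤) (hω : ∀ j, ω j ≤ c) :
    S.levelDist n ω x y ≠ ⊤ := by
  induction n generalizing x y ω c with
  | zero =>
    refine ne_top_of_le_ne_top ?_ ((levelDist_mono (ω' := fun _ => c * 1) (by simpa using hω) 0 x y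
      ).trans_eq (levelDist_const_mul hc0 hc (fun _ => 1) 0 x y))
    refine ENNReal.mul_ne_top hc ?_
    have hinl : ∀ x ∈ S.nodes 0, ∃ x' : S.init.V, x = Sum.inl x' := by
      rintro (x | ⟨k, a, x⟩) hx
      · exact ⟨x, rfl⟩
      · rw [inr_mem_nodes] at hx; omega
    obtain ⟨x, rfl⟩ := hinl x hx
    obtain ⟨y, rfl⟩ := hinl y hy
    refine ne_top_of_le_ne_top (S.init.wdist_one_ne_top x y) ?_
    exact IsPotential.le_wdist (φ := fun z => S.levelDist 0 (fun _ => 1) (Sum.inl x) (Sum.inl z))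
      (fun e => isPotential_wdist (src := fun e : S.Arc 0 => (S.ends 0 e).1)
        (tgt := fun e => (S.ends 0 e).2) (Sum.inl x) e) (wdist_self _) y
  | succ n ih =>
    obtain ⟨p, hp, hxp⟩ := exists_near_succ hx
    obtain ⟨q, hq, hyq⟩ := exists_near_succ hy
    have hR := S.ruleBound_ne_top
    have hR0 : S.ruleBound ≠ 0 := by simp [ruleBound]
    have hpq : S.levelDist (n + 1) ω p q ≠ ⊤ := by
      rw [levelDist_succ n ω hp hq]
      exact ih hp hq (mul_ne_zero hc0 hR0) (ENNReal.mul_ne_top hc hR)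
        fun j => S.ruleDist_le hc0 hc hω _ _ _
    have hqy := hyq ω c hc0 hc hω
    rw [levelDist, wdist_comm] at hqy
    have h1 := ne_top_of_le_ne_top (ENNReal.mul_ne_top hc hR) (hxp ω c hc0 hc hω)
    have h2 := ne_top_of_le_ne_top (ENNReal.mul_ne_top hc hR) hqy
    exact ne_top_of_le_ne_top (ENNReal.add_ne_top.2 ⟨h1, ENNReal.add_ne_top.2 ⟨hpq, h2⟩⟩)
      ((wdist_triangle x p y).trans (add_le_add_right (wdist_triangle p q y) _))

end Fintype

theorem dist_eq_toReal (n : ℕ) (x y : S.Node) :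
    ((S.graph n).dist x y : ℝ) = (S.levelDist n (fun _ => 1) x y).toReal := by
  rw [levelDist_one_eq_edist, SimpleGraph.dist]
  cases (S.graph n).edist x y <;> simp

namespace Growth

variable (H : S.Growth)

theorem lam_pos : 0 < H.lam := zero_lt_one.trans H.one_lt_lam

theorem lam_pow_pos (n : ℕ) : 0 < H.lam ^ n := pow_pos H.lam_pos n

/-- The limit weights of the colours. -/
noncomputable def weight (i : C) : ℝ≥0∞ := ENNReal.ofReal (H.w i)

theorem iterate_weight (k : ℕ) :
    S.substWeight^[k] H.weight = fun i => ENNReal.ofReal (H.lam ^ k) * H.weight i := by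
  have h0 : S.substWeight H.weight = fun i => ENNReal.ofReal H.lam * H.weight i := by
    rw [show H.weight = fun i => ENNReal.ofReal (H.w i) from rfl, H.substWeight_w]
    ext i
    rw [ENNReal.ofReal_mul H.lam_pos.le]
  induction k with
  | zero => simp
  | succ k ih =>
    rw [Function.iterate_succ_apply, h0, substWeight_iterate_const_mul
      (ENNReal.ofReal_pos.2 H.lam_pos).ne' ENNReal.ofReal_ne_top, ih]
    ext i
    rw [pow_succ', ENNReal.ofReal_mul H.lam_pos.le, mul_assoc]

/-- The limit of the distance in `Ξ^n`, divided by `lam ^ n`. -/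
noncomputable def ldist (x y : S.Node) : ℝ :=
  (S.levelDist (max (S.birth x) (S.birth y)) H.weight x y).toReal /
    H.lam ^ max (S.birth x) (S.birth y)

/-- Since `w` is an eigenvector, raising the level by k multiplies the weighted distance by `lam ^
k`; the quotient does not depend on the level. -/
theorem ldist_eq {n : ℕ} {x y : S.Node} (hx : x ∈ S.nodes n) (hy : y ∈ S.nodes n) :
    H.ldist x y = (S.levelDist n H.weight x y).toReal / H.lam ^ n := by
  set m := max (S.birth x) (S.birth y) with hm
  obtain ⟨k, rfl⟩ := Nat.exists_eq_add_of_le (max_le hx hy : m ≤ n)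
  rw [levelDist_add m k _ (le_max_left _ _ : S.birth x ≤ m) (le_max_right _ _ : S.birth y ≤ m),
    H.iterate_weight, levelDist_const_mul (ENNReal.ofReal_pos.2 (H.lam_pow_pos k)).ne'
    ENNReal.ofReal_ne_top, ENNReal.toReal_mul, ENNReal.toReal_ofReal (H.lam_pow_pos k).le, pow_add,
    mul_comm, mul_div_mul_right _ _ (H.lam_pow_pos k).ne']
  rfl

theorem ldist_nonneg (x y : S.Node) : 0 ≤ H.ldist x y :=
  div_nonneg ENNReal.toReal_nonneg (H.lam_pow_pos _).le

@[simp] theorem ldist_self (x : S.Node) : H.ldist x x = 0 := by simp [ldist, levelDist]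

theorem ldist_comm (x y : S.Node) : H.ldist x y = H.ldist y x := by
  rw [ldist, ldist, max_comm, levelDist, wdist_comm]
  rfl

variable [Fintype C]

/-- An upper bound for the limit weights. -/
noncomputable def wMax : ℝ := 1 + ∑ i, H.w i

theorem wMax_pos : 0 < H.wMax := by
  have : 0 ≤ ∑ i, H.w i := Finset.sum_nonneg fun i _ => (H.w_pos i).le
  unfold wMax; linarith

theorem w_le_wMax (i : C) : H.w i ≤ H.wMax := by
  have := Finset.single_le_sum (fun i _ => (H.w_pos i).le) (Finset.mem_univ i)
  unfold wMax; linarith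

/-- The smallest limit weight. -/
noncomputable def wMin : ℝ := ⨅ i, H.w i

theorem wMin_pos : 0 < H.wMin := by
  have := S.nonempty_colours
  obtain ⟨i, hi⟩ := exists_eq_ciInf_of_finite (f := H.w)
  rw [wMin, ← hi]
  exact H.w_pos i

theorem wMin_le (i : C) : H.wMin ≤ H.w i := ciInf_le (Finite.bddBelow_range _) i

theorem levelDist_weight_ne_top {n : ℕ} {x y : S.Node} (hx : x ∈ S.nodes n) (hy : y ∈ S.nodes n) :
    S.levelDist n H.weight x y ≠ ⊤ :=
  levelDist_ne_top hx hy (ENNReal.ofReal_pos.2 H.wMax_pos).ne' ENNReal.ofReal_ne_top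
    fun j => ENNReal.ofReal_le_ofReal (H.w_le_wMax j)

theorem ldist_triangle (x y z : S.Node) : H.ldist x z ≤ H.ldist x y + H.ldist y z := by
  set n := max (S.birth x) (max (S.birth y) (S.birth z))
  have hx : x ∈ S.nodes n := (le_max_left _ _ : S.birth x ≤ n)
  have hy : y ∈ S.nodes n := ((le_max_left _ _).trans (le_max_right _ _) : S.birth y ≤ n)
  have hz : z ∈ S.nodes n := ((le_max_right _ _).trans (le_max_right _ _) : S.birth z ≤ n)
  rw [H.ldist_eq hx hy, H.ldist_eq hy hz, H.ldist_eq hx hz, ← add_div]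
  have h1 := H.levelDist_weight_ne_top hx hy
  have h2 := H.levelDist_weight_ne_top hy hz
  refine div_le_div_of_nonneg_right ?_ (H.lam_pow_pos n).le
  rw [← ENNReal.toReal_add h1 h2]
  exact ENNReal.toReal_mono (ENNReal.add_ne_top.2 ⟨h1, h2⟩) (wdist_triangle x y z)

theorem ldist_ends_le (n : ℕ) (e : S.Arc n) :
    H.ldist (S.ends n e).1 (S.ends n e).2 ≤ H.wMax / H.lam ^ n := by
  rw [H.ldist_eq (ends_mem_nodes n e).1 (ends_mem_nodes n e).2]
  refine div_le_div_of_nonneg_right ?_ (H.lam_pow_pos n).le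
  refine ENNReal.toReal_le_of_le_ofReal H.wMax_pos.le ?_
  exact (wdist_arc_le e).trans (ENNReal.ofReal_le_ofReal (H.w_le_wMax _))

/-- The constant that bounds the distance of nodes of `Ξ` to those of `Ξ^n`. -/
noncomputable def K : ℝ := H.wMax / H.wMin * S.ruleBound.toReal / (H.lam - 1) + H.wMax *
  S.ruleBound.toReal

theorem ruleBound_toReal_pos : 0 < S.ruleBound.toReal :=
  ENNReal.toReal_pos (by simp [ruleBound]) S.ruleBound_ne_top

theorem K_pos : 0 < H.K := by
  have h1 := H.wMax_pos
  have h2 := H.wMin_pos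
  have h3 : 0 < S.ruleBound.toReal := ruleBound_toReal_pos
  have h4 := H.one_lt_lam
  have h5 : 0 < H.lam - 1 := by linarith
  unfold K
  positivity

theorem ldist_place_le (n : ℕ) (a : S.Arc n) (x : (S.rule (S.colour n a)).V) :
    H.ldist (S.ends n a).1 (S.place a (S.ends n a).1 (S.ends n a).2 x) ≤ H.K / H.lam ^ n := by
  have hp := ends_mem_nodes n a
  rw [H.ldist_eq (S.nodes_mono n.le_succ hp.1) (place_mem_nodes a hp.1 hp.2 x)]
  have h1 : S.levelDist (n + 1) H.weight (S.ends n a).1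
      (S.place a (S.ends n a).1 (S.ends n a).2 x) ≤
      ENNReal.ofReal (H.wMax * S.ruleBound.toReal) := by
    rw [ENNReal.ofReal_mul H.wMax_pos.le, ENNReal.ofReal_toReal S.ruleBound_ne_top]
    exact (levelDist_place_le n _ a x).trans (S.ruleDist_le
      (ENNReal.ofReal_pos.2 H.wMax_pos).ne' ENNReal.ofReal_ne_top
      (fun j => ENNReal.ofReal_le_ofReal (H.w_le_wMax j)) _ _ _)
  have h3 : 0 < S.ruleBound.toReal := ruleBound_toReal_pos
  have h4 := H.wMax_pos
  have h2 := ENNReal.toReal_le_of_le_ofReal (by positivity) h1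
  have hKle : H.wMax * S.ruleBound.toReal ≤ H.K := by
    have h5 : 0 < H.lam - 1 := by linarith [H.one_lt_lam]
    have h6 := H.wMin_pos
    unfold K
    have : 0 < H.wMax / H.wMin * S.ruleBound.toReal / (H.lam - 1) := by positivity
    linarith
  calc _ ≤ H.K / H.lam ^ (n + 1) :=
        div_le_div_of_nonneg_right (h2.trans hKle) (H.lam_pow_pos _).le
    _ ≤ _ := div_le_div_of_nonneg_left H.K_pos.le (H.lam_pow_pos n)
        (pow_le_pow_right₀ H.one_lt_lam.le n.le_succ)

/-- Coordinatewise 1 ≤ `w / wMin`, and the substitution is monotone and homogeneous. -/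
theorem iterate_one_le (k : ℕ) (i : C) :
    S.substWeight^[k] (fun _ => 1) i ≤ ENNReal.ofReal (H.wMax / H.wMin * H.lam ^ k) := by
  have h1 := H.wMin_pos
  have h2 := H.wMax_pos
  have hc : ENNReal.ofReal H.wMin⁻¹ ≠ 0 := (ENNReal.ofReal_pos.2 (inv_pos.2 h1)).ne'
  calc S.substWeight^[k] (fun _ => 1) i
      ≤ S.substWeight^[k] (fun i => ENNReal.ofReal H.wMin⁻¹ * H.weight i) i := by
        refine substWeight_iterate_mono (fun j => ?_) k i
        rw [weight, ← ENNReal.ofReal_mul (inv_pos.2 h1).le, ENNReal.one_le_ofReal,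
          inv_mul_eq_div, one_le_div h1]
        exact H.wMin_le j
    _ = ENNReal.ofReal (H.wMin⁻¹ * (H.lam ^ k * H.w i)) := by
        rw [substWeight_iterate_const_mul hc ENNReal.ofReal_ne_top, H.iterate_weight]
        simp only [weight]
        rw [← ENNReal.ofReal_mul (H.lam_pow_pos k).le, ← ENNReal.ofReal_mul (inv_pos.2 h1).le]
    _ ≤ _ := by
        refine ENNReal.ofReal_le_ofReal ?_
        calc H.wMin⁻¹ * (H.lam ^ k * H.w i) = H.w i / H.wMin * H.lam ^ k := by ring
          _ ≤ _ := by
            have := H.lam_pow_pos k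
            have := H.w_le_wMax i
            gcongr

/-- Every node of `Ξ^n` is close to a node of `Ξ^m`. -/
theorem exists_near {m n : ℕ} (hmn : m ≤ n) {x : S.Node} (hx : x ∈ S.nodes n) :
    ∃ p ∈ S.nodes m, ∀ k, S.levelDist (n + k) (fun _ => 1) x p ≤
      ENNReal.ofReal (H.wMax / H.wMin * S.ruleBound.toReal / (H.lam - 1) *
        (H.lam ^ (n + k) / H.lam ^ m - H.lam ^ k)) := by
  have h1 := H.wMin_pos
  have h2 := H.wMax_pos
  have h3 : 0 < S.ruleBound.toReal := ruleBound_toReal_pos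
  have h5 : 0 < H.lam - 1 := by linarith [H.one_lt_lam]
  induction n, hmn using Nat.le_induction generalizing x with
  | base => exact ⟨x, hx, fun k => by simp [levelDist]⟩
  | succ n hmn ih =>
    obtain ⟨p', hp', hnear⟩ := exists_near_succ hx
    obtain ⟨p, hp, hpk⟩ := ih hp'
    refine ⟨p, hp, fun k => (wdist_triangle x p' p).trans ?_⟩
    -- The descent from Ξ^(n+1) to Ξ^n costs at most this much; the bound in the statement is the
    -- geometric sum of such costs over all levels down to m.
    have hstep : S.levelDist (n + 1 + k) (fun _ => 1) x p' ≤
        ENNReal.ofReal (H.wMax / H.wMin * H.lam ^ k * S.ruleBound.toReal) := by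
      rw [levelDist_add (n + 1) k _ hx (S.nodes_mono n.le_succ hp'),
        ENNReal.ofReal_mul (mul_pos (div_pos h2 h1) (H.lam_pow_pos k)).le,
        ENNReal.ofReal_toReal S.ruleBound_ne_top]
      exact hnear _ _ (ENNReal.ofReal_pos.2 (mul_pos (div_pos h2 h1) (H.lam_pow_pos k))).ne'
        ENNReal.ofReal_ne_top (H.iterate_one_le k)
    have hrest := hpk (k + 1)
    rw [show n + (k + 1) = n + 1 + k by omega] at hrest
    refine (add_le_add hstep hrest).trans_eq ?_
    rw [← ENNReal.ofReal_add]
    · congr 1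
      have := (H.lam_pow_pos m).ne'
      have := h1.ne'
      have := h5.ne'
      field_simp
      ring
    · have := H.lam_pow_pos k
      positivity
    · refine mul_nonneg (by positivity) (sub_nonneg.2 ?_)
      rw [le_div_iff₀ (H.lam_pow_pos m), ← pow_add]
      exact pow_le_pow_right₀ H.one_lt_lam.le (by omega)

theorem exists_near_dist {m n : ℕ} (hmn : m ≤ n) {x : S.Node} (hx : x ∈ S.nodes n) :
    ∃ p ∈ S.nodes m, ∀ N ≥ n, ((S.graph N).dist x p : ℝ) / H.lam ^ N ≤ H.K / H.lam ^ m := by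
  have h1 := H.wMin_pos
  have h2 := H.wMax_pos
  have h3 : 0 < S.ruleBound.toReal := ruleBound_toReal_pos
  have h5 : 0 < H.lam - 1 := by linarith [H.one_lt_lam]
  obtain ⟨p, hp, h⟩ := H.exists_near hmn hx
  refine ⟨p, hp, fun N hN => ?_⟩
  obtain ⟨k, rfl⟩ := Nat.exists_eq_add_of_le hN
  rw [dist_eq_toReal, div_le_iff₀ (H.lam_pow_pos _)]
  have hle : H.wMax / H.wMin * S.ruleBound.toReal / (H.lam - 1) *
        (H.lam ^ (n + k) / H.lam ^ m - H.lam ^ k) ≤ H.K / H.lam ^ m * H.lam ^ (n + k) := by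
    have := H.lam_pow_pos (n + k)
    have := H.lam_pow_pos m
    have := H.lam_pow_pos k
    calc _ ≤ H.wMax / H.wMin * S.ruleBound.toReal / (H.lam - 1) *
          (H.lam ^ (n + k) / H.lam ^ m) := by gcongr; linarith
      _ ≤ H.K * (H.lam ^ (n + k) / H.lam ^ m) := by
          gcongr
          unfold K
          have : 0 < H.wMax * S.ruleBound.toReal := by positivity
          linarith
      _ = _ := by ring
  refine ENNReal.toReal_le_of_le_ofReal ?_ ((h k).trans (ENNReal.ofReal_le_ofReal hle))
  have := H.K_pos
  have := H.lam_pow_pos (n + k)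
  have := H.lam_pow_pos m
  positivity

/-- The distances in `Ξ^n`, divided by `lam ^ n`, converge. -/
theorem tendsto_dist (x y : S.Node) :
    Tendsto (fun n => ((S.graph n).dist x y : ℝ) / H.lam ^ n) atTop (𝓝 (H.ldist x y)) := by
  set m := max (S.birth x) (S.birth y) with hm
  have hx : x ∈ S.nodes m := (le_max_left _ _ : S.birth x ≤ m)
  have hy : y ∈ S.nodes m := (le_max_right _ _ : S.birth y ≤ m)
  have hD := H.levelDist_weight_ne_top hx hy
  rw [H.ldist_eq hx hy, ← tendsto_add_atTop_iff_nat m]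
  set D := S.levelDist m H.weight x y with hDdef
  -- For t near 1, the iterated weights are eventually sandwiched by multiples t λ^k w. Monotonicity
  -- and homogeneity of `levelDist` carry the sandwich over to distances.
  have hup : ∀ t : ℝ, 1 < t → ∀ᶠ k in atTop, ∀ i,
      (S.substWeight^[k] (fun _ => 1) i).toReal / H.lam ^ k ≤ t * H.w i := fun t ht =>
    eventually_all.2 fun i => (H.tendsto_iterate i).eventually_le_const (by nlinarith [H.w_pos i])
  have hlo : ∀ t : ℝ, t < 1 → ∀ᶠ k in atTop, ∀ i,
      t * H.w i ≤ (S.substWeight^[k] (fun _ => 1) i).toReal / H.lam ^ k := fun t ht =>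
    eventually_all.2 fun i => (H.tendsto_iterate i).eventually_const_le (by nlinarith [H.w_pos i])
  have hrw : ∀ k, ((S.graph (k + m)).dist x y : ℝ) / H.lam ^ (k + m) =
      (S.levelDist m (S.substWeight^[k] fun _ => 1) x y).toReal / H.lam ^ k / H.lam ^ m := by
    intro k
    rw [dist_eq_toReal, add_comm k m, levelDist_add m k _ hx hy, pow_add, div_div, mul_comm]
  simp only [hrw]
  refine Tendsto.div_const ?_ _
  have hcm : ∀ t : ℝ, 0 < t → ∀ k, S.levelDist m
      (fun i => ENNReal.ofReal (t * H.lam ^ k) * H.weight i) x y =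
      ENNReal.ofReal (t * H.lam ^ k) * D := fun t ht k =>
    levelDist_const_mul (ENNReal.ofReal_pos.2 (mul_pos ht (H.lam_pow_pos k))).ne'
      ENNReal.ofReal_ne_top _ _ _ _
  have hfin : ∀ k, S.levelDist m (S.substWeight^[k] fun _ => 1) x y ≠ ⊤ := fun k =>
    levelDist_ne_top hx hy (ENNReal.ofReal_pos.2 (mul_pos (div_pos H.wMax_pos H.wMin_pos)
      (H.lam_pow_pos k))).ne' ENNReal.ofReal_ne_top (H.iterate_one_le k)
  have hup' : ∀ t : ℝ, 1 < t → ∀ᶠ k in atTop,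
      (S.levelDist m (S.substWeight^[k] fun _ => 1) x y).toReal / H.lam ^ k ≤ t * D.toReal := by
    intro t ht
    filter_upwards [hup t ht] with k hk
    have ht0 : 0 < t := zero_lt_one.trans ht
    rw [div_le_iff₀ (H.lam_pow_pos k), mul_right_comm]
    have h1 := levelDist_mono (S := S) (ω := S.substWeight^[k] fun _ => 1)
      (ω' := fun i => ENNReal.ofReal (t * H.lam ^ k) * H.weight i) (fun i => by
        rw [weight, ← ENNReal.ofReal_mul (mul_pos ht0 (H.lam_pow_pos k)).le,
          ← ENNReal.ofReal_toReal (H.iterate_ne_top k i)]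
        refine ENNReal.ofReal_le_ofReal ?_
        have := (div_le_iff₀ (H.lam_pow_pos k)).1 (hk i)
        rwa [mul_right_comm] at this) m x y
    rw [hcm t ht0] at h1
    have h2 := ENNReal.toReal_mono (ENNReal.mul_ne_top ENNReal.ofReal_ne_top hD) h1
    rwa [ENNReal.toReal_mul, ENNReal.toReal_ofReal (mul_pos ht0 (H.lam_pow_pos k)).le] at h2
  have hlo' : ∀ t : ℝ, 0 < t → t < 1 → ∀ᶠ k in atTop,
      t * D.toReal ≤ (S.levelDist m (S.substWeight^[k] fun _ => 1) x y).toReal / H.lam ^ k := by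
    intro t ht0 ht
    filter_upwards [hlo t ht] with k hk
    rw [le_div_iff₀ (H.lam_pow_pos k), mul_right_comm]
    have h1 := levelDist_mono (S := S) (ω' := S.substWeight^[k] fun _ => 1)
      (ω := fun i => ENNReal.ofReal (t * H.lam ^ k) * H.weight i) (fun i => by
        rw [weight, ← ENNReal.ofReal_mul (mul_pos ht0 (H.lam_pow_pos k)).le,
          ← ENNReal.ofReal_toReal (H.iterate_ne_top k i)]
        refine ENNReal.ofReal_le_ofReal ?_
        have := (le_div_iff₀ (H.lam_pow_pos k)).1 (hk i)
        rwa [mul_right_comm] at this) m x y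
    rw [hcm t ht0] at h1
    have h2 := ENNReal.toReal_mono (hfin k) h1
    rwa [ENNReal.toReal_mul, ENNReal.toReal_ofReal (mul_pos ht0 (H.lam_pow_pos k)).le] at h2
  have hD0 : 0 ≤ D.toReal := ENNReal.toReal_nonneg
  refine tendsto_order.2 ⟨fun c hc => ?_, fun c hc => ?_⟩
  · by_cases hc0 : c < 0
    · exact Eventually.of_forall fun k => hc0.trans_le
        (div_nonneg ENNReal.toReal_nonneg (H.lam_pow_pos k).le)
    · push Not at hc0
      have hDpos : 0 < D.toReal := hc0.trans_lt hc
      obtain ⟨t, ht1, ht2⟩ := exists_between ((div_lt_one hDpos).2 hc)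
      filter_upwards [hlo' t ((div_nonneg hc0 hD0).trans_lt ht1) ht2] with k hk
      exact ((div_lt_iff₀ hDpos).1 ht1).trans_le hk
  · have : ∃ t : ℝ, 1 < t ∧ t * D.toReal < c := by
      rcases hD0.eq_or_lt with h | h
      · exact ⟨2, one_lt_two, by rw [← h] at hc ⊢; simpa using hc⟩
      · obtain ⟨t, ht1, ht2⟩ := exists_between ((one_lt_div h).2 hc)
        exact ⟨t, ht1, (lt_div_iff₀ h).1 ht2⟩
    obtain ⟨t, ht1, ht2⟩ := this
    filter_upwards [hup' t ht1] with k hk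
    exact hk.trans_lt ht2

theorem exists_near_ldist (m : ℕ) (x : S.Node) :
    ∃ p ∈ S.nodes m, H.ldist x p ≤ H.K / H.lam ^ m := by
  rcases le_total m (S.birth x) with h | h
  · obtain ⟨p, hp, hN⟩ := H.exists_near_dist h (S.mem_nodes_birth x)
    exact ⟨p, hp, le_of_tendsto (H.tendsto_dist x p) (eventually_atTop.2 ⟨_, hN⟩)⟩
  · exact ⟨x, h, by rw [ldist_self]; exact (div_pos H.K_pos (H.lam_pow_pos m)).le⟩

end Growth

end IteratedGraphSystem

/-! ### Diameters, scaled distances and the existence of the graph limit. -/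

namespace IteratedGraphSystem

variable {C : Type u} {S : IteratedGraphSystem.{u, v} C}

theorem graphDiam_bddAbove (n : ℕ) :
    BddAbove {d | ∃ x ∈ S.nodes n, ∃ y ∈ S.nodes n, d = (S.graph n).dist x y} := by
  refine ((Set.finite_range fun p : S.nodes n × S.nodes n =>
    (S.graph n).dist p.1.1 p.2.1).subset ?_).bddAbove
  rintro _ ⟨x, hx, y, hy, rfl⟩
  exact ⟨(⟨x, hx⟩, ⟨y, hy⟩), rfl⟩

theorem dist_le_graphDiam {n : ℕ} {x y : S.Node} (hx : x ∈ S.nodes n) (hy : y ∈ S.nodes n) :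
    (S.graph n).dist x y ≤ S.graphDiam n :=
  le_csSup (graphDiam_bddAbove n) ⟨x, hx, y, hy, rfl⟩

theorem exists_graphDiam_eq (n : ℕ) :
    ∃ x ∈ S.nodes n, ∃ y ∈ S.nodes n, S.graphDiam n = (S.graph n).dist x y := by
  obtain ⟨e⟩ := S.init_nonempty
  have h0 : (Sum.inl (S.init.src e) : S.Node) ∈ S.nodes n := Nat.zero_le n
  have hne : {d | ∃ x ∈ S.nodes n, ∃ y ∈ S.nodes n, d = (S.graph n).dist x y}.Nonempty :=
    ⟨_, _, h0, _, h0, rfl⟩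
  exact Nat.sSup_mem hne (graphDiam_bddAbove n)

namespace Growth

variable (H : S.Growth) [Fintype C]

/-- A jump of `wMin` is permitted along every arc, so every set of nodes gives a potential. The
positive lower bounds on `ldist` come from these. -/
theorem isLevelPotential_indicator (Z : Set S.Node) (n : ℕ) :
    S.IsLevelPotential n H.weight (Z.indicator fun _ => ENNReal.ofReal H.wMin) := by
  classical
  intro e
  have h : ENNReal.ofReal H.wMin ≤ H.weight (S.colour n e) :=
    ENNReal.ofReal_le_ofReal (H.wMin_le _)
  have hx : ∀ x : S.Node, (Z.indicator fun _ => ENNReal.ofReal H.wMin) x ≤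
      H.weight (S.colour n e) := fun x => (Set.indicator_le_self Z _ x).trans h
  exact ⟨(hx _).trans le_add_self, (hx _).trans le_add_self⟩

theorem wMin_le_ldist {n : ℕ} {x y : S.Node} (hx : x ∈ S.nodes n) (hy : y ∈ S.nodes n)
    (hxy : x ≠ y) : H.wMin / H.lam ^ n ≤ H.ldist x y := by
  rw [H.ldist_eq hx hy]
  refine div_le_div_of_nonneg_right ?_ (H.lam_pow_pos n).le
  refine (ENNReal.ofReal_le_iff_le_toReal (H.levelDist_weight_ne_top hx hy)).1 ?_
  have := (H.isLevelPotential_indicator {y} n).le_wdist (x := x) (by simp [hxy]) y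
  rwa [Set.indicator_of_mem (Set.mem_singleton y)] at this

/-- The limit of the diameter of `Ξ^n`, divided by `lam ^ n`. -/
noncomputable def diamLim : ℝ := ⨆ p : S.Node × S.Node, H.ldist p.1 p.2

theorem bddAbove_ldist : BddAbove (Set.range fun p : S.Node × S.Node => H.ldist p.1 p.2) := by
  obtain ⟨M, hM⟩ := (Set.finite_range fun p : S.nodes 0 × S.nodes 0 =>
    H.ldist p.1.1 p.2.1).bddAbove
  refine ⟨H.K + (M + H.K), ?_⟩
  rintro _ ⟨⟨x, y⟩, rfl⟩
  obtain ⟨p, hp, hxp⟩ := H.exists_near_ldist 0 x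
  obtain ⟨q, hq, hyq⟩ := H.exists_near_ldist 0 y
  rw [pow_zero, div_one] at hxp hyq
  have h1 := H.ldist_triangle x p y
  have h2 := H.ldist_triangle p q y
  rw [H.ldist_comm q y] at h2
  have h3 : H.ldist p q ≤ M := hM ⟨(⟨p, hp⟩, ⟨q, hq⟩), rfl⟩
  simp only
  linarith

theorem ldist_le_diamLim (x y : S.Node) : H.ldist x y ≤ H.diamLim :=
  le_ciSup H.bddAbove_ldist (x, y)

theorem diamLim_pos : 0 < H.diamLim := by
  obtain ⟨e⟩ : Nonempty (S.Arc 0) := S.init_nonempty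
  have h := ends_mem_nodes 0 e
  exact (div_pos H.wMin_pos (H.lam_pow_pos 0)).trans_le
    ((H.wMin_le_ldist h.1 h.2 (ends_ne 0 e)).trans (H.ldist_le_diamLim _ _))

/-- From below, one pair of nodes that nearly attains the supremum suffices. From above, all nodes
of Ξ^n are close, on the scale λ^n, to the finitely many nodes of Ξ^m, on which convergence is
uniform. -/
theorem tendsto_graphDiam :
    Tendsto (fun n => (S.graphDiam n : ℝ) / H.lam ^ n) atTop (𝓝 H.diamLim) := by
  have hinv : Tendsto (fun m : ℕ => 2 * (H.K / H.lam ^ m)) atTop (𝓝 0) := by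
    have := (tendsto_pow_atTop_atTop_of_one_lt H.one_lt_lam).const_div_atTop H.K
    simpa using this.const_mul 2
  refine tendsto_order.2 ⟨fun c hc => ?_, fun c hc => ?_⟩
  · have : Nonempty (S.Node × S.Node) :=
      ⟨(Sum.inl (S.init.src S.init_nonempty.some), Sum.inl (S.init.src S.init_nonempty.some))⟩
    obtain ⟨⟨x, y⟩, hxy⟩ := exists_lt_of_lt_ciSup hc
    filter_upwards [(H.tendsto_dist x y).eventually_const_lt hxy,
      eventually_ge_atTop (max (S.birth x) (S.birth y))] with n hn hge
    refine hn.trans_le (div_le_div_of_nonneg_right ?_ (H.lam_pow_pos n).le)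
    exact_mod_cast dist_le_graphDiam (n := n) ((le_max_left _ _).trans hge)
      ((le_max_right _ _).trans hge)
  · obtain ⟨c', hc1, hc2⟩ := exists_between hc
    obtain ⟨m, hm⟩ := (hinv.eventually_lt_const (sub_pos.2 hc2)).exists
    have hfin : ∀ᶠ n in atTop, ∀ p : S.nodes m × S.nodes m,
        ((S.graph n).dist p.1.1 p.2.1 : ℝ) / H.lam ^ n ≤ c' := eventually_all.2 fun p =>
      (H.tendsto_dist p.1.1 p.2.1).eventually_le_const
        ((H.ldist_le_diamLim _ _).trans_lt hc1)
    filter_upwards [hfin, eventually_ge_atTop m] with n hn hge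
    obtain ⟨x, hx, y, hy, hxy⟩ := exists_graphDiam_eq (S := S) n
    obtain ⟨p, hp, hxp⟩ := H.exists_near_dist hge hx
    obtain ⟨q, hq, hyq⟩ := H.exists_near_dist hge hy
    have h1 := hn (⟨p, hp⟩, ⟨q, hq⟩)
    have h2 := hxp n le_rfl
    have h3 := hyq n le_rfl
    have htri : ((S.graph n).dist x y : ℝ) ≤
        (S.graph n).dist x p + (S.graph n).dist p q + (S.graph n).dist y q := by
      have hne : ∀ {a b : S.Node}, a ∈ S.nodes n → b ∈ S.nodes n →
          S.levelDist n (fun _ => 1) a b ≠ ⊤ := fun ha hb =>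
        levelDist_ne_top ha hb one_ne_zero ENNReal.one_ne_top fun _ => le_rfl
      have hpn := S.nodes_mono hge hp
      have hqn := S.nodes_mono hge hq
      simp only [dist_eq_toReal]
      rw [← ENNReal.toReal_add (hne hx hpn) (hne hpn hqn),
        ← ENNReal.toReal_add (ENNReal.add_ne_top.2 ⟨hne hx hpn, hne hpn hqn⟩) (hne hy hqn)]
      refine ENNReal.toReal_mono (ENNReal.add_ne_top.2
        ⟨ENNReal.add_ne_top.2 ⟨hne hx hpn, hne hpn hqn⟩, hne hy hqn⟩) ?_
      refine (wdist_triangle x q y).trans (add_le_add (wdist_triangle x p q) ?_)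
      exact (wdist_comm q y).le
    rw [hxy]
    have h4 := div_le_div_of_nonneg_right htri (H.lam_pow_pos n).le
    rw [add_div, add_div] at h4
    linarith

theorem tendsto_scaledDist (x y : S.Node) :
    Tendsto (fun n => S.scaledDist n x y) atTop (𝓝 (H.ldist x y / H.diamLim)) := by
  refine ((H.tendsto_dist x y).div H.tendsto_graphDiam H.diamLim_pos.ne').congr fun n => ?_
  rw [Pi.div_apply, div_div_div_cancel_right₀ (H.lam_pow_pos n).ne']
  rfl

theorem limitDist_eq (x y : S.Node) : S.limitDist x y = H.ldist x y / H.diamLim :=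
  (H.tendsto_scaledDist x y).limUnder_eq

/-- The constant in the estimates of scaled limit distances. -/
noncomputable def κ : ℝ := 2 * (H.K * H.lam / (H.lam - 1) + H.wMax) / H.diamLim

theorem κ_pos : 0 < H.κ := by
  have h1 : 0 < H.lam - 1 := by linarith [H.one_lt_lam]
  have := H.K_pos
  have := H.wMax_pos
  have := H.diamLim_pos
  have := H.lam_pos
  unfold κ
  positivity

theorem le_κ {t : ℝ} (n : ℕ)
    (h : t ≤ 2 * (H.K * H.lam / (H.lam - 1)) / H.lam ^ n ∨ t ≤ H.wMax / H.lam ^ n) :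
    t / H.diamLim ≤ H.κ / H.lam ^ n := by
  have h1 : 0 < H.lam - 1 := by linarith [H.one_lt_lam]
  have h2 := H.K_pos
  have h3 := H.wMax_pos
  have h4 := H.diamLim_pos
  have h5 := H.lam_pos
  have h7 := H.lam_pow_pos n
  have h6 : 0 < H.K * H.lam / (H.lam - 1) := by positivity
  rw [κ, div_right_comm]
  refine div_le_div_of_nonneg_right ?_ h4.le
  rcases h with h | h
  · exact h.trans (div_le_div_of_nonneg_right (by linarith) h7.le)
  · exact h.trans (div_le_div_of_nonneg_right (by linarith) h7.le)

theorem exists_near_limitDist (m : ℕ) (x : S.Node) :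
    ∃ p ∈ S.nodes m, S.limitDist x p ≤ H.κ / H.lam ^ m := by
  obtain ⟨p, hp, h⟩ := H.exists_near_ldist m x
  refine ⟨p, hp, ?_⟩
  rw [H.limitDist_eq]
  refine H.le_κ m (Or.inl (h.trans (div_le_div_of_nonneg_right ?_ (H.lam_pow_pos m).le)))
  have h1 : 0 < H.lam - 1 := by linarith [H.one_lt_lam]
  have h2 := H.K_pos
  have h3 : H.K ≤ H.K * H.lam / (H.lam - 1) := by
    rw [le_div_iff₀ h1]
    exact mul_le_mul_of_nonneg_left (by linarith) h2.le
  linarith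

theorem limitDist_self (H : S.Growth) (x : S.Node) : S.limitDist x x = 0 := by
  rw [H.limitDist_eq, ldist_self, zero_div]

theorem limitDist_comm (H : S.Growth) (x y : S.Node) : S.limitDist x y = S.limitDist y x := by
  rw [H.limitDist_eq, H.limitDist_eq, ldist_comm]

theorem limitDist_nonneg (H : S.Growth) (x y : S.Node) : 0 ≤ S.limitDist x y := by
  rw [H.limitDist_eq]
  exact div_nonneg (H.ldist_nonneg x y) H.diamLim_pos.le

theorem limitDist_triangle (H : S.Growth) (x y z : S.Node) :
    S.limitDist x z ≤ S.limitDist x y + S.limitDist y z := by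
  simp only [H.limitDist_eq]
  rw [← add_div]
  exact div_le_div_of_nonneg_right (H.ldist_triangle x y z) H.diamLim_pos.le

/-! ### Arcs of the graph limit -/

/-- The beginning node moves by at most `K / lam ^ m` from level m to m + 1; the right side is the
telescoped geometric series. -/
theorem ldist_arc_le (e : S.LimitArc) {n m : ℕ} (h : n ≤ m) :
    H.ldist (S.ends n (e.1 n)).1 (S.ends m (e.1 m)).1 ≤
      H.K * H.lam / (H.lam - 1) * (1 / H.lam ^ n - 1 / H.lam ^ m) := by
  have h1 : 0 < H.lam - 1 := by linarith [H.one_lt_lam]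
  induction m, h using Nat.le_induction with
  | base => simp
  | succ m h ih =>
    refine (H.ldist_triangle _ (S.ends m (e.1 m)).1 _).trans ?_
    have hstep : H.ldist (S.ends m (e.1 m)).1 (S.ends (m + 1) (e.1 (m + 1))).1 ≤
        H.K / H.lam ^ m := by
      rw [← e.2 m]
      exact H.ldist_place_le m _ _
    refine (add_le_add ih hstep).trans_eq ?_
    have := (H.lam_pow_pos m).ne'
    have := (H.lam_pow_pos n).ne'
    have := H.lam_pos.ne'
    have := h1.ne'
    field_simp
    ring

theorem limitDist_arc_le (e : S.LimitArc) {n m : ℕ} (h : n ≤ m) :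
    S.limitDist (S.ends n (e.1 n)).1 (S.ends m (e.1 m)).1 ≤ H.κ / H.lam ^ n := by
  have h1 : 0 < H.lam - 1 := by linarith [H.one_lt_lam]
  rw [H.limitDist_eq]
  refine H.le_κ n (Or.inl ((H.ldist_arc_le e h).trans ?_))
  have := H.K_pos
  have := H.lam_pos
  have hm := H.lam_pow_pos m
  have hn := H.lam_pow_pos n
  have h3 : 0 < H.K * H.lam / (H.lam - 1) := by positivity
  have h4 : 0 < 1 / H.lam ^ m := by positivity
  have h5 : 0 < 1 / H.lam ^ n := by positivity
  calc _ ≤ H.K * H.lam / (H.lam - 1) * (1 / H.lam ^ n) := by gcongr; linarith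
    _ ≤ 2 * (H.K * H.lam / (H.lam - 1)) * (1 / H.lam ^ n) := by gcongr; linarith
    _ = _ := by ring

theorem tendsto_κ : Tendsto (fun n : ℕ => H.κ / H.lam ^ n) atTop (𝓝 0) :=
  (tendsto_pow_atTop_atTop_of_one_lt H.one_lt_lam).const_div_atTop H.κ

/-- After level N each of the two beginning nodes moves by at most `κ / lam ^ N`, so the distances
form a Cauchy sequence. -/
theorem tendsto_limitArcDist (H : S.Growth) (e f : S.LimitArc) :
    Tendsto (fun n => S.limitDist (S.ends n (e.1 n)).1 (S.ends n (f.1 n)).1) atTop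
      (𝓝 (S.limitArcDist e f)) := by
  refine tendsto_nhds_limUnder (cauchySeq_tendsto_of_complete ?_)
  refine cauchySeq_of_le_tendsto_0 (fun n : ℕ => 2 * (2 * (H.κ / H.lam ^ n))) ?_ ?_
  · intro n m N hn hm
    have key : ∀ k, N ≤ k → |S.limitDist (S.ends k (e.1 k)).1 (S.ends k (f.1 k)).1 -
        S.limitDist (S.ends N (e.1 N)).1 (S.ends N (f.1 N)).1| ≤ 2 * (H.κ / H.lam ^ N) := by
      intro k hk
      have h1 := H.limitDist_arc_le e hk
      have h2 := H.limitDist_arc_le f hk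
      set x := (S.ends N (e.1 N)).1
      set x' := (S.ends k (e.1 k)).1
      set y := (S.ends N (f.1 N)).1
      set y' := (S.ends k (f.1 k)).1
      have h3 := H.limitDist_triangle x' x y'
      have h4 := H.limitDist_triangle x y y'
      have h5 := H.limitDist_triangle x x' y
      have h6 := H.limitDist_triangle x' y' y
      rw [H.limitDist_comm x' x] at h3
      rw [H.limitDist_comm y' y] at h6
      rw [abs_le]
      constructor <;> linarith
    rw [Real.dist_eq]
    have h1 := abs_le.1 (key n hn)
    have h2 := abs_le.1 (key m hm)
    rw [abs_le]
    constructor <;> linarith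
  · simpa using (H.tendsto_κ.const_mul 2).const_mul 2

theorem limitArcDist_le_of_eq {e f : S.LimitArc} {n : ℕ} (h : e.1 n = f.1 n) :
    S.limitArcDist e f ≤ 2 * H.κ / H.lam ^ n := by
  refine le_of_tendsto (H.tendsto_limitArcDist e f) ?_
  filter_upwards [eventually_ge_atTop n] with m hm
  have h1 := H.limitDist_arc_le e hm
  have h2 := H.limitDist_arc_le f hm
  have h3 := H.limitDist_triangle (S.ends m (e.1 m)).1 (S.ends n (e.1 n)).1 (S.ends m (f.1 m)).1
  rw [H.limitDist_comm] at h1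
  rw [← h] at h2
  rw [mul_div_assoc]
  linarith

theorem limitExists (H : S.Growth) : S.LimitExists := by
  refine ⟨fun x y => ?_, fun e => ?_, H.tendsto_limitArcDist⟩
  · rw [H.limitDist_eq]
    exact H.tendsto_scaledDist x y
  · refine squeeze_zero (fun n => H.limitDist_nonneg _ _) (fun n => ?_) H.tendsto_κ
    rw [H.limitDist_eq]
    exact H.le_κ n (Or.inr (H.ldist_ends_le n _))

end Growth

end IteratedGraphSystem

namespace IteratedGraphSystem

variable {C : Type u} {S : IteratedGraphSystem.{u, v} C}

/-! ### Ancestors of arcs and separation -/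

/-- The arc of `Ξ^m` out of which an arc of `Ξ^n` arises. -/
def anc {m n : ℕ} (h : m ≤ n) : S.Arc n → S.Arc m :=
  Nat.leRec (motive := fun n _ => S.Arc n → S.Arc m) id (fun n _ f e => f (S.parent n e)) h

@[simp] theorem anc_self {m : ℕ} (e : S.Arc m) : anc le_rfl e = e := by
  simp [anc]

theorem anc_succ {m n : ℕ} (h : m ≤ n) (h' : m ≤ n + 1) (e : S.Arc (n + 1)) :
    anc h' e = anc h (S.parent n e) := by
  simp [anc, Nat.leRec_succ _ _ h]

theorem anc_anc {l m n : ℕ} (h : l ≤ m) (h' : m ≤ n) (e : S.Arc n) :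
    anc h (anc h' e) = anc (h.trans h') e := by
  induction n, h' using Nat.le_induction with
  | base => simp
  | succ n h' ih => rw [anc_succ h', anc_succ (h.trans h'), ih]

theorem parent_anc {m n : ℕ} (h : m + 1 ≤ n) (e : S.Arc n) :
    S.parent m (anc h e) = anc (m.le_succ.trans h) e := by
  rw [← anc_anc m.le_succ h, anc_succ le_rfl, anc_self]

theorem LimitArc.anc_eq (e : S.LimitArc) {m n : ℕ} (h : m ≤ n) : anc h (e.1 n) = e.1 m := by
  induction n, h using Nat.le_induction with
  | base => simp
  | succ n h ih => rw [anc_succ h, e.2, ih]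

/-- The nodes strictly inside the copy that replaces an arc. -/
def inside {m : ℕ} (a : S.Arc m) : Set S.Node :=
  {z | ∃ (n : ℕ) (h : m ≤ n) (b : S.Arc n)
    (x : {x : (S.rule (S.colour n b)).V // x ≠ S.A (S.colour n b) ∧ x ≠ S.B (S.colour n b)}),
    z = Sum.inr ⟨n, b, x⟩ ∧ anc h b = a}

theorem notMem_inside {m : ℕ} {a : S.Arc m} {z : S.Node} (hz : z ∈ S.nodes m) : z ∉ inside a := by
  rintro ⟨n, h, b, x, rfl, -⟩
  rw [inr_mem_nodes] at hz
  omega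

theorem inside_unique {m : ℕ} {a b : S.Arc m} {z : S.Node} (ha : z ∈ inside a)
    (hb : z ∈ inside b) : a = b := by
  obtain ⟨n, h, c, x, rfl, rfl⟩ := ha
  obtain ⟨n', h', c', x', heq, rfl⟩ := hb
  cases heq
  rfl

/-- Being one of the two ends of an arc. -/
def IsEnd {n : ℕ} (e : S.Arc n) (z : S.Node) : Prop := z = (S.ends n e).1 ∨ z = (S.ends n e).2

theorem IsEnd.mem_nodes {n : ℕ} {e : S.Arc n} {z : S.Node} (h : IsEnd e z) : z ∈ S.nodes n := by
  rcases h with rfl | rfl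
  exacts [(ends_mem_nodes n e).1, (ends_mem_nodes n e).2]

theorem isEnd_or_inside_place {m n : ℕ} (h : m ≤ n) (a : S.Arc n) (x : (S.rule (S.colour n a)).V) :
    IsEnd a (S.place a (S.ends n a).1 (S.ends n a).2 x) ∨
      S.place a (S.ends n a).1 (S.ends n a).2 x ∈ inside (anc h a) := by
  by_cases hA : x = S.A _
  · subst hA; left; left; simp
  by_cases hB : x = S.B _
  · subst hB; left; right; simp
  · right
    exact ⟨n, h, a, ⟨x, hA, hB⟩, place_of_ne _ _ _ hA hB, rfl⟩

theorem isEnd_or_inside {m n : ℕ} (h : m ≤ n) (e : S.Arc n) {z : S.Node} (hz : IsEnd e z) :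
    IsEnd (anc h e) z ∨ z ∈ inside (anc h e) := by
  induction n, h using Nat.le_induction generalizing z with
  | base => left; simpa using hz
  | succ n h ih =>
    rw [anc_succ h]
    have key : IsEnd (S.parent n e) z ∨ z ∈ inside (anc h (S.parent n e)) := by
      rcases hz with rfl | rfl
      · exact isEnd_or_inside_place h e.1 _
      · exact isEnd_or_inside_place h e.1 _
    rcases key with hk | hk
    · exact ih _ hk
    · exact Or.inr hk

/-- A potential on `Ξ^m` for iterated substituted weights extends to `Ξ^(m+k)`. -/
theorem IsLevelPotential.exists_extension_iterate {m : ℕ} (k : ℕ) {ω : C → ℝ≥0∞}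
    {φ : S.Node → ℝ≥0∞} (hφ : S.IsLevelPotential m (S.substWeight^[k] ω) φ) :
    ∃ ψ : S.Node → ℝ≥0∞, S.IsLevelPotential (m + k) ω ψ ∧
      ∀ (e : S.Arc (m + k)) (z : S.Node), IsEnd e z → ∀ a, a = anc (Nat.le_add_right m k) e →
        ψ z ∈ Set.Icc (min (φ (S.ends m a).1) (φ (S.ends m a).2))
          (max (φ (S.ends m a).1) (φ (S.ends m a).2)) := by
  induction k generalizing ω with
  | zero =>
    refine ⟨φ, hφ, fun e z hz a ha => ?_⟩
    have ha' : a = e := ha.trans (anc_self e)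
    subst ha'
    rcases hz with rfl | rfl
    · exact ⟨min_le_left _ _, le_max_left _ _⟩
    · exact ⟨min_le_right _ _, le_max_right _ _⟩
  | succ k ih =>
    obtain ⟨ψ, hψ, hval⟩ := ih (ω := S.substWeight ω) hφ
    obtain ⟨χ, hχ, -, hval'⟩ := hψ.exists_extension
    refine ⟨χ, hχ, fun e z hz a ha => ?_⟩
    have ha' : a = anc (Nat.le_add_right m k) (S.parent (m + k) e) :=
      ha.trans (anc_succ _ _ e)
    have h1 := hval (S.parent (m + k) e) _ (Or.inl rfl) a ha'
    have h2 := hval (S.parent (m + k) e) _ (Or.inr rfl) a ha'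
    have h3 : χ z ∈ Set.Icc (min (ψ (S.ends (m + k) (S.parent (m + k) e)).1)
          (ψ (S.ends (m + k) (S.parent (m + k) e)).2))
        (max (ψ (S.ends (m + k) (S.parent (m + k) e)).1)
          (ψ (S.ends (m + k) (S.parent (m + k) e)).2)) := by
      rcases hz with rfl | rfl
      · exact hval' e.1 _
      · exact hval' e.1 _
    exact ⟨(le_min h1.1 h2.1).trans h3.1, h3.2.trans (max_le h1.2 h2.2)⟩

/-- An arc of `Ξ^n` that shares no end with its ancestor in `Ξ^m`. -/
def Detached {m n : ℕ} (h : m ≤ n) (e : S.Arc n) : Prop :=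
  ∀ z, IsEnd e z → ¬ IsEnd (anc h e) z

namespace Growth

variable (H : S.Growth) [Fintype C]

/-- Take the potential on Ξ^n that is constant on the nodes strictly inside the copy replacing `e.1
m` and zero elsewhere. Detachment puts both ends of `e.1 n` inside, while both ends of `f.1 n` are
outside. Extensions stay between the end values of each arc, so the potential is constant on the
descendants of either arc and the gap persists at level N. -/
theorem le_ldist_of_detached (e f : S.LimitArc) {m n N : ℕ} (hmn : m ≤ n) (hnN : n ≤ N)
    (hef : e.1 m ≠ f.1 m) (he : Detached hmn (e.1 n)) :
    H.wMin / H.lam ^ n ≤ H.ldist (S.ends N (e.1 N)).1 (S.ends N (f.1 N)).1 := by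
  obtain ⟨k, rfl⟩ := Nat.exists_eq_add_of_le hnN
  set Z := inside (e.1 m) with hZ
  set φ : S.Node → ℝ≥0∞ := fun z =>
    ENNReal.ofReal (H.lam ^ k) * (Z.indicator fun _ => ENNReal.ofReal H.wMin) z with hφ
  have hpot : S.IsLevelPotential n (S.substWeight^[k] H.weight) φ := by
    rw [H.iterate_weight]
    exact (H.isLevelPotential_indicator Z n).const_mul _
  obtain ⟨ψ, hψ, hval⟩ := hpot.exists_extension_iterate k
  have hanc : ∀ g : S.LimitArc, g.1 n = anc (Nat.le_add_right n k) (g.1 (n + k)) := fun g =>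
    (LimitArc.anc_eq g _).symm
  have hin : ∀ z, IsEnd (e.1 n) z → φ z = ENNReal.ofReal (H.lam ^ k * H.wMin) := by
    intro z hz
    have : z ∈ Z := by
      have h1 := isEnd_or_inside hmn (e.1 n) hz
      rw [LimitArc.anc_eq] at h1
      rcases h1 with h1 | h1
      · refine absurd ?_ (he z hz)
        rwa [LimitArc.anc_eq]
      · exact h1
    rw [hφ, ENNReal.ofReal_mul (H.lam_pow_pos k).le]
    simp only
    rw [Set.indicator_of_mem this]
  have hout : ∀ z, IsEnd (f.1 n) z → φ z = 0 := by
    intro z hz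
    have : z ∉ Z := by
      intro hzZ
      have h1 := isEnd_or_inside hmn (f.1 n) hz
      rw [LimitArc.anc_eq] at h1
      rcases h1 with h1 | h1
      · exact notMem_inside h1.mem_nodes hzZ
      · exact hef (inside_unique hzZ h1)
    rw [hφ]
    simp only
    rw [Set.indicator_of_notMem this, mul_zero]
  have h1 := hval (e.1 (n + k)) _ (Or.inl rfl) _ (hanc e)
  have h2 := hval (f.1 (n + k)) _ (Or.inl rfl) _ (hanc f)
  rw [hin _ (Or.inl rfl), hin _ (Or.inr rfl), min_self, max_self, Set.Icc_self] at h1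
  rw [hout _ (Or.inl rfl), hout _ (Or.inr rfl), min_self, max_self, Set.Icc_self] at h2
  have h3 := hψ.le_wdist h2 (S.ends (n + k) (e.1 (n + k))).1
  rw [h1, wdist_comm] at h3
  have hx := (ends_mem_nodes (n + k) (e.1 (n + k))).1
  have hy := (ends_mem_nodes (n + k) (f.1 (n + k))).1
  rw [H.ldist_eq hx hy]
  have h4 := (ENNReal.ofReal_le_iff_le_toReal (H.levelDist_weight_ne_top hx hy)).1 h3
  rw [div_le_div_iff₀ (H.lam_pow_pos n) (H.lam_pow_pos _), pow_add]
  calc H.wMin * (H.lam ^ n * H.lam ^ k) = (H.lam ^ k * H.wMin) * H.lam ^ n := by ring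
    _ ≤ _ := mul_le_mul_of_nonneg_right h4 (H.lam_pow_pos n).le

theorem le_limitArcDist_of_detached (e f : S.LimitArc) {m n : ℕ} (hmn : m ≤ n)
    (hef : e.1 m ≠ f.1 m) (he : Detached hmn (e.1 n)) :
    H.wMin / H.diamLim / H.lam ^ n ≤ S.limitArcDist e f := by
  refine ge_of_tendsto (H.tendsto_limitArcDist e f) ?_
  filter_upwards [eventually_ge_atTop n] with N hN
  rw [H.limitDist_eq, div_right_comm]
  exact div_le_div_of_nonneg_right (H.le_ldist_of_detached e f hmn hN hef he) H.diamLim_pos.le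

end Growth

end IteratedGraphSystem

namespace IteratedGraphSystem

variable {C : Type u} {S : IteratedGraphSystem.{u, v} C}

/-! ### Counting arcs -/

noncomputable instance fintypeRuleE (i : C) : Fintype (S.rule i).E := Fintype.ofFinite _

/-- The arc of `Ξ^(n+1)` given by an arc of the rule graph that replaces an arc of `Ξ^n`. -/
def child {n : ℕ} (a : S.Arc n) (x : (S.rule (S.colour n a)).E) : S.Arc (n + 1) := ⟨a, x⟩

theorem parent_child {n : ℕ} (a : S.Arc n) (x : (S.rule (S.colour n a)).E) :
    S.parent n (child a x) = a := rfl

theorem colour_child {n : ℕ} (a : S.Arc n) (x : (S.rule (S.colour n a)).E) :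
    S.colour (n + 1) (child a x) = (S.rule (S.colour n a)).col x := rfl

theorem sum_arc_succ {R : Type*} [AddCommMonoid R] (n : ℕ) (F : S.Arc (n + 1) → R) :
    ∑ e, F e = ∑ a : S.Arc n, ∑ x : (S.rule (S.colour n a)).E, F (child a x) := by
  have h := Fintype.sum_sigma' fun (a : S.Arc n) (x : (S.rule (S.colour n a)).E) => F (child a x)
  rw [← h]
  exact Fintype.sum_equiv (ι := S.Arc (n + 1))
    (Equiv.refl ((a : S.Arc n) × (S.rule (S.colour n a)).E) :
      S.Arc (n + 1) ≃ (a : S.Arc n) × (S.rule (S.colour n a)).E) F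
    (fun p => F (child p.1 p.2)) fun _ => rfl

/-- Every node of a rule graph is an end of some arc. -/
theorem exists_rule_arc (i : C) (x : (S.rule i).V) :
    ∃ e, (S.rule i).src e = x ∨ (S.rule i).tgt e = x := by
  by_cases h : x = S.A i
  · exact (S.rule i).exists_arc_of_ne (y := S.B i) (by rw [h]; exact S.A_ne_B i)
  · exact (S.rule i).exists_arc_of_ne h

/-- No arc of a rule graph joins the marked nodes. -/
theorem not_rule_arc_join (i : C) (e : (S.rule i).E)
    (hA : (S.rule i).src e = S.A i ∨ (S.rule i).tgt e = S.A i)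
    (hB : (S.rule i).src e = S.B i ∨ (S.rule i).tgt e = S.B i) : False := by
  have hadj : (S.rule i).underlying.Adj (S.A i) (S.B i) := by
    have h := (S.rule i).adj_underlying e
    rcases hA with hA | hA <;> rcases hB with hB | hB
    · exact absurd (hA.symm.trans hB) (S.A_ne_B i)
    · rwa [hA, hB] at h
    · rw [hA, hB] at h; exact h.symm
    · exact absurd (hA.symm.trans hB) (S.A_ne_B i)
  have := S.two_le_dist i
  rw [SimpleGraph.dist_eq_one_iff_adj.2 hadj] at this
  omega

theorem isEnd_of_isEnd_succ {n : ℕ} {e : S.Arc (n + 1)} {p : S.Node} (hp : p ∈ S.nodes n)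
    (h : IsEnd e p) :
    (p = (S.ends n e.1).1 ∧ ((S.rule _).src e.2 = S.A (S.colour n e.1) ∨
      (S.rule _).tgt e.2 = S.A (S.colour n e.1))) ∨
    (p = (S.ends n e.1).2 ∧ ((S.rule _).src e.2 = S.B (S.colour n e.1) ∨
      (S.rule _).tgt e.2 = S.B (S.colour n e.1))) := by
  have key : ∀ x, p = S.place e.1 (S.ends n e.1).1 (S.ends n e.1).2 x →
      (p = (S.ends n e.1).1 ∧ x = S.A (S.colour n e.1)) ∨
      (p = (S.ends n e.1).2 ∧ x = S.B (S.colour n e.1)) := by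
    intro x hx
    by_cases hA : x = S.A (S.colour n e.1)
    · exact Or.inl ⟨by rw [hx, hA, place_A], hA⟩
    by_cases hB : x = S.B (S.colour n e.1)
    · exact Or.inr ⟨by rw [hx, hB, place_B], hB⟩
    rw [place_of_ne _ _ _ hA hB] at hx
    subst hx
    rw [inr_mem_nodes] at hp
    omega
  rcases h with h | h
  · rcases key _ h with ⟨h1, h2⟩ | ⟨h1, h2⟩
    exacts [Or.inl ⟨h1, Or.inl h2⟩, Or.inr ⟨h1, Or.inl h2⟩]
  · rcases key _ h with ⟨h1, h2⟩ | ⟨h1, h2⟩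
    exacts [Or.inl ⟨h1, Or.inr h2⟩, Or.inr ⟨h1, Or.inr h2⟩]

variable (S) in
/-- A positive eigenvector of the substitution matrix, and a bound for the part of it that the arcs
at one of the marked nodes contribute. -/
structure ArcWeights where
  rho : ℝ
  w : C → ℝ
  θ : ℝ
  one_lt_rho : 1 < rho
  w_pos : ∀ i, 0 < w i
  θ_nonneg : 0 ≤ θ
  θ_lt_one : θ < 1
  sum_w : ∀ i, ∑ e : (S.rule i).E, w ((S.rule i).col e) = rho * w i
  sub_w_le : ∀ i j, rho * w i - w j ≤ θ * (rho * w i)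

theorem IsPrimitive.exists_arcWeights [Fintype C] [DecidableEq C] (hS : S.IsPrimitive) :
    ∃ W : S.ArcWeights, W.rho = specRadius S.M := by
  have := S.nonempty_colours
  obtain ⟨w, hw, heq⟩ := exists_perron_vector hS.1
  have hrho : 1 < specRadius S.M := by have := hS.two_le_rho; linarith
  have hpos : ∀ i, 0 < specRadius S.M * w i := fun i => mul_pos (by linarith) (hw i)
  have hsum : ∀ i, ∑ e : (S.rule i).E, w ((S.rule i).col e) = specRadius S.M * w i := by
    intro i
    have h1 := congrFun heq i
    simp only [Matrix.mulVec, dotProduct, M, Pi.smul_apply, smul_eq_mul] at h1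
    rw [ColouredDigraph.sum_chi_mul] at h1
    rw [← h1]
    refine Finset.sum_congr ?_ fun _ _ => rfl
    ext e
    simp
  have hle : ∀ i j, specRadius S.M * w i - w j < specRadius S.M * w i := fun i j => by
    linarith [hw j]
  obtain ⟨⟨i0, j0⟩, hmax⟩ := Finite.exists_max fun p : C × C =>
    (specRadius S.M * w p.1 - w p.2) / (specRadius S.M * w p.1)
  set t := (specRadius S.M * w i0 - w j0) / (specRadius S.M * w i0) with ht
  -- θ is the largest share of a parent's weight that can remain after the loss of one child arc;
  -- the maximum with 0 gives nonnegativity without further argument.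
  refine ⟨⟨specRadius S.M, w, max t 0, hrho, hw, le_max_right _ _, max_lt ?_ one_pos, hsum,
    fun i j => ?_⟩, rfl⟩
  · rw [ht, div_lt_one (hpos i0)]
    exact hle i0 j0
  · exact ((div_le_iff₀ (hpos i)).1 (hmax (i, j))).trans
      (mul_le_mul_of_nonneg_right (le_max_left _ _) (hpos i).le)

namespace ArcWeights

variable (W : S.ArcWeights)

theorem rho_pos : 0 < W.rho := zero_lt_one.trans W.one_lt_rho

open scoped Classical in
theorem sum_descendants {m n : ℕ} (h : m ≤ n) (a : S.Arc m) :
    ∑ e : S.Arc n, (if anc h e = a then W.w (S.colour n e) else 0) =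
      W.rho ^ (n - m) * W.w (S.colour m a) := by
  induction n, h using Nat.le_induction with
  | base => simp
  | succ n h ih =>
    rw [sum_arc_succ, Nat.succ_sub h, pow_succ', mul_assoc, ← ih, Finset.mul_sum]
    refine Finset.sum_congr rfl fun b _ => ?_
    simp only [anc_succ h, parent_child, colour_child]
    split_ifs
    · exact W.sum_w _
    · simp

open scoped Classical in
-- When `p` is an end of `a`, some arc of the copy at the opposite marked node misses `p`, since no
-- rule arc joins the marked nodes. Omitting it leaves at most the share θ.
theorem sum_isEnd_le {n : ℕ} (a : S.Arc n) {p : S.Node} (hp : p ∈ S.nodes n) :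
    ∑ x : (S.rule (S.colour n a)).E,
      (if IsEnd (child a x) p then W.w ((S.rule (S.colour n a)).col x) else 0) ≤
      if IsEnd a p then W.θ * (W.rho * W.w (S.colour n a)) else 0 := by
  split_ifs with hap
  · obtain ⟨x₀, hx₀⟩ : ∃ x₀, ¬ IsEnd (child a x₀) p := by
      rcases hap with hap | hap
      · obtain ⟨x₀, hx₀⟩ := exists_rule_arc (S.colour n a) (S.B _)
        refine ⟨x₀, fun hend => ?_⟩
        rcases isEnd_of_isEnd_succ hp hend with ⟨-, h⟩ | ⟨h, -⟩
        · exact not_rule_arc_join _ _ h hx₀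
        · exact ends_ne n a (hap.symm.trans h)
      · obtain ⟨x₀, hx₀⟩ := exists_rule_arc (S.colour n a) (S.A _)
        refine ⟨x₀, fun hend => ?_⟩
        rcases isEnd_of_isEnd_succ hp hend with ⟨h, -⟩ | ⟨-, h⟩
        · exact ends_ne n a (h.symm.trans hap)
        · exact not_rule_arc_join _ _ hx₀ h
    refine le_trans ?_ (W.sub_w_le (S.colour n a) ((S.rule (S.colour n a)).col x₀))
    have h0 := Finset.sum_erase Finset.univ (f := fun x => if IsEnd (child a x) p then
      W.w ((S.rule (S.colour n a)).col x) else 0) (a := x₀) (if_neg hx₀)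
    rw [← W.sum_w, ← Finset.sum_erase_eq_sub (Finset.mem_univ x₀), ← h0]
    refine Finset.sum_le_sum fun x _ => ?_
    split_ifs
    · exact le_rfl
    · exact (W.w_pos _).le
  · refine (Finset.sum_eq_zero fun x _ => if_neg fun hend => hap ?_).le
    rcases isEnd_of_isEnd_succ hp hend with ⟨h, -⟩ | ⟨h, -⟩
    exacts [Or.inl h, Or.inr h]

open scoped Classical in
-- Each generation multiplies the weight at a fixed node by at most θρ, against ρ for all
-- descendants, so the share of touching arcs decays geometrically.
theorem sum_touching_le {m n : ℕ} (h : m ≤ n) (a : S.Arc m) {p : S.Node} (hp : p ∈ S.nodes m) :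
    ∑ e : S.Arc n, (if anc h e = a ∧ IsEnd e p then W.w (S.colour n e) else 0) ≤
      (W.θ * W.rho) ^ (n - m) * W.w (S.colour m a) := by
  induction n, h using Nat.le_induction with
  | base =>
    simp only [anc_self, tsub_self, pow_zero, one_mul]
    calc _ ≤ ∑ e : S.Arc m, (if e = a then W.w (S.colour m e) else 0) :=
          Finset.sum_le_sum fun e _ => by
            have := (W.w_pos (S.colour m e)).le
            split_ifs with h1 h2 h2
            · exact le_rfl
            · exact absurd h1.1 h2
            · exact this
            · exact le_rfl
      _ = _ := by simp
  | succ n h ih =>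
    rw [sum_arc_succ, Nat.succ_sub h, pow_succ', mul_assoc]
    refine le_trans ?_ (mul_le_mul_of_nonneg_left ih (mul_nonneg W.θ_nonneg W.rho_pos.le))
    rw [Finset.mul_sum]
    refine Finset.sum_le_sum fun b _ => ?_
    simp only [anc_succ h, parent_child, colour_child]
    by_cases hb : anc h b = a
    · simp only [hb, true_and]
      refine (W.sum_isEnd_le b (S.nodes_mono h hp)).trans_eq ?_
      split_ifs
      · ring
      · simp
    · simp [hb]

open scoped Classical in
/-- Most descendants of an arc, measured by weights, are detached from it. -/
theorem le_sum_detached {m n : ℕ} (h : m ≤ n) (a : S.Arc m) :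
    (1 - 2 * W.θ ^ (n - m)) * W.rho ^ (n - m) * W.w (S.colour m a) ≤
      ∑ e : S.Arc n, (if anc h e = a ∧ Detached h e then W.w (S.colour n e) else 0) := by
  have h0 := W.sum_descendants h a
  have h1 := W.sum_touching_le h a (ends_mem_nodes m a).1
  have h2 := W.sum_touching_le h a (ends_mem_nodes m a).2
  have h3 : ∑ e : S.Arc n, (if anc h e = a then W.w (S.colour n e) else 0) ≤
      ∑ e : S.Arc n, (if anc h e = a ∧ Detached h e then W.w (S.colour n e) else 0) +
      (∑ e : S.Arc n, (if anc h e = a ∧ IsEnd e (S.ends m a).1 then W.w (S.colour n e) else 0) +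
      ∑ e : S.Arc n, (if anc h e = a ∧ IsEnd e (S.ends m a).2 then W.w (S.colour n e) else 0)) := by
    rw [← Finset.sum_add_distrib, ← Finset.sum_add_distrib]
    refine Finset.sum_le_sum fun e _ => ?_
    have hw := (W.w_pos (S.colour n e)).le
    by_cases ha : anc h e = a
    · have hcase : Detached h e ∨ IsEnd e (S.ends m a).1 ∨ IsEnd e (S.ends m a).2 := by
        by_contra! hcon
        refine hcon.1 fun z hz hz' => ?_
        rw [ha] at hz'
        rcases hz' with rfl | rfl
        exacts [hcon.2.1 hz, hcon.2.2 hz]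
      simp only [ha, true_and, if_true]
      split_ifs <;> first | linarith | (exfalso; tauto)
    · simp [ha]
  rw [mul_pow] at h1 h2
  linarith [mul_assoc (W.θ ^ (n - m)) (W.rho ^ (n - m)) (W.w (S.colour m a)),
    mul_assoc 2 (W.θ ^ (n - m) * W.rho ^ (n - m)) (W.w (S.colour m a))]

end ArcWeights

end IteratedGraphSystem

/-! ### Covers of the branches of a tree -/

open scoped Classical in
/-- If a finitely branching tree carries a superadditive mass, then a family of nodes of total cost
less than the mass of the root can be avoided by a branch: at each node of the branch, the total cost
of the family below it is less than the mass. Here `D n a i` means that the `i`-th member of the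
family lies below `a`. -/
theorem exists_branch_avoiding {X : ℕ → Type*} (ch : ∀ n, X n → Finset (X (n + 1)))
    (μ : ∀ n, X n → ℝ≥0∞) (hμ : ∀ n a, μ n a ≤ ∑ b ∈ ch n a, μ (n + 1) b) {ι : Type*}
    (D : ∀ n, X n → ι → Prop) (huniq : ∀ n a a' i, D n a i → D n a' i → a = a')
    (hstep : ∀ n a b i, b ∈ ch n a → D (n + 1) b i → D n a i) (c : ι → ℝ≥0∞) (r : X 0)
    (hlt : ∑' i, c i < μ 0 r) :
    ∃ x : ∀ n, X n, x 0 = r ∧ (∀ n, x (n + 1) ∈ ch n (x n)) ∧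
      ∀ n i, D n (x n) i → c i < μ n (x n) := by
  -- Total cost below a node. If it is less than the mass, the same holds for some child: otherwise
  -- summing over the children, below which lie disjoint subfamilies, would contradict
  -- superadditivity.
  set T : ∀ n, X n → ℝ≥0∞ := fun n a => ∑' i, if D n a i then c i else 0 with hT
  have hex : ∀ n (a : {a // T n a < μ n a}), ∃ b : {b // T (n + 1) b < μ (n + 1) b},
      b.1 ∈ ch n a.1 := by
    rintro n ⟨a, ha⟩
    by_contra! hcon
    refine absurd ha (not_lt.2 ?_)
    calc μ n a ≤ ∑ b ∈ ch n a, μ (n + 1) b := hμ n a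
      _ ≤ ∑ b ∈ ch n a, T (n + 1) b := Finset.sum_le_sum fun b hb => by
          by_contra! hlt'
          exact hcon ⟨b, hlt'⟩ hb
      _ = ∑' i, ∑ b ∈ ch n a, if D (n + 1) b i then c i else 0 :=
          (Summable.tsum_finsetSum fun _ _ => ENNReal.summable).symm
      _ ≤ T n a := ENNReal.tsum_le_tsum fun i => by
          by_cases h : ∃ b ∈ ch n a, D (n + 1) b i
          · obtain ⟨b, hb, hD⟩ := h
            rw [Finset.sum_eq_single_of_mem b hb fun b' _ hne =>
              if_neg fun hD' => hne (huniq _ _ _ i hD' hD), if_pos hD,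
              if_pos (hstep n a b i hb hD)]
          · push Not at h
            rw [Finset.sum_eq_zero fun b hb => if_neg (h b hb)]
            exact zero_le
  choose f hf using hex
  have hr : T 0 r < μ 0 r := lt_of_le_of_lt (ENNReal.tsum_le_tsum fun i => by
    split_ifs
    exacts [le_rfl, zero_le]) hlt
  set y : ∀ n, {a // T n a < μ n a} := fun n => Nat.rec ⟨r, hr⟩ (fun n a => f n a) n with hy
  refine ⟨fun n => (y n).1, rfl, fun n => hf n (y n), fun n i hD => ?_⟩
  refine lt_of_le_of_lt ?_ (y n).2
  refine le_trans ?_ (ENNReal.le_tsum i)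
  rw [if_pos hD]

/-! ### Mass distribution on the limit arcs. -/

namespace IteratedGraphSystem

variable {C : Type u} {S : IteratedGraphSystem.{u, v} C}

/-- A limit arc from its members at the multiples of `K`. -/
theorem exists_limitArc {K : ℕ} (hK : 0 < K) (x : ∀ n, S.Arc (K * n))
    (hx : ∀ n, anc (Nat.mul_le_mul_left K n.le_succ) (x (n + 1)) = x n) :
    ∃ e : S.LimitArc, ∀ n, e.1 (K * n) = x n := by
  have hle : ∀ m, m ≤ K * m := fun m => Nat.le_mul_of_pos_left m hK
  have hanc : ∀ {n m} (h : n ≤ m), anc (Nat.mul_le_mul_left K h) (x m) = x n := by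
    intro n m h
    induction m, h using Nat.le_induction with
    | base => simp
    | succ m h ih =>
      rw [← ih, ← hx m, anc_anc]
  refine ⟨⟨fun m => anc (hle m) (x m), fun m => ?_⟩, fun n => ?_⟩
  · change S.parent m (anc _ _) = anc _ (x m)
    rw [parent_anc, ← hx m, anc_anc]
  · exact hanc (hle n)

open scoped Classical in
/-- The mass distribution principle for the limit arcs. -/
theorem exists_le_tsum_of_cover [Fintype C] (H : S.Growth) (W : S.ArcWeights) {s : ℝ} (hs : 0 ≤ s)
    (hlt : H.lam ^ s < W.rho) :
    ∃ c : ℝ, 0 < c ∧ ∀ {ι : Type*} (U : ι → Set S.LimitArc) (ℓ : ι → ℝ), (∀ e, ∃ i, e ∈ U i) →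
      (∀ i, 0 < ℓ i) → (∀ i, ∀ e ∈ U i, ∀ f ∈ U i, S.limitArcDist e f ≤ ℓ i) →
      ENNReal.ofReal c ≤ ∑' i, ENNReal.ofReal (ℓ i ^ s) := by
  set q := H.lam ^ s with hq
  have hq1 : 1 ≤ q := Real.one_le_rpow H.one_lt_lam.le hs
  have hq0 : 0 < q := zero_lt_one.trans_le hq1
  have hρ := W.rho_pos
  -- Both (q/ρ)^K and 2θ^K tend to 0, so for large K the detached descendants compensate the
  -- normalisation by q^K.
  obtain ⟨K, hK, hKq⟩ : ∃ K, 0 < K ∧ q ^ K ≤ (1 - 2 * W.θ ^ K) * W.rho ^ K := by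
    have h1 : Tendsto (fun K : ℕ => (q / W.rho) ^ K + 2 * W.θ ^ K) atTop (𝓝 (0 + 2 * 0)) :=
      (tendsto_pow_atTop_nhds_zero_of_lt_one (div_nonneg hq0.le hρ.le)
        ((div_lt_one hρ).2 hlt)).add
        ((tendsto_pow_atTop_nhds_zero_of_lt_one W.θ_nonneg W.θ_lt_one).const_mul 2)
    obtain ⟨K, hK1, hK2⟩ := ((h1.eventually_lt_const (by norm_num : (0 : ℝ) + 2 * 0 < 1)).and
      (eventually_gt_atTop 0)).exists
    refine ⟨K, hK2, ?_⟩
    rw [← div_le_iff₀ (pow_pos hρ K), ← div_pow]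
    linarith
  set c₀ := H.wMin / H.diamLim with hc₀
  have hc₀pos : 0 < c₀ := div_pos H.wMin_pos H.diamLim_pos
  have hlevel : ∀ n, K * n ≤ K * (n + 1) := fun n => Nat.mul_le_mul_left K n.le_succ
  obtain ⟨r⟩ : Nonempty (S.Arc (K * 0)) := S.init_nonempty
  obtain ⟨wmax, hwmax0, hwmax⟩ : ∃ t, 0 < t ∧ ∀ i, W.w i ≤ t := by
    have := S.nonempty_colours
    obtain ⟨i, hi⟩ := Finite.exists_max W.w
    exact ⟨W.w i, W.w_pos i, hi⟩
  set B := wmax * q ^ (2 * K) / c₀ ^ s with hB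
  have hBpos : 0 < B := by positivity
  -- Levels are grouped in blocks of length K. The tree keeps only detached children, and by the
  -- choice of K this mass is superadditive on it.
  set μ : ∀ n, S.Arc (K * n) → ℝ≥0∞ := fun n a =>
    ENNReal.ofReal (W.w (S.colour _ a) / q ^ (K * n)) with hμdef
  set ch : ∀ n, S.Arc (K * n) → Finset (S.Arc (K * (n + 1))) := fun n a =>
    {b | anc (hlevel n) b = a ∧ Detached (hlevel n) b} with hch
  have hμ : ∀ n a, μ n a ≤ ∑ b ∈ ch n a, μ (n + 1) b := by
    intro n a
    simp only [hμdef, hch]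
    rw [← ENNReal.ofReal_sum_of_nonneg fun b _ => div_nonneg (W.w_pos _).le (pow_nonneg hq0.le _)]
    refine ENNReal.ofReal_le_ofReal ?_
    have h1 := W.le_sum_detached (hlevel n) a
    rw [← Finset.sum_filter, show K * (n + 1) - K * n = K by rw [mul_add]; omega] at h1
    rw [← Finset.sum_div, div_le_div_iff₀ (pow_pos hq0 _) (pow_pos hq0 _)]
    have h2 : q ^ K * W.w (S.colour _ a) ≤ (1 - 2 * W.θ ^ K) * W.rho ^ K * W.w (S.colour _ a) :=
      mul_le_mul_of_nonneg_right hKq (W.w_pos _).le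
    calc _ = q ^ K * W.w (S.colour _ a) * q ^ (K * n) := by rw [mul_add, pow_add, mul_one]; ring
      _ ≤ _ := mul_le_mul_of_nonneg_right (h2.trans h1) (pow_nonneg hq0.le _)
  refine ⟨W.w (S.colour _ r) / B, div_pos (W.w_pos _) hBpos, ?_⟩
  intro ι U ℓ hU hℓ hdiam
  by_contra! hsum
  set Ret : Set S.LimitArc := {e | e.1 (K * 0) = r ∧ ∀ n, Detached (hlevel n) (e.1 (K * (n + 1)))}
    with hRet
  have hexn : ∀ i, ∃ n, c₀ / H.lam ^ (K * (n + 2)) ≤ ℓ i := by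
    intro i
    have h1 : Tendsto (fun n : ℕ => c₀ / H.lam ^ (K * (n + 2))) atTop (𝓝 0) := by
      refine Tendsto.const_div_atTop ?_ _
      refine (tendsto_pow_atTop_atTop_of_one_lt H.one_lt_lam).comp ?_
      exact tendsto_atTop_mono (fun n => (Nat.le_add_right n 2).trans
        (Nat.le_mul_of_pos_left _ hK)) tendsto_id
    exact (h1.eventually_le_const (hℓ i)).exists
  set N : ι → ℕ := fun i => Nat.find (hexn i) with hN
  have hNle : ∀ i, c₀ / H.lam ^ (K * (N i + 2)) ≤ ℓ i := fun i => Nat.find_spec (hexn i)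
  have hcell : ∀ i, ∀ e ∈ U i ∩ Ret, ∀ f ∈ U i ∩ Ret, e.1 (K * N i) = f.1 (K * N i) := by
    intro i e he f hf
    rcases hNi : N i with _ | k
    · exact he.2.1.trans hf.2.1.symm
    · by_contra hne
      have hnot : ¬ c₀ / H.lam ^ (K * (k + 2)) ≤ ℓ i := Nat.find_min (hexn i) (by
        change k < N i; omega)
      refine hnot ?_
      exact (H.le_limitArcDist_of_detached e f (hlevel (k + 1)) hne (he.2.2 (k + 1))).trans
        (hdiam i e he.1 f hf.1)
  -- Sets that miss the retained tree are discarded; each other set is charged the mass of its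
  -- single cylinder.
  set J := {i // (U i ∩ Ret).Nonempty}
  choose g hg using fun i : J => i.2
  set c : J → ℝ≥0∞ := fun i => μ (N i.1) ((g i).1 _) with hc
  have hcle : ∀ i : J, c i ≤ ENNReal.ofReal B * ENNReal.ofReal (ℓ i.1 ^ s) := by
    intro i
    rw [← ENNReal.ofReal_mul hBpos.le]
    refine ENNReal.ofReal_le_ofReal ?_
    have h1 : c₀ ^ s / q ^ (K * (N i.1 + 2)) ≤ ℓ i.1 ^ s := by
      have h2 := Real.rpow_le_rpow (div_pos hc₀pos (H.lam_pow_pos _)).le (hNle i.1) hs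
      rw [Real.div_rpow hc₀pos.le (H.lam_pow_pos _).le] at h2
      rwa [hq, ← Real.rpow_natCast, ← Real.rpow_mul H.lam_pos.le, mul_comm s,
        Real.rpow_mul H.lam_pos.le, Real.rpow_natCast]
    calc _ ≤ wmax / q ^ (K * N i.1) :=
          div_le_div_of_nonneg_right (hwmax _) (pow_nonneg hq0.le _)
      _ = B * (c₀ ^ s / q ^ (K * (N i.1 + 2))) := by
          have h3 : q ^ (K * (N i.1 + 2)) = q ^ (K * N i.1) * q ^ (2 * K) := by
            rw [← pow_add]; congr 1; ring
          have h4 : c₀ ^ s ≠ 0 := (Real.rpow_pos_of_pos hc₀pos s).ne'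
          rw [hB, h3]
          field_simp
      _ ≤ _ := mul_le_mul_of_nonneg_left h1 hBpos.le
  have hclt : ∑' i, c i < μ 0 r := by
    calc ∑' i, c i ≤ ∑' i : J, ENNReal.ofReal B * ENNReal.ofReal (ℓ i.1 ^ s) :=
          ENNReal.tsum_le_tsum hcle
      _ = ENNReal.ofReal B * ∑' i : J, ENNReal.ofReal (ℓ i.1 ^ s) := ENNReal.tsum_mul_left
      _ ≤ ENNReal.ofReal B * ∑' i, ENNReal.ofReal (ℓ i ^ s) := by
          gcongr
          exact ENNReal.tsum_comp_le_tsum_of_injective Subtype.val_injective _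
      _ < ENNReal.ofReal B * ENNReal.ofReal (W.w (S.colour _ r) / B) :=
          ENNReal.mul_lt_mul_right (ENNReal.ofReal_pos.2 hBpos).ne' ENNReal.ofReal_ne_top hsum
      _ = μ 0 r := by
          rw [← ENNReal.ofReal_mul hBpos.le, mul_div_cancel₀ _ hBpos.ne']
          simp [hμdef]
  -- The avoiding branch defines a retained limit arc. The set that contains it has its cylinder on
  -- this branch, where cost and mass coincide, contrary to strict inequality.
  obtain ⟨x, hx0, hxch, hx⟩ := exists_branch_avoiding ch μ hμ
    (fun n a (i : J) => ∃ h : K * n ≤ K * N i.1, anc h ((g i).1 (K * N i.1)) = a)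
    (fun n a a' i ⟨_, h⟩ ⟨_, h'⟩ => h.symm.trans h')
    (fun n a b i hb ⟨h, hD⟩ => ⟨(hlevel n).trans h, by
      have h1 := (Finset.mem_filter.1 hb).2.1
      rw [← anc_anc (hlevel n) h, hD, h1]⟩) c r hclt
  obtain ⟨e, he⟩ := exists_limitArc hK x fun n => (Finset.mem_filter.1 (hxch n)).2.1
  have heRet : e ∈ Ret := ⟨(he 0).trans hx0, fun n => by
    rw [he]
    exact (Finset.mem_filter.1 (hxch n)).2.2⟩
  obtain ⟨i, hi⟩ := hU e
  set j : J := ⟨i, ⟨e, hi, heRet⟩⟩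
  have hej : (g j).1 (K * N i) = x (N i) := by
    rw [← he]
    exact hcell i _ (hg j) _ ⟨hi, heRet⟩
  have := hx (N i) j ⟨le_rfl, by rw [anc_self]; exact hej⟩
  refine absurd this (not_lt.2 ?_)
  rw [← hej]

end IteratedGraphSystem

/-! ### Dimensions -/

namespace GraphDim

variable {α : Type v} {δ : α → α → ℝ}

theorem diam_le {U : Set α} {t : ℝ} (h : ∀ x ∈ U, ∀ y ∈ U, δ x y ≤ t) :
    diam δ U ≤ ENNReal.ofReal t :=
  iSup₂_le fun x hx => iSup₂_le fun y hy => ENNReal.ofReal_le_ofReal (h x hx y hy)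

theorem ofReal_le_diam {U : Set α} {x y : α} (hx : x ∈ U) (hy : y ∈ U) :
    ENNReal.ofReal (δ x y) ≤ diam δ U :=
  le_iSup₂_of_le x hx (le_iSup₂_of_le y hy le_rfl)

theorem coveringNumber_le {ι : Type*} [Fintype ι] {ℓ : ℝ} (U : ι → Set α) (hU : ∀ x, ∃ i, x ∈ U i)
    (hd : ∀ i, diam δ (U i) < ENNReal.ofReal ℓ) : coveringNumber δ ℓ ≤ Fintype.card ι := by
  refine (iInf₂_le_of_le (Set.range U) ?_ (iInf_le _ ?_)).trans ?_
  · rw [Set.sUnion_range]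
    exact Set.eq_univ_of_forall fun x => Set.mem_iUnion.2 (hU x)
  · rintro _ ⟨i, rfl⟩
    exact hd i
  · rw [← Set.image_univ]
    exact (Set.encard_image_le _ _).trans_eq (by simp)

theorem exists_cover_of_coveringNumber {ℓ : ℝ} (h : coveringNumber δ ℓ ≠ ⊤) :
    ∃ 𝒰 : Set (Set α), ⋃₀ 𝒰 = Set.univ ∧ (∀ U ∈ 𝒰, diam δ U < ENNReal.ofReal ℓ) ∧ 𝒰.Finite ∧
      𝒰.ncard ≤ (coveringNumber δ ℓ).toNat := by
  have hlt : coveringNumber δ ℓ < (((coveringNumber δ ℓ).toNat + 1 : ℕ) : ℕ∞) := by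
    conv_lhs => rw [← ENat.natCast_toNat h]
    exact_mod_cast Nat.lt_succ_self _
  conv_lhs at hlt => unfold coveringNumber
  simp only [iInf_lt_iff] at hlt
  obtain ⟨𝒰, h1, h2, h3⟩ := hlt
  have hfin : 𝒰.Finite := Set.encard_lt_top_iff.1 (h3.trans_le le_top)
  refine ⟨𝒰, h1, h2, hfin, ?_⟩
  rw [← hfin.cast_ncard_eq] at h3
  exact Nat.lt_succ_iff.1 (by exact_mod_cast h3)

/-- The exponent of a function between multiples of powers. -/
theorem tendsto_log_div_log {N : ℝ → ℝ} {d : ℝ} (hd : 0 < d)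
    (hup : ∃ c : ℝ, 0 < c ∧ ∀ ℓ, 0 < ℓ → ℓ < 1 → N ℓ ≤ c * (ℓ ^ d)⁻¹)
    (hlo : ∀ s, 0 ≤ s → s < d → ∃ c : ℝ, 0 < c ∧ ∀ ℓ, 0 < ℓ → ℓ < 1 → c * (ℓ ^ s)⁻¹ ≤ N ℓ) :
    Tendsto (fun ℓ => Real.log (N ℓ) / (-Real.log ℓ)) (𝓝[>] 0) (𝓝 d) := by
  have hT : Tendsto (fun ℓ => -Real.log ℓ) (𝓝[>] 0) atTop :=
    tendsto_neg_atBot_atTop.comp Real.tendsto_log_nhdsGT_zero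
  have hIoo : ∀ᶠ ℓ : ℝ in 𝓝[>] 0, 0 < ℓ ∧ ℓ < 1 := by
    filter_upwards [Ioo_mem_nhdsGT (zero_lt_one' ℝ)] with ℓ hℓ using hℓ
  have hlim : ∀ c s : ℝ, Tendsto (fun ℓ => Real.log c / (-Real.log ℓ) + s) (𝓝[>] 0) (𝓝 s) :=
    fun c s => by simpa using (hT.const_div_atTop (Real.log c)).add_const s
  have hlog : ∀ c s ℓ : ℝ, 0 < c → 0 < ℓ → Real.log (c * (ℓ ^ s)⁻¹) =
      Real.log c + s * (-Real.log ℓ) := fun c s ℓ hc hℓ => by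
    rw [Real.log_mul hc.ne' (inv_pos.2 (Real.rpow_pos_of_pos hℓ s)).ne', Real.log_inv,
      Real.log_rpow hℓ]
    ring
  -- The exponent 0 yields positivity of `N`, needed to compare logarithms.
  obtain ⟨c₀, hc₀, hN₀⟩ := hlo 0 le_rfl hd
  have hNpos : ∀ ℓ, 0 < ℓ → ℓ < 1 → 0 < N ℓ := fun ℓ h0 h1 =>
    lt_of_lt_of_le (by positivity) (hN₀ ℓ h0 h1)
  refine tendsto_order.2 ⟨fun a ha => ?_, fun a ha => ?_⟩
  · obtain ⟨s, hs1, hs2⟩ := exists_between (max_lt ha hd)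
    obtain ⟨c, hc, hN⟩ := hlo s ((le_max_right _ _).trans hs1.le) hs2
    filter_upwards [hIoo, (hlim c s).eventually_const_lt ((le_max_left _ _).trans_lt hs1)]
      with ℓ hℓ hlt
    have hpos : 0 < -Real.log ℓ := neg_pos.2 (Real.log_neg hℓ.1 hℓ.2)
    refine hlt.trans_le ?_
    rw [div_add' _ _ _ hpos.ne']
    refine div_le_div_of_nonneg_right ?_ hpos.le
    rw [← hlog c s ℓ hc hℓ.1]
    have := Real.rpow_pos_of_pos hℓ.1 s
    exact Real.log_le_log (by positivity) (hN ℓ hℓ.1 hℓ.2)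
  · obtain ⟨c, hc, hN⟩ := hup
    filter_upwards [hIoo, (hlim c d).eventually_lt_const ha] with ℓ hℓ hlt
    have hpos : 0 < -Real.log ℓ := neg_pos.2 (Real.log_neg hℓ.1 hℓ.2)
    refine lt_of_le_of_lt ?_ hlt
    rw [div_add' _ _ _ hpos.ne']
    refine div_le_div_of_nonneg_right ?_ hpos.le
    rw [← hlog c d ℓ hc hℓ.1]
    exact Real.log_le_log (hNpos ℓ hℓ.1 hℓ.2) (hN ℓ hℓ.1 hℓ.2)

/-- The cover is padded with empty sets to a sequence; `0 < s` makes their cost `0 ^ s` vanish. -/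
theorem premeasure_le_of_fintype_cover {ι : Type*} [Fintype ι] {s : ℝ} (hs : 0 < s) {r t : ℝ}
    (htr : t ≤ r) (V : ι → Set α) (hV : ∀ x, ∃ i, x ∈ V i)
    (hd : ∀ i, diam δ (V i) ≤ ENNReal.ofReal t) :
    (⨅ (U : ℕ → Set α) (_ : ⋃ i, U i = Set.univ) (_ : ∀ i, diam δ (U i) ≤ ENNReal.ofReal r),
      ∑' i, diam δ (U i) ^ s) ≤ Fintype.card ι * ENNReal.ofReal t ^ s := by
  set f : ι → ℕ := fun i => Fintype.equivFin ι i with hf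
  have hinj : Function.Injective f := fun i j h => (Fintype.equivFin ι).injective (Fin.ext h)
  set U : ℕ → Set α := fun n => {x | ∃ i, f i = n ∧ x ∈ V i} with hU
  have hUf : ∀ i, U (f i) = V i := fun i => by
    ext x
    constructor
    · rintro ⟨j, hj, hx⟩
      rwa [← hinj hj]
    · exact fun hx => ⟨i, rfl, hx⟩
  have hUn : ∀ n, n ∉ Set.range f → U n = ∅ := fun n hn =>
    Set.eq_empty_of_forall_notMem fun x ⟨i, hi, _⟩ => hn ⟨i, hi⟩
  have hempty : diam δ (∅ : Set α) = 0 := by simp [diam]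
  refine iInf₂_le_of_le U ?_ (iInf_le_of_le (fun n => ?_) ?_)
  · refine Set.eq_univ_of_forall fun x => ?_
    obtain ⟨i, hi⟩ := hV x
    exact Set.mem_iUnion.2 ⟨f i, i, rfl, hi⟩
  · by_cases hn : n ∈ Set.range f
    · obtain ⟨i, rfl⟩ := hn
      rw [hUf]
      exact (hd i).trans (ENNReal.ofReal_le_ofReal htr)
    · rw [hUn n hn, hempty]
      exact zero_le
  · rw [← hinj.tsum_eq, tsum_fintype]
    · calc _ ≤ ∑ _i : ι, ENNReal.ofReal t ^ s := Finset.sum_le_sum fun i _ => by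
            rw [hUf]
            exact ENNReal.rpow_le_rpow (hd i) hs.le
        _ = _ := by rw [Finset.sum_const, nsmul_eq_mul, Finset.card_univ]
    · intro n hn
      by_contra hcon
      refine hn ?_
      simp only [hUn n hcon, hempty, ENNReal.zero_rpow_of_pos hs]

theorem hausdorffDim_le {d : ℝ} (h : ∀ s : ℝ≥0, d < s → 0 < s → hausdorffMeasure δ s = 0) :
    hausdorffDim δ ≤ ENNReal.ofReal d := by
  refine le_of_forall_gt_imp_ge_of_dense fun c hc => ?_
  obtain ⟨s, hs1, hs2⟩ := ENNReal.lt_iff_exists_nnreal_btwn.1 hc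
  refine (iInf₂_le s (h s ?_ ?_)).trans hs2.le
  · by_contra! hle
    exact absurd hs1 (not_lt.2 (by
      rw [← ENNReal.ofReal_coe_nnreal]; exact ENNReal.ofReal_le_ofReal hle))
  · exact_mod_cast (zero_le (a := ENNReal.ofReal d)).trans_lt hs1

/-- Singletons have diameter 0 and cost nothing for positive `s`; this settles the vertex dimension.
-/
theorem hausdorffDim_eq_zero_of_countable [Countable α] [Nonempty α] (h : ∀ x, δ x x = 0) :
    hausdorffDim δ = 0 := by
  refine le_antisymm ?_ zero_le
  rw [← ENNReal.ofReal_zero]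
  refine hausdorffDim_le fun s _ hs => ?_
  obtain ⟨f, hf⟩ := exists_surjective_nat α
  refine le_antisymm (iSup₂_le fun r hr => ?_) zero_le
  have hd : ∀ i, diam δ {f i} = 0 := fun i => by simp [diam, h]
  refine iInf₂_le_of_le (fun i => {f i}) ?_ (iInf_le_of_le (fun i => by rw [hd]; exact zero_le) ?_)
  · exact Set.eq_univ_of_forall fun x => Set.mem_iUnion.2 ((hf x).imp fun i hi => hi.symm)
  · simp [hd, ENNReal.zero_rpow_of_pos (show (0 : ℝ) < s from hs)]

/-- A cover of small measure has slightly larger bounds on the diameters with small sum. -/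
theorem exists_cover_of_hausdorffMeasure_eq_zero {s : ℝ≥0} (h : hausdorffMeasure δ s = 0) {c : ℝ}
    (hc : 0 < c) : ∃ (U : ℕ → Set α) (ℓ : ℕ → ℝ), (∀ x, ∃ i, x ∈ U i) ∧ (∀ i, 0 < ℓ i) ∧
      (∀ i, ∀ x ∈ U i, ∀ y ∈ U i, δ x y ≤ ℓ i) ∧
      ∑' i, ENNReal.ofReal (ℓ i ^ (s : ℝ)) < ENNReal.ofReal c := by
  have hc2 : ENNReal.ofReal c / 2 ≠ 0 := (ENNReal.half_pos (ENNReal.ofReal_pos.2 hc).ne').ne'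
  have h1 : (⨅ (U : ℕ → Set α) (_ : ⋃ i, U i = Set.univ)
      (_ : ∀ i, diam δ (U i) ≤ ENNReal.ofReal 1), ∑' i, diam δ (U i) ^ (s : ℝ)) <
        ENNReal.ofReal c / 2 := by
    refine lt_of_le_of_lt ?_ (pos_iff_ne_zero.2 hc2)
    rw [← h]
    exact le_iSup₂_of_le (1 : ℝ) one_pos le_rfl
  simp only [iInf_lt_iff] at h1
  obtain ⟨U, hU, hd, hsum⟩ := h1
  -- Diameters may vanish, but the mass estimate needs positive radii; `ε` pays for the enlargement.
  obtain ⟨ε, hε, hεsum⟩ := ENNReal.exists_pos_sum_of_countable' hc2 ℕ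
  have hex : ∀ i, ∃ y : ℝ≥0∞, diam δ (U i) < y ∧ y < ⊤ ∧
      y ^ (s : ℝ) < diam δ (U i) ^ (s : ℝ) + ε i := by
    intro i
    have hfin : diam δ (U i) < ⊤ := (hd i).trans_lt ENNReal.ofReal_lt_top
    have : (𝓝[>] diam δ (U i)).NeBot := nhdsGT_neBot_of_exists_gt ⟨⊤, hfin⟩
    have h2 : diam δ (U i) ^ (s : ℝ) < diam δ (U i) ^ (s : ℝ) + ε i :=
      ENNReal.lt_add_right (ENNReal.rpow_ne_top_of_nonneg s.2 hfin.ne) (hε i).ne'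
    have h3 := ((ENNReal.continuous_rpow_const (y := (s : ℝ))).tendsto
      (diam δ (U i))).eventually_lt_const h2
    obtain ⟨y, hy1, hy2, hy3⟩ := ((eventually_mem_nhdsWithin (a := diam δ (U i))
      (s := Set.Ioi (diam δ (U i)))).and
        (eventually_nhdsWithin_of_eventually_nhds (h3.and (gt_mem_nhds hfin)))).exists
    exact ⟨y, hy1, hy3, hy2⟩
  choose y hy1 hy2 hy3 using hex
  have hypos : ∀ i, 0 < (y i).toReal := fun i =>
    ENNReal.toReal_pos (zero_le.trans_lt (hy1 i)).ne' (hy2 i).ne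
  refine ⟨U, fun i => (y i).toReal, fun x => ?_, hypos, fun i x hx z hz => ?_, ?_⟩
  · exact Set.mem_iUnion.1 (hU ▸ Set.mem_univ x)
  · have h2 := (ofReal_le_diam (δ := δ) hx hz).trans (hy1 i).le
    exact (ENNReal.ofReal_le_iff_le_toReal (hy2 i).ne).1 h2
  · calc ∑' i, ENNReal.ofReal ((y i).toReal ^ (s : ℝ)) = ∑' i, y i ^ (s : ℝ) := by
          refine tsum_congr fun i => ?_
          rw [← ENNReal.ofReal_rpow_of_pos (hypos i), ENNReal.ofReal_toReal (hy2 i).ne]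
      _ ≤ ∑' i, (diam δ (U i) ^ (s : ℝ) + ε i) := ENNReal.tsum_le_tsum fun i => (hy3 i).le
      _ = ∑' i, diam δ (U i) ^ (s : ℝ) + ∑' i, ε i := ENNReal.tsum_add
      _ < ENNReal.ofReal c / 2 + ENNReal.ofReal c / 2 := ENNReal.add_lt_add hsum hεsum
      _ = ENNReal.ofReal c := ENNReal.add_halves _

end GraphDim

/-! ### Covering numbers and Hausdorff dimension of the graph limit. -/

namespace IteratedGraphSystem

variable {C : Type u} {S : IteratedGraphSystem.{u, v} C}

theorem exists_isEnd {n : ℕ} {x : S.Node} (hx : x ∈ S.nodes n) : ∃ e : S.Arc n, IsEnd e x := by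
  induction n generalizing x with
  | zero =>
    rcases x with x | ⟨k, a, x⟩
    · obtain ⟨y, hy⟩ : ∃ y, x ≠ y := by
        obtain ⟨e⟩ := S.init_nonempty
        by_cases h : x = S.init.src e
        · exact ⟨S.init.tgt e, by rw [h]; exact S.init.loopless e⟩
        · exact ⟨_, h⟩
      obtain ⟨e, he⟩ := S.init.exists_arc_of_ne hy
      exact ⟨e, he.imp (fun h => congrArg Sum.inl h.symm) fun h => congrArg Sum.inl h.symm⟩
    · rw [inr_mem_nodes] at hx; omega
  | succ n ih =>
    obtain ⟨a, z, rfl⟩ : ∃ (a : S.Arc n) (z : (S.rule (S.colour n a)).V),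
        x = S.place a (S.ends n a).1 (S.ends n a).2 z := by
      rcases mem_nodes_succ hx with h | h
      · obtain ⟨a, rfl | rfl⟩ := ih h
        · exact ⟨a, S.A _, (place_A _ _ _).symm⟩
        · exact ⟨a, S.B _, (place_B _ _ _).symm⟩
      · exact h
    obtain ⟨e, he⟩ := exists_rule_arc _ z
    refine ⟨child a e, he.imp (fun h => ?_) fun h => ?_⟩
    · rw [← h]; rfl
    · rw [← h]; rfl

/-- The total eigenvector weight is multiplied by exactly `rho` per level, and each arc has at least
the minimal weight. -/
theorem ArcWeights.exists_card_arc_le (W : S.ArcWeights) [Fintype C] :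
    ∃ c : ℝ, 0 < c ∧ ∀ n, (Fintype.card (S.Arc n) : ℝ) ≤ c * W.rho ^ n := by
  have := S.nonempty_colours
  obtain ⟨i, hi⟩ := Finite.exists_min W.w
  have hsum : ∀ n, ∑ e : S.Arc n, W.w (S.colour n e) =
      W.rho ^ n * ∑ e : S.Arc 0, W.w (S.colour 0 e) := by
    intro n
    induction n with
    | zero => simp
    | succ n ih =>
      rw [sum_arc_succ, pow_succ', mul_assoc, ← ih, Finset.mul_sum]
      exact Finset.sum_congr rfl fun a _ => W.sum_w _
  have h0 : 0 < ∑ e : S.Arc 0, W.w (S.colour 0 e) :=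
    Finset.sum_pos (fun e _ => W.w_pos _) ⟨S.init_nonempty.some, Finset.mem_univ _⟩
  refine ⟨(∑ e : S.Arc 0, W.w (S.colour 0 e)) / W.w i, div_pos h0 (W.w_pos i), fun n => ?_⟩
  rw [div_mul_eq_mul_div, le_div_iff₀ (W.w_pos i), mul_comm (∑ e : S.Arc 0, _), ← hsum]
  calc (Fintype.card (S.Arc n) : ℝ) * W.w i = ∑ _e : S.Arc n, W.w i := by simp
    _ ≤ _ := Finset.sum_le_sum fun e _ => hi _

namespace Growth

variable (H : S.Growth) (W : S.ArcWeights)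

/-- The dimension of the graph limit. -/
noncomputable def dimension : ℝ := Real.log W.rho / Real.log H.lam

theorem dimension_pos : 0 < H.dimension W :=
  div_pos (Real.log_pos W.one_lt_rho) (Real.log_pos H.one_lt_lam)

theorem rpow_dimension : H.lam ^ H.dimension W = W.rho := by
  rw [Real.rpow_def_of_pos H.lam_pos, dimension,
    mul_div_cancel₀ _ (Real.log_pos H.one_lt_lam).ne', Real.exp_log W.rho_pos]

theorem rpow_lt_rho {s : ℝ} (hs : s < H.dimension W) : H.lam ^ s < W.rho := by
  rw [← H.rpow_dimension W]
  exact Real.rpow_lt_rpow_of_exponent_lt H.one_lt_lam hs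

variable [Fintype C]

/-- Every node is within `κ / lam ^ m` of a node of Ξ^m, which is an end of an arc; balls about both
ends of all arcs therefore cover. -/
theorem coveringNumber_le {m : ℕ} {ℓ : ℝ} (hℓ : 2 * (H.κ / H.lam ^ m) < ℓ) :
    GraphDim.coveringNumber S.limitDist ℓ ≤ ((2 * Fintype.card (S.Arc m) : ℕ) : ℕ∞) := by
  have hκ : 0 < H.κ / H.lam ^ m := div_pos H.κ_pos (H.lam_pow_pos m)
  have h := GraphDim.coveringNumber_le (δ := S.limitDist) (ℓ := ℓ)
    (fun p : S.Arc m × Bool => {x | S.limitDist x (if p.2 then (S.ends m p.1).1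
      else (S.ends m p.1).2) ≤ H.κ / H.lam ^ m}) (fun x => ?_) fun p => ?_
  · refine h.trans ?_
    rw [Fintype.card_prod, Fintype.card_bool, mul_comm]
  · obtain ⟨p, hp, hxp⟩ := H.exists_near_limitDist m x
    obtain ⟨e, rfl | rfl⟩ := exists_isEnd hp
    · exact ⟨(e, true), by simpa using hxp⟩
    · exact ⟨(e, false), by simpa using hxp⟩
  · refine lt_of_le_of_lt (GraphDim.diam_le fun x hx y hy => ?_)
      ((ENNReal.ofReal_lt_ofReal_iff (by linarith)).2 hℓ)
    have h1 := H.limitDist_triangle x (if p.2 then (S.ends m p.1).1 else (S.ends m p.1).2) y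
    rw [H.limitDist_comm (if p.2 then (S.ends m p.1).1 else (S.ends m p.1).2) y] at h1
    exact (h1.trans (add_le_add hx hy)).trans_eq (two_mul _).symm

theorem exists_level {ℓ : ℝ} (hℓ : 0 < ℓ) : ∃ m, 2 * (H.κ / H.lam ^ m) < ℓ := by
  have := H.tendsto_κ.const_mul 2
  rw [mul_zero] at this
  exact (this.eventually_lt_const hℓ).exists

theorem coveringNumber_ne_top (H : S.Growth) {ℓ : ℝ} (hℓ : 0 < ℓ) : GraphDim.coveringNumber S.limitDist ℓ ≠ ⊤ := by
  obtain ⟨m, hm⟩ := H.exists_level hℓ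
  exact ne_top_of_le_ne_top (ENat.natCast_ne_top _) (H.coveringNumber_le hm)

theorem exists_coveringNumber_le : ∃ c : ℝ, 0 < c ∧ ∀ ℓ, 0 < ℓ → ℓ < 1 →
    ((GraphDim.coveringNumber S.limitDist ℓ).toNat : ℝ) ≤ c * (ℓ ^ H.dimension W)⁻¹ := by
  obtain ⟨c, hc, hcard⟩ := W.exists_card_arc_le
  have hκ := H.κ_pos
  have hd := H.dimension_pos W
  have hρ := W.rho_pos
  have hκd : 0 < (2 * H.κ) ^ H.dimension W := Real.rpow_pos_of_pos (by linarith) _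
  refine ⟨2 * c * (1 + W.rho * (2 * H.κ) ^ H.dimension W), by positivity, fun ℓ hℓ hℓ1 => ?_⟩
  have hℓd : 0 < ℓ ^ H.dimension W := Real.rpow_pos_of_pos hℓ _
  set m := Nat.find (H.exists_level hℓ)
  -- As `m` is the first sufficiently fine level, `lam ^ (m - 1)` is at most 2κ/ℓ when m > 0, and
  -- its power with exponent `dimension` is `rho ^ (m - 1)`. The summand 1 in the constant covers m
  -- = 0.
  have hm : 2 * (H.κ / H.lam ^ m) < ℓ := Nat.find_spec (H.exists_level hℓ)
  have h1 : ((GraphDim.coveringNumber S.limitDist ℓ).toNat : ℝ) ≤ 2 * (c * W.rho ^ m) := by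
    have h2 := ENat.toNat_le_of_le_natCast (H.coveringNumber_le hm)
    have h3 : ((GraphDim.coveringNumber S.limitDist ℓ).toNat : ℝ) ≤
        2 * (Fintype.card (S.Arc m) : ℝ) := by exact_mod_cast h2
    exact h3.trans (mul_le_mul_of_nonneg_left (hcard m) zero_le_two)
  have h4 : W.rho ^ m ≤ (1 + W.rho * (2 * H.κ) ^ H.dimension W) * (ℓ ^ H.dimension W)⁻¹ := by
    have hinv : 1 ≤ (ℓ ^ H.dimension W)⁻¹ :=
      (one_le_inv₀ hℓd).2 (Real.rpow_le_one hℓ.le hℓ1.le hd.le)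
    rcases hmk : m with _ | k
    · rw [pow_zero]
      refine hinv.trans (le_mul_of_one_le_left (inv_pos.2 hℓd).le ?_)
      have : 0 < W.rho * (2 * H.κ) ^ H.dimension W := by positivity
      linarith
    · have hk : ¬ 2 * (H.κ / H.lam ^ k) < ℓ := Nat.find_min (H.exists_level hℓ) (by
        change k < m; omega)
      rw [not_lt, ← mul_div_assoc, le_div_iff₀ (H.lam_pow_pos k)] at hk
      have h5 : W.rho ^ k ≤ (2 * H.κ) ^ H.dimension W * (ℓ ^ H.dimension W)⁻¹ := by
        rw [← div_eq_mul_inv, le_div_iff₀ hℓd, ← H.rpow_dimension W, ← Real.rpow_natCast,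
          ← Real.rpow_mul H.lam_pos.le, mul_comm (H.dimension W), Real.rpow_mul H.lam_pos.le,
          Real.rpow_natCast, ← Real.mul_rpow (H.lam_pow_pos k).le hℓ.le, mul_comm]
        exact Real.rpow_le_rpow (mul_pos hℓ (H.lam_pow_pos k)).le hk hd.le
      calc W.rho ^ (k + 1) = W.rho * W.rho ^ k := pow_succ' _ _
        _ ≤ W.rho * ((2 * H.κ) ^ H.dimension W * (ℓ ^ H.dimension W)⁻¹) :=
            mul_le_mul_of_nonneg_left h5 hρ.le
        _ ≤ _ := by
            rw [← mul_assoc]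
            exact mul_le_mul_of_nonneg_right (by linarith) (inv_pos.2 hℓd).le
  calc _ ≤ 2 * (c * W.rho ^ m) := h1
    _ ≤ 2 * (c * ((1 + W.rho * (2 * H.κ) ^ H.dimension W) * (ℓ ^ H.dimension W)⁻¹)) := by gcongr
    _ = _ := by ring

/-- A finite node cover induces a cover of the limit arcs: by pigeonhole, some member contains
infinitely many of the beginning nodes of a given limit arc. Limit arcs assigned to one member are
at distance at most ℓ, so the mass estimate bounds the number of members. -/
theorem exists_le_coveringNumber {s : ℝ} (hs : 0 ≤ s) (hsd : s < H.dimension W) :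
    ∃ c : ℝ, 0 < c ∧ ∀ ℓ, 0 < ℓ → ℓ < 1 →
      c * (ℓ ^ s)⁻¹ ≤ ((GraphDim.coveringNumber S.limitDist ℓ).toNat : ℝ) := by
  obtain ⟨c, hc, hcov⟩ := exists_le_tsum_of_cover H W hs (H.rpow_lt_rho W hsd)
  refine ⟨c, hc, fun ℓ hℓ _ => ?_⟩
  have hℓs : 0 < ℓ ^ s := Real.rpow_pos_of_pos hℓ s
  obtain ⟨𝒰, hU, hd, hfin, hcard⟩ :=
    GraphDim.exists_cover_of_coveringNumber (H.coveringNumber_ne_top hℓ)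
  have := hfin.fintype
  have h1 := hcov (ι := 𝒰)
    (fun i => {e | ∃ᶠ n in atTop, (S.ends n (e.1 n)).1 ∈ i.1}) (fun _ => ℓ) (fun e => ?_)
    (fun _ => hℓ) (fun i e he f hf => ?_)
  · rw [tsum_fintype, Finset.sum_const, nsmul_eq_mul, Finset.card_univ, ← Nat.card_eq_fintype_card,
      Nat.card_coe_set_eq] at h1
    have h2 : ENNReal.ofReal c ≤ ENNReal.ofReal (𝒰.ncard * ℓ ^ s) := by
      rwa [ENNReal.ofReal_mul (Nat.cast_nonneg _), ENNReal.ofReal_natCast]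
    have h3 := (ENNReal.ofReal_le_ofReal_iff (by positivity)).1 h2
    rw [← div_eq_mul_inv, div_le_iff₀ hℓs]
    refine h3.trans (mul_le_mul_of_nonneg_right ?_ hℓs.le)
    exact_mod_cast hcard
  · by_contra hcon
    simp only [Set.mem_ofPred_eq, not_exists, not_frequently] at hcon
    obtain ⟨n, hn⟩ := (eventually_all.2 hcon).exists
    have hx : (S.ends n (e.1 n)).1 ∈ ⋃₀ 𝒰 := hU ▸ Set.mem_univ _
    obtain ⟨V, hV, hxV⟩ := hx
    exact hn ⟨V, hV⟩ hxV
  · have hlim : Tendsto (fun N : ℕ => H.κ / H.lam ^ N + ℓ + H.κ / H.lam ^ N) atTop (𝓝 ℓ) := by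
      simpa using (H.tendsto_κ.add_const ℓ).add H.tendsto_κ
    refine le_of_tendsto_of_tendsto' (H.tendsto_limitArcDist e f) hlim fun N => ?_
    obtain ⟨n, hn, hen⟩ := (frequently_atTop.1 he) N
    obtain ⟨m, hm, hfm⟩ := (frequently_atTop.1 hf) N
    have h1 := H.limitDist_arc_le e hn
    have h2 := H.limitDist_arc_le f hm
    rw [H.limitDist_comm] at h2
    have h3 : S.limitDist (S.ends n (e.1 n)).1 (S.ends m (f.1 m)).1 < ℓ :=
      (ENNReal.ofReal_lt_ofReal_iff hℓ).1
        ((GraphDim.ofReal_le_diam hen hfm).trans_lt (hd i.1 i.2))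
    have h4 := H.limitDist_triangle (S.ends N (e.1 N)).1 (S.ends n (e.1 n)).1 (S.ends N (f.1 N)).1
    have h5 := H.limitDist_triangle (S.ends n (e.1 n)).1 (S.ends m (f.1 m)).1 (S.ends N (f.1 N)).1
    linarith

theorem hasMinkowskiDim : S.HasMinkowskiDim (H.dimension W) :=
  ⟨fun _ hℓ => H.coveringNumber_ne_top hℓ,
    GraphDim.tendsto_log_div_log (H.dimension_pos W) (H.exists_coveringNumber_le W)
      fun _ hs hsd => H.exists_le_coveringNumber W hs hsd⟩

/-- The O(ρ^m) cylinders of level m have diameter at most `2 * κ / lam ^ m`; their total cost tends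
to 0 once λ^s > ρ. -/
theorem hausdorffMeasure_arc_eq_zero {s : ℝ≥0} (hs : H.dimension W < s) (hs0 : 0 < s) :
    GraphDim.hausdorffMeasure S.limitArcDist s = 0 := by
  obtain ⟨c, hc, hcard⟩ := W.exists_card_arc_le
  have hs0' : (0 : ℝ) < s := hs0
  have hκ : 0 < 2 * H.κ := by linarith [H.κ_pos]
  have hlt : W.rho < H.lam ^ (s : ℝ) := by
    rw [← H.rpow_dimension W]
    exact Real.rpow_lt_rpow_of_exponent_lt H.one_lt_lam hs
  have hq : 0 < H.lam ^ (s : ℝ) := W.rho_pos.trans hlt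
  refine le_antisymm (iSup₂_le fun r hr => ?_) zero_le
  have hlim : Tendsto (fun m : ℕ => ENNReal.ofReal
      (c * (2 * H.κ) ^ (s : ℝ) * (W.rho / H.lam ^ (s : ℝ)) ^ m)) atTop (𝓝 0) := by
    have h1 := (tendsto_pow_atTop_nhds_zero_of_lt_one (div_nonneg W.rho_pos.le hq.le)
      ((div_lt_one hq).2 hlt)).const_mul (c * (2 * H.κ) ^ (s : ℝ))
    rw [mul_zero] at h1
    simpa using ENNReal.tendsto_ofReal h1
  refine ge_of_tendsto hlim ?_
  have hsmall : ∀ᶠ m : ℕ in atTop, 2 * H.κ / H.lam ^ m < r :=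
    ((tendsto_pow_atTop_atTop_of_one_lt H.one_lt_lam).const_div_atTop (2 * H.κ)).eventually_lt_const
      hr
  filter_upwards [hsmall] with m hm
  have h1 := GraphDim.premeasure_le_of_fintype_cover (δ := S.limitArcDist) hs0' hm.le
    (fun a : S.Arc m => {e : S.LimitArc | e.1 m = a}) (fun e => ⟨e.1 m, rfl⟩)
    (fun a => GraphDim.diam_le fun e he f hf =>
      H.limitArcDist_le_of_eq ((show e.1 m = a from he).trans (show f.1 m = a from hf).symm))
  refine h1.trans ?_
  have ht : 0 < 2 * H.κ / H.lam ^ m := div_pos hκ (H.lam_pow_pos m)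
  rw [ENNReal.ofReal_rpow_of_pos ht, ← ENNReal.ofReal_natCast,
    ← ENNReal.ofReal_mul (Nat.cast_nonneg _)]
  refine ENNReal.ofReal_le_ofReal ?_
  refine (mul_le_mul_of_nonneg_right (hcard m) (Real.rpow_nonneg ht.le _)).trans_eq ?_
  have h2 : (H.lam ^ m) ^ (s : ℝ) = (H.lam ^ (s : ℝ)) ^ m := by
    rw [← Real.rpow_natCast, ← Real.rpow_mul H.lam_pos.le, mul_comm, Real.rpow_mul H.lam_pos.le,
      Real.rpow_natCast]
  rw [Real.div_rpow hκ.le (H.lam_pow_pos m).le, h2, div_pow]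
  ring

theorem hausdorffDim_eq : S.hausdorffDim = ENNReal.ofReal (H.dimension W) := by
  have : Nonempty S.Node := ⟨Sum.inl (S.init.src S.init_nonempty.some)⟩
  rw [hausdorffDim, GraphDim.hausdorffDim_eq_zero_of_countable H.limitDist_self,
    max_eq_right zero_le]
  refine le_antisymm (GraphDim.hausdorffDim_le fun s hs hs0 =>
    H.hausdorffMeasure_arc_eq_zero W hs hs0) (le_iInf₂ fun s hs => ?_)
  rw [← ENNReal.ofReal_coe_nnreal]
  refine ENNReal.ofReal_le_ofReal ?_
  by_contra! hlt
  obtain ⟨c, hc, hcov⟩ := exists_le_tsum_of_cover H W s.2 (H.rpow_lt_rho W hlt)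
  obtain ⟨U, ℓ, hU, hℓ, hd, hsum⟩ := GraphDim.exists_cover_of_hausdorffMeasure_eq_zero hs hc
  exact absurd (hcov U ℓ hU hℓ hd) (not_le.2 hsum)

end Growth

end IteratedGraphSystem

theorem mainTheorem1 {C : Type u} [Fintype C] [DecidableEq C] (S : IteratedGraphSystem.{u, v} C)
    (hS : S.IsPrimitive) :
    S.LimitExists ∧
    S.HasMinkowskiDim
      (Real.log (IteratedGraphSystem.specRadius S.M) / Real.log S.rhoMin) ∧
    S.hausdorffDim = ENNReal.ofReal
      (Real.log (IteratedGraphSystem.specRadius S.M) / Real.log S.rhoMin) := by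
  obtain ⟨H, hH⟩ := hS.exists_growth
  obtain ⟨W, hW⟩ := hS.exists_arcWeights
  rw [← hH, ← hW]
  exact ⟨H.limitExists, H.hasMinkowskiDim W, H.hausdorffDim_eq W⟩
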